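/- **Setting.** Let $S$ be a compact connected Riemann surface, $P=\{p_1,\dots,p_n\}\subset S$ a finite non-empty set of punctures, $S'=S\setminus P$, and for each $i$ let $h_i$ be a germ at $p_i$ of a meromorphic function with a pole at $p_i$; write $\mathcal H=\{h_1,\dots,h_n\}$. (A log-Riemann surface of finite type $S^*$ with at least one ramification point of infinite order is given by such a surface $S'$ together with a map $\pi$ whose differential $d\pi$ has exponential singularities at the $p_i$; one takes $h_i$ to be their types. The objects below depend only on $(S,\mathcal H)$, and the statement holds for all such pairs.) A function $f$ (resp. $1$-form $\omega$) has an *exponential singularity of type $h_i$* at $p_i$ if near $p_i$ it is $g\,e^{h_i}$ (resp. $e^{h_i}\alpha$) with $g$ a germ of meromorphic function (resp. $\alpha$ a germ of meromorphic $1$-form) at $p_i$. Let $\mathcal M(S^*)$ (resp. $\Omega(S^*)$) be the space of meromorphic functions (resp. $1$-forms) on $S'$ with exponential singularities of types $h_1,\dots,h_n$ at $p_1,\dots,p_n$; let $\mathcal O(S^*)\subset\mathcal M(S^*)$ and $\Omega^0(S^*)\subset\Omega(S^*)$ be the subspaces of elements that are holomorphic on $S'$, and let $\Omega_{II}(S^*)\subset\Omega(S^*)$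 be the subspace of forms all of whose residues at points of $S'$ vanish. The divisor of a nonzero element of $\mathcal M(S^*)$ or $\Omega(S^*)$ is its order at the points of $S'$, and the order of $g$, resp. $\alpha$, at the points $p_i$. Choose pairwise disjoint open neighbourhoods $B_i$ of the $p_i$ such that $h_i$ is holomorphic on $B_i\setminus\{p_i\}$, and an open set $V\subset S'$ such that $V,B_1,\dots,B_n$ cover $S$ (for instance disks $B_i$ that $V$ meets in annuli). Let $L_{\mathcal H}$ be the holomorphic line bundle on $S$ that is trivial over $V$ and over each $B_i$, with transition function $e^{-h_i}$ on $V\cap B_i$ (from the coordinate over $V$ to the coordinate over $B_i$). Let $s_{\mathcal H}$ be its non-vanishing holomorphic section over $S'$ given by $1$ over $V$ and by $e^{-h_i}$ over $B_i\setminus\{p_i\}$, and let $s^*_{\mathcal H}$ be the section of the dual bundle over $S'$ with $s_{\mathcal H}\otimes s^*_{\mathcal H}=1$. **Theorem.** Such choices exist, and for every such choice the following hold. 1. $L_{\mathcal H}$ has degree zero, that is, it has a nonzero meromorphic section, and the divisor of every nonzero meromorphic section is finite and has degree $0$. 2. The maps $s\mapsto s\otimes s^*_{\mathcal H}$ and $f\mapsto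 f\cdot s_{\mathcal H}$ are mutually inverse linear isomorphisms between the space of meromorphic sections of $L_{\mathcal H}$ over $S$ and $\mathcal M(S^*)$, and they preserve divisors. 3. The maps $\alpha\mapsto\alpha\otimes s^*_{\mathcal H}$ and $\omega\mapsto\omega\cdot s_{\mathcal H}$ are mutually inverse linear isomorphisms between the space of meromorphic $L_{\mathcal H}$-valued $1$-forms on $S$ and $\Omega(S^*)$, and they preserve divisors. Moreover the vector spaces $\mathcal M(S^*)$, $\mathcal O(S^*)$, $\Omega(S^*)$, $\Omega_{II}(S^*)$ and $\Omega^0(S^*)$ are all nonzero. -/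

import Mathlib

open scoped Manifold Topology ContDiff Bundle
open Filter Set

noncomputable section

set_option linter.unusedSectionVars false

namespace ExpAlg

/-! ### Functions, forms and sections on a Riemann surface -/

section Basic

variable {S : Type*} [TopologicalSpace S] [ChartedSpace ℂ S]

/-- The function `f` is meromorphic at `p`, read in the preferred chart at `p`. The value at a single
point never matters for this notion. -/
def MeroAt (f : S → ℂ) (p : S) : Prop :=
  MeromorphicAt (f ∘ (chartAt ℂ p).symm) (chartAt ℂ p p)

/-- The order of the meromorphic germ `f` at `p`; it is `⊤` if `f` vanishes on a punctured
neighbourhood of `p`. -/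
def ord (f : S → ℂ) (p : S) : WithTop ℤ :=
  meromorphicOrderAt (f ∘ (chartAt ℂ p).symm) (chartAt ℂ p p)

/-- The function `f` is holomorphic near `p`. -/
def HolAt (f : S → ℂ) (p : S) : Prop :=
  ContMDiffAt 𝓘(ℂ) 𝓘(ℂ) ω f p

/-- The functions (or sections, or forms) that vanish off a closed discrete subset of `S`. -/
def nullOff (E : S → Type*) [∀ x, AddCommGroup (E x)] [∀ x, Module ℂ (E x)] :
    Submodule ℂ (Π x, E x) where
  carrier := {f | ∀ᶠ x in codiscrete S, f x = 0}
  add_mem' := by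
    intro f g hf hg
    rw [mem_ofPred_eq] at hf hg ⊢
    filter_upwards [hf, hg] with x h1 h2
    simp [h1, h2]
  zero_mem' := by simp
  smul_mem' := by
    intro c f hf
    rw [mem_ofPred_eq] at hf ⊢
    filter_upwards [hf] with x h
    simp [h]

/-- Meromorphic objects are identified when they agree off a closed discrete subset, since the values
at poles carry no meaning: the elements of `A`, up to this identification. -/
abbrev Classes {E : S → Type*} [∀ x, AddCommGroup (E x)] [∀ x, Module ℂ (E x)]
    (A : Submodule ℂ (Π x, E x)) : Type _ :=
  A ⧸ (nullOff E).submoduleOf A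

/-- The class of a representative. -/
abbrev cls {E : S → Type*} [∀ x, AddCommGroup (E x)] [∀ x, Module ℂ (E x)]
    (A : Submodule ℂ (Π x, E x)) (f : A) : Classes A :=
  Submodule.Quotient.mk f

theorem tendsto_chart_symm (p : S) :
    Tendsto (chartAt ℂ p).symm (𝓝 (chartAt ℂ p p)) (𝓝 p) := by
  have h := (chartAt ℂ p).continuousAt_symm (mem_chart_target ℂ p)
  rw [ContinuousAt, (chartAt ℂ p).left_inv (mem_chart_source ℂ p)] at h
  exact h

theorem tendsto_chart_symm_punctured (p : S) :
    Tendsto (chartAt ℂ p).symm (𝓝[≠] (chartAt ℂ p p)) (𝓝[≠] p) := by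
  refine tendsto_nhdsWithin_iff.2
    ⟨(tendsto_chart_symm p).mono_left nhdsWithin_le_nhds, ?_⟩
  have ht : (chartAt ℂ p).target ∈ 𝓝[≠] (chartAt ℂ p p) :=
    mem_nhdsWithin_of_mem_nhds
      ((chartAt ℂ p).open_target.mem_nhds (mem_chart_target ℂ p))
  filter_upwards [ht, self_mem_nhdsWithin] with z hz hne h
  apply hne
  have := (chartAt ℂ p).right_inv hz
  rw [mem_singleton_iff] at h ⊢
  rw [← this, h]

theorem MeroAt.congr {f g : S → ℂ} {p : S} (hf : MeroAt f p)
    (h : ∀ᶠ x in 𝓝[≠] p, f x = g x) : MeroAt g p :=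
  MeromorphicAt.congr hf ((tendsto_chart_symm_punctured p).eventually h)

theorem MeroAt.add {f g : S → ℂ} {p : S} (hf : MeroAt f p) (hg : MeroAt g p) :
    MeroAt (fun x => f x + g x) p :=
  MeromorphicAt.add hf hg

theorem MeroAt.const_mul {f : S → ℂ} {p : S} (c : ℂ) (hf : MeroAt f p) :
    MeroAt (fun x => c * f x) p :=
  MeromorphicAt.mul (MeromorphicAt.const c _) hf

theorem MeroAt.zero (p : S) : MeroAt (fun _ => 0) p :=
  MeromorphicAt.const 0 _

section Sections

variable [IsManifold 𝓘(ℂ) ω S]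
variable (L : S → Type*) [∀ x, AddCommGroup (L x)] [∀ x, Module ℂ (L x)]

/-- A (not necessarily continuous) `1`-form on `S` with values in `L`. -/
abbrev Form : Type _ := Π x : S, TangentSpace 𝓘(ℂ) x →ₗ[ℂ] L x

/-- A (not necessarily continuous) scalar `1`-form on `S`. -/
abbrev SForm (S : Type*) [TopologicalSpace S] [ChartedSpace ℂ S] : Type _ :=
  Π x : S, TangentSpace 𝓘(ℂ) x →ₗ[ℂ] ℂ

/-- The coordinate vector field `∂/∂z`, where `z` is the preferred chart at `p`; it is meaningful
on the domain of that chart. -/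
def coordVec (p x : S) : TangentSpace 𝓘(ℂ) x :=
  (trivializationAt ℂ (TangentSpace 𝓘(ℂ) : S → Type _) p).symm x (1 : ℂ)

/-- The coefficient `a` of `ω = a dz` in the preferred chart `z` at `p`. -/
def coeff (w : SForm S) (p : S) : S → ℂ := fun x => w x (coordVec p x)

/-- A scalar `1`-form is meromorphic at `p`. -/
def FormMeroAt (w : SForm S) (p : S) : Prop := MeroAt (coeff w p) p

/-- A scalar `1`-form is holomorphic near `p`. -/
def FormHolAt (w : SForm S) (p : S) : Prop := HolAt (coeff w p) p

/-- The residue of the meromorphic `1`-form at `p` is zero. -/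
def ResidueZeroAt (w : SForm S) (p : S) : Prop :=
  ∀ᶠ r in 𝓝[>] (0 : ℝ),
    circleIntegral (coeff w p ∘ (chartAt ℂ p).symm) (chartAt ℂ p p) r = 0

theorem FormMeroAt.circleIntegrable {w : SForm S} {p : S} (hw : FormMeroAt w p) :
    ∀ᶠ r in 𝓝[>] (0 : ℝ),
      CircleIntegrable (coeff w p ∘ (chartAt ℂ p).symm) (chartAt ℂ p p) r := by
  have h := MeromorphicAt.eventually_continuousAt hw
  rw [eventually_nhdsWithin_iff, Metric.eventually_nhds_iff] at h
  obtain ⟨e, he, h⟩ := h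
  filter_upwards [Ioo_mem_nhdsGT he] with r hr
  apply ContinuousOn.circleIntegrable hr.1.le
  intro z hz
  rw [Metric.mem_sphere] at hz
  refine (h (hz ▸ hr.2) ?_).continuousWithinAt
  rintro rfl
  rw [dist_self] at hz
  exact hr.1.ne hz

variable [TopologicalSpace (Bundle.TotalSpace ℂ L)] [∀ x, TopologicalSpace (L x)]
  [FiberBundle ℂ L]

variable {L} in
/-- The section `s` read in the preferred local trivialization of the line bundle at `p`. -/
def localRep (s : Π x, L x) (p : S) : S → ℂ := fun x => (trivializationAt ℂ L p ⟨x, s x⟩).2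

variable {L} in
/-- The order of a meromorphic section at `p`; the function `p ↦ secOrd s p` is its divisor. -/
def secOrd (s : Π x, L x) (p : S) : WithTop ℤ := ord (localRep s p) p

variable {L} in
/-- The section `α(∂/∂z)` obtained from the `L`-valued form `α = s ⊗ dz`, in the chart at `p`. -/
def formSec (a : Form L) (p : S) : Π x, L x := fun x => a x (coordVec p x)

variable {L} in
/-- The order of a meromorphic `L`-valued `1`-form at `p`; the function `p ↦ formSecOrd α p` is its
divisor. -/
def formSecOrd (a : Form L) (p : S) : WithTop ℤ := secOrd (formSec a p) p

variable [VectorBundle ℂ ℂ L]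

theorem localRep_add (s t : Π x, L x) (p : S) :
    ∀ᶠ x in 𝓝[≠] p, localRep s p x + localRep t p x = localRep (s + t) p x := by
  have hb : (trivializationAt ℂ L p).baseSet ∈ 𝓝[≠] p :=
    mem_nhdsWithin_of_mem_nhds
      ((trivializationAt ℂ L p).open_baseSet.mem_nhds (FiberBundle.mem_baseSet_trivializationAt ℂ L p))
  filter_upwards [hb] with x hx
  exact (((trivializationAt ℂ L p).linear ℂ hx).map_add (s x) (t x)).symm

theorem localRep_smul (c : ℂ) (s : Π x, L x) (p : S) :
    ∀ᶠ x in 𝓝[≠] p, c * localRep s p x = localRep (c • s) p x := by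
  have hb : (trivializationAt ℂ L p).baseSet ∈ 𝓝[≠] p :=
    mem_nhdsWithin_of_mem_nhds
      ((trivializationAt ℂ L p).open_baseSet.mem_nhds (FiberBundle.mem_baseSet_trivializationAt ℂ L p))
  filter_upwards [hb] with x hx
  exact (((trivializationAt ℂ L p).linear ℂ hx).map_smul c (s x)).symm

theorem localRep_zero (p : S) :
    ∀ᶠ x in 𝓝[≠] p, 0 = localRep (0 : Π x, L x) p x := by
  filter_upwards [localRep_smul L 0 (0 : Π x, L x) p] with x hx
  simpa using hx

/-- The meromorphic sections of the line bundle `L` over `S`. -/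
def meroSections : Submodule ℂ (Π x, L x) where
  carrier := {s | ∀ p, MeroAt (localRep s p) p}
  add_mem' := fun hs ht p => ((hs p).add (ht p)).congr (localRep_add L _ _ p)
  zero_mem' := fun p => (MeroAt.zero p).congr (localRep_zero L p)
  smul_mem' := fun c _ hs p => ((hs p).const_mul c).congr (localRep_smul L c _ p)

/-- The meromorphic `1`-forms on `S` with values in the line bundle `L`. -/
def meroForms : Submodule ℂ (Form L) where
  carrier := {a | ∀ p, MeroAt (localRep (formSec a p) p) p}
  add_mem' := fun hs ht p => ((hs p).add (ht p)).congr (localRep_add L _ _ p)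
  zero_mem' := fun p => (MeroAt.zero p).congr (localRep_zero L p)
  smul_mem' := fun c _ hs p => ((hs p).const_mul c).congr (localRep_smul L c _ p)

/-- The holomorphic line bundle `L` has degree `d`: there is a nonzero meromorphic section, and the
divisor of every nonzero meromorphic section is finite, of degree `d`. -/
def HasDegree [ContMDiffVectorBundle ω ℂ L 𝓘(ℂ)] (d : ℤ) : Prop :=
  Nontrivial (Classes (meroSections L)) ∧
    ∀ s : meroSections L, cls (meroSections L) s ≠ 0 →
      ∃ D : S →₀ ℤ, (∀ p, secOrd s.1 p = (D p : WithTop ℤ)) ∧ (D.sum fun _ m => m) = d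

end Sections

end Basic

/-! ### Exp-algebraic curves and their function spaces -/

/-- The data of an exp-algebraic curve on a Riemann surface `S`: a finite non-empty set `P` of
punctures, and at each puncture `p` the germ at `p` of a function `h p`, meromorphic with a pole
at `p`. -/
structure ExpCurve (S : Type*) [TopologicalSpace S] [ChartedSpace ℂ S] where
  P : Finset S
  nonempty : P.Nonempty
  h : P → S → ℂ
  mero : ∀ p : P, MeroAt (h p) p
  pole : ∀ p : P, ord (h p) p < 0

namespace ExpCurve

variable {S : Type*} [TopologicalSpace S] [ChartedSpace ℂ S]

/-- The function `f` has an exponential singularity of type `h` at `p`: it is `g * exp h` near `p`,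
with `g` meromorphic at `p`. -/
def HasExpType (h f : S → ℂ) (p : S) : Prop :=
  ∃ g : S → ℂ, MeroAt g p ∧ ∀ᶠ x in 𝓝[≠] p, f x = g x * Complex.exp (h x)

/-- The `1`-form `w` has an exponential singularity of type `h` at `p`. -/
def FormHasExpType [IsManifold 𝓘(ℂ) ω S] (h : S → ℂ) (w : SForm S) (p : S) : Prop :=
  ∃ b : SForm S, FormMeroAt b p ∧ ∀ᶠ x in 𝓝[≠] p, w x = Complex.exp (h x) • b x

theorem HasExpType.add {h f g : S → ℂ} {p : S} (hf : HasExpType h f p) (hg : HasExpType h g p) :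
    HasExpType h (f + g) p := by
  obtain ⟨a, ha, ha'⟩ := hf
  obtain ⟨b, hb, hb'⟩ := hg
  refine ⟨_, ha.add hb, ?_⟩
  filter_upwards [ha', hb'] with x h1 h2
  simp [h1, h2, add_mul]

theorem HasExpType.smul {h f : S → ℂ} {p : S} (c : ℂ) (hf : HasExpType h f p) :
    HasExpType h (c • f) p := by
  obtain ⟨a, ha, ha'⟩ := hf
  refine ⟨_, ha.const_mul c, ?_⟩
  filter_upwards [ha'] with x h1
  simp [h1, mul_assoc]

theorem HasExpType.zero (h : S → ℂ) (p : S) : HasExpType h 0 p :=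
  ⟨fun _ => 0, MeroAt.zero p, by simp⟩

theorem FormHasExpType.add [IsManifold 𝓘(ℂ) ω S] {h : S → ℂ} {v w : SForm S} {p : S}
    (hv : FormHasExpType h v p) (hw : FormHasExpType h w p) : FormHasExpType h (v + w) p := by
  obtain ⟨a, ha, ha'⟩ := hv
  obtain ⟨b, hb, hb'⟩ := hw
  refine ⟨a + b, MeroAt.add ha hb, ?_⟩
  filter_upwards [ha', hb'] with x h1 h2
  simp [h1, h2]

theorem FormHasExpType.smul [IsManifold 𝓘(ℂ) ω S] {h : S → ℂ} {w : SForm S} {p : S} (c : ℂ)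
    (hw : FormHasExpType h w p) : FormHasExpType h (c • w) p := by
  obtain ⟨a, ha, ha'⟩ := hw
  refine ⟨c • a, MeroAt.const_mul c ha, ?_⟩
  filter_upwards [ha'] with x h1
  simp [h1, smul_comm c]

theorem FormHasExpType.zero [IsManifold 𝓘(ℂ) ω S] (h : S → ℂ) (p : S) :
    FormHasExpType h (0 : SForm S) p :=
  ⟨0, MeroAt.zero p, by simp⟩

variable (X : ExpCurve S)

/-- The meromorphic functions on `S' = S \ P` with exponential singularities of types `h p` at the
punctures; the values at the punctures are irrelevant. -/
def M : Submodule ℂ (S → ℂ) where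
  carrier := {f | (∀ p ∉ X.P, MeroAt f p) ∧ ∀ p : X.P, HasExpType (X.h p) f p}
  add_mem' := fun hf hg =>
    ⟨fun p hp => (hf.1 p hp).add (hg.1 p hp), fun p => (hf.2 p).add (hg.2 p)⟩
  zero_mem' := ⟨fun p _ => MeroAt.zero p, fun _ => HasExpType.zero _ _⟩
  smul_mem' := fun c _ hf =>
    ⟨fun p hp => (hf.1 p hp).const_mul c, fun p => (hf.2 p).smul c⟩

/-- The functions in `M` that are holomorphic on `S'`. -/
def O : Submodule ℂ (S → ℂ) where
  carrier := {f | f ∈ X.M ∧ ∀ p ∉ X.P, HolAt f p}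
  add_mem' := fun hf hg =>
    ⟨X.M.add_mem hf.1 hg.1, fun p hp => ContMDiffAt.add (hf.2 p hp) (hg.2 p hp)⟩
  zero_mem' := ⟨X.M.zero_mem, fun p _ => contMDiffAt_const⟩
  smul_mem' := fun c _ hf =>
    ⟨X.M.smul_mem c hf.1, fun p hp => ContMDiffAt.smul (contMDiffAt_const : HolAt (fun _ : S => c) p) (hf.2 p hp)⟩

/-- The divisor of an element `f` of `M`: the order of `f` at the points of `S'`, and the order of the
meromorphic germ `g = f * exp (-h)` at the punctures. It is constantly `⊤` for `f = 0`. -/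
def div (f : S → ℂ) (p : S) : WithTop ℤ :=
  open Classical in
  if hp : p ∈ X.P then ord (fun x => f x * Complex.exp (-X.h ⟨p, hp⟩ x)) p else ord f p

section Forms

variable [IsManifold 𝓘(ℂ) ω S]

/-- The meromorphic `1`-forms on `S'` with exponential singularities of types `h p` at the
punctures. -/
def Om : Submodule ℂ (SForm S) where
  carrier := {w | (∀ p ∉ X.P, FormMeroAt w p) ∧ ∀ p : X.P, FormHasExpType (X.h p) w p}
  add_mem' := fun hf hg =>
    ⟨fun p hp => MeroAt.add (hf.1 p hp) (hg.1 p hp), fun p => (hf.2 p).add (hg.2 p)⟩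
  zero_mem' := ⟨fun p _ => MeroAt.zero p, fun _ => FormHasExpType.zero _ _⟩
  smul_mem' := fun c _ hf =>
    ⟨fun p hp => MeroAt.const_mul c (hf.1 p hp), fun p => (hf.2 p).smul c⟩

/-- The `1`-forms in `Om` of the second kind: all residues at the points of `S'` are zero. -/
def OmII : Submodule ℂ (SForm S) where
  carrier := {w | w ∈ X.Om ∧ ∀ p ∉ X.P, ResidueZeroAt w p}
  add_mem' := by
    intro v w hv hw
    refine ⟨X.Om.add_mem hv.1 hw.1, fun p hp => ?_⟩
    filter_upwards [hv.2 p hp, hw.2 p hp, (hv.1.1 p hp).circleIntegrable,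
      (hw.1.1 p hp).circleIntegrable] with r h1 h2 h3 h4
    have := circleIntegral.integral_add h3 h4
    rw [h1, h2, add_zero] at this
    exact this
  zero_mem' := by
    refine ⟨X.Om.zero_mem, fun p _ => Eventually.of_forall fun r => ?_⟩
    simp [circleIntegral, coeff]
  smul_mem' := by
    intro c w hw
    refine ⟨X.Om.smul_mem c hw.1, fun p hp => ?_⟩
    filter_upwards [hw.2 p hp] with r h1
    have := circleIntegral.integral_smul c (coeff w p ∘ (chartAt ℂ p).symm) (chartAt ℂ p p) r
    rw [h1, smul_zero] at this
    exact this

/-- The `1`-forms in `Om` that are holomorphic on `S'`. -/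
def Om0 : Submodule ℂ (SForm S) where
  carrier := {w | w ∈ X.Om ∧ ∀ p ∉ X.P, FormHolAt w p}
  add_mem' := fun hf hg =>
    ⟨X.Om.add_mem hf.1 hg.1, fun p hp => ContMDiffAt.add (hf.2 p hp) (hg.2 p hp)⟩
  zero_mem' := ⟨X.Om.zero_mem, fun p _ => contMDiffAt_const⟩
  smul_mem' := fun c _ hf =>
    ⟨X.Om.smul_mem c hf.1, fun p hp => ContMDiffAt.smul (contMDiffAt_const : HolAt (fun _ : S => c) p) (hf.2 p hp)⟩

/-- The divisor of an element `w` of `Om`: the order of `w` at the points of `S'`, and the order of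
the meromorphic germ `exp (-h) • w` at the punctures. -/
def formDiv (w : SForm S) (p : S) : WithTop ℤ :=
  X.div (coeff w p) p

end Forms

end ExpCurve

/-! ### The line bundle -/

/-- A cover as used in the construction of the line bundle: pairwise disjoint open neighbourhoods
`B p` of the punctures, such that `h p` is holomorphic on `B p \ {p}`, and an open subset `V` of `S'`
which together with them covers `S`. Disks `B p` which `V` meets in annuli are an example. -/
structure Cover {S : Type*} [TopologicalSpace S] [ChartedSpace ℂ S] (X : ExpCurve S) where
  B : X.P → Set S
  V : Set S
  isOpen_B : ∀ p, IsOpen (B p)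
  isOpen_V : IsOpen V
  mem_B : ∀ p : X.P, (p : S) ∈ B p
  disj : ∀ p q : X.P, p ≠ q → Disjoint (B p) (B q)
  notMem_V : ∀ p : X.P, (p : S) ∉ V
  cover : ∀ x, x ∈ V ∨ ∃ p, x ∈ B p
  hol : ∀ p : X.P, ∀ x ∈ B p, x ≠ p → HolAt (X.h p) x

namespace Cover

variable {S : Type*} [TopologicalSpace S] [ChartedSpace ℂ S] {X : ExpCurve S} (C : Cover X)

/-- The open cover: `none` stands for `V`, and `some p` for `B p`. -/
def base : Option X.P → Set S
  | none => C.V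
  | some p => C.B p

/-- The transition functions: `trans i j` takes coordinates over `base i` to coordinates over
`base j`. It is `exp (-h p)` from `V` to `B p`. -/
def trans (X : ExpCurve S) : Option X.P → Option X.P → S → ℂ
  | none, none => fun _ => 1
  | none, some p => fun x => Complex.exp (-X.h p x)
  | some p, none => fun x => Complex.exp (X.h p x)
  | some _, some _ => fun _ => 1

open Classical in
/-- The member of the cover used for the fibre over `x`: `V` if possible. -/
def index (x : S) : Option X.P :=
  if hx : x ∈ C.V then none else some ((C.cover x).resolve_left hx).choose

theorem mem_base_index (x : S) : x ∈ C.base (C.index x) := by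
  unfold index
  split_ifs with hx
  · exact hx
  · exact ((C.cover x).resolve_left hx).choose_spec

theorem eq_of_mem {x : S} {p q : X.P} (hp : x ∈ C.B p) (hq : x ∈ C.B q) : p = q := by
  by_contra h
  exact Set.disjoint_left.1 (C.disj p q h) hp hq

theorem ne_of_mem {x : S} (hV : x ∈ C.V) (p : X.P) : x ≠ p := by
  rintro rfl
  exact C.notMem_V p hV

theorem contMDiffOn_trans (i j : Option X.P) :
    ContMDiffOn 𝓘(ℂ) 𝓘(ℂ) ω (trans X i j) (C.base i ∩ C.base j) := by
  have hexp : ContMDiff 𝓘(ℂ) 𝓘(ℂ) ω Complex.exp := Complex.contDiff_exp.contMDiff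
  rcases i with _ | p <;> rcases j with _ | q
  · exact contMDiffOn_const
  · intro x hx
    refine ContMDiffAt.contMDiffWithinAt ?_
    exact hexp.contMDiffAt.comp x (C.hol q x hx.2 (C.ne_of_mem hx.1 q)).neg
  · intro x hx
    refine ContMDiffAt.contMDiffWithinAt ?_
    exact hexp.contMDiffAt.comp x (C.hol p x hx.1 (C.ne_of_mem hx.2 p))
  · exact contMDiffOn_const

theorem contMDiffOn_coordChange (i j : Option X.P) :
    ContMDiffOn 𝓘(ℂ) 𝓘(ℂ, ℂ →L[ℂ] ℂ) ω
      (fun x => trans X i j x • ContinuousLinearMap.id ℂ ℂ) (C.base i ∩ C.base j) :=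
  (C.contMDiffOn_trans i j).smul contMDiffOn_const

theorem trans_comp (i j k : Option X.P) {x : S} (hi : x ∈ C.base i) (hj : x ∈ C.base j)
    (hk : x ∈ C.base k) : trans X j k x * trans X i j x = trans X i k x := by
  rcases i with _ | p <;> rcases j with _ | q <;> rcases k with _ | r
  · simp [trans]
  · simp [trans]
  · simp [trans, ← Complex.exp_add]
  · obtain rfl := C.eq_of_mem hj hk
    simp [trans]
  · simp [trans]
  · obtain rfl := C.eq_of_mem hi hk
    simp [trans, ← Complex.exp_add]
  · obtain rfl := C.eq_of_mem hi hj
    simp [trans]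
  · simp [trans]

/-- The line bundle with transition functions `exp (-h p)`. -/
def core : VectorBundleCore ℂ S ℂ (Option X.P) where
  baseSet := C.base
  isOpen_baseSet := by
    rintro (_ | p)
    exacts [C.isOpen_V, C.isOpen_B p]
  indexAt := C.index
  mem_baseSet_at := C.mem_base_index
  coordChange i j x := trans X i j x • ContinuousLinearMap.id ℂ ℂ
  coordChange_self := by
    rintro (_ | p) x _ v <;> simp [trans]
  continuousOn_coordChange i j := (C.contMDiffOn_coordChange i j).continuousOn
  coordChange_comp := by
    rintro i j k x ⟨⟨hi, hj⟩, hk⟩ v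
    simp [← C.trans_comp i j k hi hj hk, mul_assoc]

instance : C.core.IsContMDiff 𝓘(ℂ) ω where
  contMDiffOn_coordChange := C.contMDiffOn_coordChange

/-- The fibres of the line bundle. -/
abbrev L : S → Type _ := C.core.Fiber

/-- The section that is `1` over `V` and `exp (-h p)` over `B p \ {p}`, in the local trivializations
there. It is a section over `S'`; its values at the punctures are irrelevant. -/
def sH (x : S) : C.L x :=
  (C.core.localTriv (C.index x)).symm x
    (match C.index x with
      | none => 1
      | some p => Complex.exp (-X.h p x))

theorem localTriv_sH_V {x : S} (hx : x ∈ C.V) :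
    (C.core.localTriv none ⟨x, C.sH x⟩).2 = 1 := by
  have hi : C.index x = none := by simp [index, hx]
  unfold sH
  have := (C.core.localTriv none).apply_mk_symm (b := x) hx (1 : ℂ)
  rw [hi, this]

theorem localTriv_sH_B {x : S} {p : X.P} (hx : x ∈ C.B p) :
    (C.core.localTriv (some p) ⟨x, C.sH x⟩).2 = Complex.exp (-X.h p x) := by
  by_cases hV : x ∈ C.V
  · have hi : C.index x = none := by simp [index, hV]
    unfold sH
    rw [hi, VectorBundleCore.localTriv_symm_apply _ _ hV, VectorBundleCore.localTriv_apply]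
    simp [core, hi, trans]
  · have hi : C.index x = some p := by
      have := C.mem_base_index x
      rcases h : C.index x with _ | q
      · rw [h] at this
        exact absurd this hV
      · rw [h] at this
        rw [C.eq_of_mem this hx]
    unfold sH
    rw [hi]
    have := (C.core.localTriv (some p)).apply_mk_symm (b := x) hx (Complex.exp (-X.h p x))
    rw [this]

/-- The section of the dual bundle that takes the value `1` on `sH`. -/
def sHdual (x : S) : Module.Dual ℂ (C.L x) where
  toFun v := (C.core.localTriv (C.index x) ⟨x, v⟩).2 /
    (C.core.localTriv (C.index x) ⟨x, C.sH x⟩).2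
  map_add' v w := by
    rw [((C.core.localTriv (C.index x)).linear ℂ (C.mem_base_index x)).map_add v w, add_div]
  map_smul' c v := by
    rw [((C.core.localTriv (C.index x)).linear ℂ (C.mem_base_index x)).map_smul c v, smul_div_assoc]
    rfl

theorem sHdual_sH (x : S) : C.sHdual x (C.sH x) = 1 := by
  apply div_self
  rcases h : C.index x with _ | p
  · have := C.mem_base_index x
    rw [h] at this
    rw [C.localTriv_sH_V this]
    exact one_ne_zero
  · have := C.mem_base_index x
    rw [h] at this
    rw [C.localTriv_sH_B this]
    exact Complex.exp_ne_zero _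

/-- The function `s ⊗ sHdual`. -/
def tensorDual (s : Π x, C.L x) : S → ℂ := fun x => C.sHdual x (s x)

/-- The section `f • sH`. -/
def mulSection (f : S → ℂ) : Π x, C.L x := fun x => f x • C.sH x

/-- The `1`-form `α ⊗ sHdual`. -/
def formTensorDual (a : Form C.L) : SForm S := fun x => C.sHdual x ∘ₗ a x

/-- The `L`-valued `1`-form `w • sH`. -/
def formMulSection (w : SForm S) : Form C.L := fun x => (w x).smulRight (C.sH x)

end Cover

end ExpAlg

end

/-! The dictionary between sections and functions is local. In the trivialization at p, the section
f · `sH` reads f · exp(-h) if p is a puncture, and f times a non-vanishing holomorphic factor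
otherwise (`Cover.localRep_mulSection_cases`). Since f = g e^h with g meromorphic exactly when f
e^{-h} is meromorphic, meromorphic sections correspond to elements of M(S*) with the same orders.
Forms reduce to functions through their coefficient in the chart at p.

The analytic content is the existence of a nonzero element of O(S*), that is, of a section of the
bundle with its only pole at one puncture (`FrameCover.exists_section`, `ExpCurve.exists_mem_O`).
Take a finite atlas with frames e_i, cutoffs ψ_i and a partition of unity ρ_i such that ψ_i = 1 near
the support of ρ_i. For a polar part P at the puncture, try f = ψ_o e_o P - Σ ψ_i e_i H_i, where H_i
is the Cauchy transform of a function u_i carried by the image K_i of supp ρ_i. Then ∂̄f = 0 off the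
puncture becomes a system u + Tu = A(P) of integral equations. The kernels are continuous, because
∂̄ψ_i vanishes near supp ρ_i and so the Cauchy kernel is never used at its singularity. By
Stone–Weierstrass T is a norm limit of finite rank operators, hence the system is solvable up to
finitely many linear conditions on P. The polar parts form an infinite-dimensional space, so some P
≠ 0 admits a solution. Then f is not zero near the puncture, because P is unbounded there and H_o is
not.

For the spaces of forms take df. Near a puncture f = g e^h and df = (g' + g h') e^h dz. This cannot
vanish identically when g does not: otherwise g'/g = -h', but g'/g has order at least -1 and h' has
order at most -2. As df is holomorphic on S', its residues there vanish, so one form serves all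
three spaces.

For the degree, let f in M(S*) correspond to a section. Connectedness makes all its orders finite
and compactness makes its divisor finite. Near each point df/f = n dz/(z - z₀) + holomorphic + dh,
and the exact term dh has no residue even if h has a pole. The orders n then add up to zero by the
residue theorem, proved here by integrating ∂̄σ_i ∧ df/f over a smooth partition of unity σ_i
(`sum_order_eq_zero`): the total vanishes because Σ ∂̄σ_i = 0, and the Cauchy–Pompeiu formula
evaluates the individual terms. -/

noncomputable section

set_option linter.unusedSectionVars false

namespace ExpAlg

open MeasureTheory ComplexConjugate

/-! ### The Cauchy–Riemann operator in the plane -/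

/-- The Cauchy–Riemann operator `∂/∂z̄`. -/
def dbar (f : ℂ → ℂ) (z : ℂ) : ℂ :=
  (fderiv ℝ f z 1 + Complex.I * fderiv ℝ f z Complex.I) / 2

theorem dbar_eq_zero_iff {f : ℂ → ℂ} {z : ℂ} (hf : DifferentiableAt ℝ f z) :
    dbar f z = 0 ↔ DifferentiableAt ℂ f z := by
  rw [differentiableAt_complex_iff_differentiableAt_real]
  simp only [hf, true_and, smul_eq_mul, dbar]
  generalize fderiv ℝ f z 1 = a
  generalize fderiv ℝ f z Complex.I = b
  constructor
  · intro h
    linear_combination (-2 * Complex.I) * h + b * Complex.I_mul_I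
  · rintro rfl
    linear_combination (a / 2) * Complex.I_mul_I

theorem dbar_of_differentiableAt {f : ℂ → ℂ} {z : ℂ} (hf : DifferentiableAt ℂ f z) :
    dbar f z = 0 :=
  (dbar_eq_zero_iff (hf.restrictScalars ℝ)).2 hf

theorem dbar_congr {f g : ℂ → ℂ} {z : ℂ} (h : f =ᶠ[𝓝 z] g) : dbar f z = dbar g z := by
  rw [dbar, dbar, h.fderiv_eq]

theorem dbar_sub {f g : ℂ → ℂ} {z : ℂ} (hf : DifferentiableAt ℝ f z)
    (hg : DifferentiableAt ℝ g z) : dbar (fun w => f w - g w) z = dbar f z - dbar g z := by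
  rw [dbar, fderiv_fun_sub hf hg, dbar, dbar]
  simp only [sub_apply]
  ring

theorem dbar_sum {ι : Type*} (s : Finset ι) {f : ι → ℂ → ℂ} {z : ℂ}
    (hf : ∀ i ∈ s, DifferentiableAt ℝ (f i) z) :
    dbar (fun w => ∑ i ∈ s, f i w) z = ∑ i ∈ s, dbar (f i) z := by
  rw [dbar, fderiv_fun_sum hf]
  simp only [dbar, sum_apply, ← Finset.sum_div, Finset.sum_add_distrib,
    Finset.mul_sum]

theorem dbar_mul {f g : ℂ → ℂ} {z : ℂ} (hf : DifferentiableAt ℝ f z)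
    (hg : DifferentiableAt ℝ g z) :
    dbar (fun w => f w * g w) z = dbar f z * g z + f z * dbar g z := by
  rw [dbar, fderiv_fun_mul hf hg, dbar, dbar]
  simp only [add_apply, smul_apply, smul_eq_mul]
  ring

theorem dbar_mul_of_differentiableAt {f g : ℂ → ℂ} {z : ℂ} (hf : DifferentiableAt ℝ f z)
    (hg : DifferentiableAt ℂ g z) : dbar (fun w => f w * g w) z = dbar f z * g z := by
  rw [dbar_mul hf (hg.restrictScalars ℝ), dbar_of_differentiableAt hg, mul_zero, add_zero]

/-- Write L w = αw + βw̄. The combination L c + i L(ic) kills the α-part and leaves 2βc̄. This gives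
both the chain rule for ∂̄ under holomorphic maps and, with c on the unit circle, the expression of
∂̄ in polar coordinates. -/
theorem real_clm_conj_mul (L : ℂ →L[ℝ] ℂ) (c : ℂ) :
    L c + Complex.I * L (Complex.I * c) = conj c * (L 1 + Complex.I * L Complex.I) := by
  have h1 : ∀ w : ℂ, L w = w.re * L 1 + w.im * L Complex.I := by
    intro w
    conv_lhs => rw [show w = w.re • (1 : ℂ) + w.im • Complex.I by
      simp [Complex.re_add_im]]
    rw [map_add, map_smul, map_smul, Complex.real_smul, Complex.real_smul]
  rw [h1 c, h1 (Complex.I * c)]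
  have hc : conj c = (c.re : ℂ) - c.im * Complex.I := by
    apply Complex.ext <;> simp
  rw [hc]
  simp only [Complex.mul_re, Complex.I_re, Complex.I_im, Complex.mul_im, zero_mul, one_mul, zero_sub,
    Complex.ofReal_neg, zero_add]
  linear_combination ((c.im : ℂ) * L Complex.I) * Complex.I_mul_I

theorem dbar_comp {f g : ℂ → ℂ} {z : ℂ} (hf : DifferentiableAt ℝ f (g z))
    (hg : DifferentiableAt ℂ g z) : dbar (f ∘ g) z = conj (deriv g z) * dbar f (g z) := by
  have h : HasFDerivAt (f ∘ g) ((fderiv ℝ f (g z)).comp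
      ((fderiv ℂ g z).restrictScalars ℝ)) z :=
    hf.hasFDerivAt.comp z (hg.hasFDerivAt.restrictScalars ℝ)
  rw [dbar, h.fderiv, dbar]
  simp only [ContinuousLinearMap.comp_apply, ContinuousLinearMap.coe_restrictScalars']
  have h2 : fderiv ℂ g z Complex.I = Complex.I * deriv g z := by
    rw [← fderiv_apply_one_eq_deriv, ← smul_eq_mul, ← map_smul, smul_eq_mul, mul_one]
  rw [h2, fderiv_apply_one_eq_deriv, real_clm_conj_mul]
  ring

/-! ### Integration by parts, the Cauchy–Pompeiu formula and the Cauchy transform -/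

theorem integral_fderiv_eq_zero {f : ℂ → ℂ} (hf : ContDiff ℝ 1 f) (hc : HasCompactSupport f)
    (v : ℂ) : ∫ z, fderiv ℝ f z v = 0 := by
  have hi : Integrable (fun z => fderiv ℝ f z v) :=
    (((hf.continuous_fderiv one_ne_zero).clm_apply continuous_const)).integrable_of_hasCompactSupport
      (hc.fderiv_apply ℝ v)
  have h := integral_mul_fderiv_eq_neg_fderiv_mul_of_integrable (μ := volume) (f := fun _ : ℂ => (1 : ℂ))
    (g := f) (v := v) (by simp) (by simpa using hi)
    (by simpa using hf.continuous.integrable_of_hasCompactSupport hc)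
    (fun x _ => differentiableAt_const _) (fun x _ => hf.differentiable one_ne_zero x)
  simpa using h

theorem continuous_dbar {f : ℂ → ℂ} (hf : ContDiff ℝ 1 f) : Continuous (dbar f) := by
  have h := hf.continuous_fderiv one_ne_zero
  unfold dbar
  fun_prop

theorem HasCompactSupport.dbar {f : ℂ → ℂ} (hc : HasCompactSupport f) :
    HasCompactSupport (dbar f) := by
  refine (hc.fderiv ℝ).mono' ?_
  refine fun z hz => subset_tsupport _ fun h => hz ?_
  simp [ExpAlg.dbar, h]

theorem integral_dbar_eq_zero {f : ℂ → ℂ} (hf : ContDiff ℝ 1 f) (hc : HasCompactSupport f) :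
    ∫ z, dbar f z = 0 := by
  have hi : ∀ v : ℂ, Integrable (fun z => fderiv ℝ f z v) := fun v =>
    (((hf.continuous_fderiv one_ne_zero).clm_apply continuous_const)).integrable_of_hasCompactSupport
      (hc.fderiv_apply ℝ v)
  unfold dbar
  rw [integral_div, integral_add (hi 1) ((hi Complex.I).const_mul _), integral_const_mul,
    integral_fderiv_eq_zero hf hc, integral_fderiv_eq_zero hf hc]
  simp

/-- In real dimension two the radial weight r cancels 1/r. -/
theorem locallyIntegrable_inv : LocallyIntegrable (fun z : ℂ => z⁻¹) := by
  rw [locallyIntegrable_iff]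
  intro k hk
  obtain ⟨R, hR⟩ := hk.isBounded.subset_ball (0 : ℂ)
  refine IntegrableOn.mono_set ?_ hR
  have h := (integrableOn_fun_norm_addHaar (E := ℂ) volume (r := R) (f := fun x : ℝ => x⁻¹)).2 ?_
  · refine Integrable.mono h measurable_inv.aestronglyMeasurable ?_
    filter_upwards with z
    simp
  · refine IntegrableOn.congr_fun (f := fun _ => (1 : ℝ)) ?_ ?_ measurableSet_Ioo
    · simp
    · intro x hx
      simp [hx.1.ne']

theorem circleLike_hasDerivAt (t : ℝ) :
    HasDerivAt (fun t : ℝ => ((Real.cos t : ℂ) + Real.sin t * Complex.I))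
      (Complex.I * (Real.cos t + Real.sin t * Complex.I)) t := by
  have h1 := (Real.hasDerivAt_cos t).ofReal_comp
  have h2 := ((Real.hasDerivAt_sin t).ofReal_comp).mul_const Complex.I
  convert! h1.add h2 using 1
  rw [Complex.ofReal_neg]
  linear_combination (Real.sin t : ℂ) * Complex.I_mul_I

/-- The integrand is the derivative of r ↦ f(ru), which vanishes for large r. -/
theorem integral_radial {f : ℂ → ℂ} (hf : ContDiff ℝ 1 f) (hc : HasCompactSupport f) (u : ℂ)
    (hu : ‖u‖ = 1) : ∫ r in Ioi (0 : ℝ), fderiv ℝ f (r * u) u = - f 0 := by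
  let g : ℝ → ℂ := fun r => f (r * u)
  have hcd : ContDiff ℝ 1 g :=
    hf.comp ((Complex.ofRealCLM.contDiff).mul contDiff_const)
  have hcs : HasCompactSupport g := by
    obtain ⟨R, hR⟩ := hc.isCompact.isBounded.subset_closedBall (0 : ℂ)
    refine HasCompactSupport.intro (isCompact_closedBall (0 : ℝ) R) fun r hr => ?_
    by_contra h
    apply hr
    have := hR (subset_tsupport _ h)
    simpa [hu] using this
  have h := hcs.integral_Ioi_deriv_eq hcd 0
  have hd : ∀ r : ℝ, deriv g r = fderiv ℝ f (r * u) u := by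
    intro r
    have h1 : HasDerivAt (fun r : ℝ => (r : ℂ) * u) u r := by
      simpa using (Complex.ofRealCLM.hasDerivAt (x := r)).mul_const u
    exact ((hf.differentiable one_ne_zero _).hasFDerivAt.comp_hasDerivAt r h1).deriv
  simp_rw [hd] at h
  rw [h]
  simp [g]

/-- Up to the factor r, the integrand is the derivative of the periodic function t ↦ f(re^{it}). -/
theorem integral_angular {f : ℂ → ℂ} (hf : ContDiff ℝ 1 f) {r : ℝ} (hr : 0 < r) :
    ∫ t in Ioo (-Real.pi) Real.pi, fderiv ℝ f (r * (Real.cos t + Real.sin t * Complex.I))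
      (Complex.I * (Real.cos t + Real.sin t * Complex.I)) = 0 := by
  rw [← integral_Ioc_eq_integral_Ioo, ← intervalIntegral.integral_of_le (by linarith [Real.pi_pos])]
  have hd : ∀ t : ℝ, HasDerivAt (fun t : ℝ => (r : ℂ)⁻¹ * f (r * (Real.cos t + Real.sin t * Complex.I)))
      (fderiv ℝ f (r * (Real.cos t + Real.sin t * Complex.I))
      (Complex.I * (Real.cos t + Real.sin t * Complex.I))) t := by
    intro t
    have h1 := (circleLike_hasDerivAt t).const_mul (r : ℂ)
    have h2 := ((hf.differentiable one_ne_zero _).hasFDerivAt.comp_hasDerivAt t h1).const_mul (r : ℂ)⁻¹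
    convert! h2 using 1
    have : (r : ℂ) * (Complex.I * (Real.cos t + Real.sin t * Complex.I)) =
      r • (Complex.I * (Real.cos t + Real.sin t * Complex.I)) := by simp
    rw [this, map_smul, Complex.real_smul, inv_mul_cancel_left₀ (by exact_mod_cast hr.ne')]
  rw [intervalIntegral.integral_eq_sub_of_hasDerivAt (fun t _ => hd t)]
  · simp
  · apply Continuous.intervalIntegrable
    refine (((hf.continuous_fderiv one_ne_zero).comp ?_).clm_apply ?_) <;> fun_prop

/-- The **Cauchy–Pompeiu formula** for functions with compact support. -/
theorem integral_dbar_div {f : ℂ → ℂ} (hf : ContDiff ℝ 1 f) (hc : HasCompactSupport f) (a : ℂ) :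
    ∫ w, dbar f w / (w - a) = - Real.pi * f a := by
  wlog ha : a = 0 generalizing f a
  · have hg : ContDiff ℝ 1 (fun w => f (w + a)) := hf.comp (contDiff_id.add contDiff_const)
    have hgc : HasCompactSupport (fun w => f (w + a)) :=
      hc.comp_homeomorph (Homeomorph.addRight a)
    have := this hg hgc 0 rfl
    rw [zero_add] at this
    rw [← this, ← integral_add_right_eq_self _ a]
    congr 1
    ext w
    have h1 : fderiv ℝ (fun w => f (w + a)) w = fderiv ℝ f (w + a) := fderiv_comp_add_right a
    simp [dbar, h1]
  subst ha
  simp only [sub_zero]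
  rw [← Complex.integral_comp_polarCoord_symm]
  let e : ℝ → ℂ := fun t => Real.cos t + Real.sin t * Complex.I
  have hen : ∀ t, ‖e t‖ = 1 := fun t => by
    simp only [e]
    rw [Complex.ofReal_cos, Complex.ofReal_sin, ← Complex.exp_mul_I, Complex.norm_exp_ofReal_mul_I]
  have hec : Continuous e := by fun_prop
  -- `A` is the radial derivative of f and `B` the angular one divided by r.
  let A : ℝ × ℝ → ℂ := fun p => fderiv ℝ f (p.1 * e p.2) (e p.2)
  let B : ℝ × ℝ → ℂ := fun p => fderiv ℝ f (p.1 * e p.2) (Complex.I * e p.2)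
  have hfd := hf.continuous_fderiv one_ne_zero
  have hA : Continuous A := by
    refine ((hfd.comp ?_).clm_apply ?_) <;> fun_prop
  have hB : Continuous B := by
    refine ((hfd.comp ?_).clm_apply ?_) <;> fun_prop
  obtain ⟨R, hR⟩ := (hc.fderiv ℝ).isCompact.isBounded.subset_closedBall (0 : ℂ)
  have hz : ∀ p : ℝ × ℝ, R < |p.1| → fderiv ℝ f (p.1 * e p.2) = 0 := by
    intro p hp
    by_contra h
    have := hR (subset_tsupport _ h)
    simp [hen] at this
    linarith
  have hint : ∀ F : ℝ × ℝ → ℂ, Continuous F → (∀ p : ℝ × ℝ, R < |p.1| → F p = 0) →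
      IntegrableOn F (Ioi 0 ×ˢ Ioo (-Real.pi) Real.pi) := by
    intro F hF h0
    have h1 : IntegrableOn F (Icc (-R) R ×ˢ Icc (-Real.pi) Real.pi) :=
      hF.continuousOn.integrableOn_compact (isCompact_Icc.prod isCompact_Icc)
    refine IntegrableOn.of_forall_sdiff_eq_zero h1 (measurableSet_Ioi.prod measurableSet_Ioo) ?_
    rintro p ⟨⟨_, hp2⟩, hp⟩
    apply h0
    by_contra h
    rw [not_lt] at h
    exact hp ⟨abs_le.1 h, Ioo_subset_Icc_self hp2⟩
  have hAi := hint A hA fun p hp => by simp [A, hz p hp]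
  have hBi := hint B hB fun p hp => by simp [B, hz p hp]
  -- The Jacobian r cancels the modulus of 1/w, and the remaining unit factor e^{-it} is the
  -- conjugate produced by `real_clm_conj_mul`. What is left has no singularity at the origin.
  have hcongr : ∀ p ∈ (Ioi (0 : ℝ) ×ˢ Ioo (-Real.pi) Real.pi : Set (ℝ × ℝ)),
      p.1 • (dbar f (Complex.polarCoord.symm p) / Complex.polarCoord.symm p) =
        (2 : ℂ)⁻¹ * A p + (2 : ℂ)⁻¹ * Complex.I * B p := by
    rintro p ⟨hp, -⟩
    have hp0 : (p.1 : ℂ) ≠ 0 := by exact_mod_cast (ne_of_gt hp)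
    have he0 : e p.2 ≠ 0 := fun h => by simpa [h] using hen p.2
    have hpe : Complex.polarCoord.symm p = p.1 * e p.2 := Complex.polarCoord_symm_apply p
    have h := real_clm_conj_mul (fderiv ℝ f (p.1 * e p.2)) (e p.2)
    have hconj : conj (e p.2) = (e p.2)⁻¹ := by
      rw [Complex.inv_def, Complex.normSq_eq_norm_sq, hen]
      simp
    rw [hconj] at h
    rw [hpe, Complex.real_smul, dbar]
    have h2 : (2 : ℂ)⁻¹ * A p + (2 : ℂ)⁻¹ * Complex.I * B p =
      (2 : ℂ)⁻¹ * (fderiv ℝ f (p.1 * e p.2) (e p.2) +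
        Complex.I * fderiv ℝ f (p.1 * e p.2) (Complex.I * e p.2)) := by
      simp only [A, B]; ring
    rw [h2, h]
    field_simp
  have htgt : polarCoord.target = (Ioi (0 : ℝ) ×ˢ Ioo (-Real.pi) Real.pi : Set (ℝ × ℝ)) := rfl
  rw [htgt, setIntegral_congr_fun (measurableSet_Ioi.prod measurableSet_Ioo) hcongr,
    integral_add (hAi.const_mul _) (hBi.const_mul _), integral_const_mul, integral_const_mul]
  have hBz : ∫ p in (Ioi (0 : ℝ) ×ˢ Ioo (-Real.pi) Real.pi : Set (ℝ × ℝ)), B p = 0 := by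
    rw [Measure.volume_eq_prod, setIntegral_prod B hBi]
    refine setIntegral_eq_zero_of_forall_eq_zero fun r hr => ?_
    exact integral_angular hf hr
  have hAz : ∫ p in (Ioi (0 : ℝ) ×ˢ Ioo (-Real.pi) Real.pi : Set (ℝ × ℝ)), A p =
      - (2 * Real.pi) * f 0 := by
    -- For the radial term the inner integral must run over r, so the two factors are exchanged.
    have hAs : IntegrableOn (A ∘ Prod.swap) (Ioo (-Real.pi) Real.pi ×ˢ Ioi (0 : ℝ)) := by
      rw [Measure.volume_eq_prod] at hAi ⊢
      exact hAi.swap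
    have h1 := setIntegral_prod_swap (μ := volume) (ν := volume) (Ioi (0 : ℝ))
      (Ioo (-Real.pi) Real.pi) A
    rw [Measure.volume_eq_prod, ← h1, setIntegral_prod (fun z => A z.swap) hAs]
    have h2 : ∀ t ∈ Ioo (-Real.pi) Real.pi, ∫ r in Ioi (0 : ℝ), A (Prod.swap (t, r)) = - f 0 :=
      fun t _ => integral_radial hf hc (e t) (hen t)
    rw [setIntegral_congr_fun measurableSet_Ioo h2]
    simp [Real.pi_pos.le]
    left; ring
  rw [hAz, hBz]
  ring

/-- The Cauchy transform. -/
def cauchyT (v : ℂ → ℂ) (z : ℂ) : ℂ := (Real.pi : ℂ)⁻¹ * ∫ w, v w / (z - w)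

theorem cauchyT_eq_convolution (v : ℂ → ℂ) :
    cauchyT v = fun z => (Real.pi : ℂ)⁻¹ *
      (convolution (fun z : ℂ => z⁻¹) v (ContinuousLinearMap.mul ℝ ℂ) volume) z := by
  ext z
  rw [cauchyT, convolution]
  congr 1
  rw [← integral_sub_left_eq_self _ volume z]
  refine integral_congr_ae (Eventually.of_forall fun w => ?_)
  simp [div_eq_mul_inv, mul_comm]

theorem differentiable_cauchyT {v : ℂ → ℂ} (hv : ContDiff ℝ 1 v) (hc : HasCompactSupport v) :
    Differentiable ℝ (cauchyT v) := by
  rw [cauchyT_eq_convolution]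
  intro z
  exact (hc.hasFDerivAt_convolution_right (ContinuousLinearMap.mul ℝ ℂ) locallyIntegrable_inv hv
    z).differentiableAt.const_mul _

/-- Differentiating the convolution puts the derivatives on v; the result is the integral of ∂̄v
against the Cauchy kernel, which Cauchy–Pompeiu evaluates. -/
theorem dbar_cauchyT {v : ℂ → ℂ} (hv : ContDiff ℝ 1 v) (hc : HasCompactSupport v) (z : ℂ) :
    dbar (cauchyT v) z = v z := by
  have h := (hc.hasFDerivAt_convolution_right (ContinuousLinearMap.mul ℝ ℂ) locallyIntegrable_inv hv
    z).const_mul (Real.pi : ℂ)⁻¹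
  have hex := (hc.fderiv ℝ).convolutionExists_right
    ((ContinuousLinearMap.mul ℝ ℂ).precompR ℂ) locallyIntegrable_inv
    (hv.continuous_fderiv one_ne_zero) z
  have key : ∀ u : ℂ, fderiv ℝ (cauchyT v) z u =
      (Real.pi : ℂ)⁻¹ * ∫ w, w⁻¹ * fderiv ℝ v (z - w) u := by
    intro u
    rw [cauchyT_eq_convolution, h.fderiv]
    simp only [smul_apply, smul_eq_mul]
    rw [convolution, ContinuousLinearMap.integral_apply hex]
    rfl
  have hi : ∀ u : ℂ, Integrable fun w => w⁻¹ * fderiv ℝ v (z - w) u := fun u =>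
    (hc.fderiv_apply ℝ u).convolutionExists_right (ContinuousLinearMap.mul ℝ ℂ)
      locallyIntegrable_inv ((hv.continuous_fderiv one_ne_zero).clm_apply continuous_const) z
  have hp := integral_dbar_div hv hc z
  rw [dbar, key, key]
  have h2 : ∫ w, dbar v w / (w - z) = - ((∫ w, w⁻¹ * fderiv ℝ v (z - w) 1) +
      Complex.I * ∫ w, w⁻¹ * fderiv ℝ v (z - w) Complex.I) / 2 := by
    rw [← integral_const_mul, ← integral_add (hi 1) ((hi Complex.I).const_mul _),
      ← integral_sub_left_eq_self _ volume z, ← integral_neg, ← integral_div]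
    refine integral_congr_ae (Eventually.of_forall fun w => ?_)
    simp only [dbar, sub_sub_cancel_left]
    rw [div_neg, div_eq_mul_inv _ w]
    ring
  have hpi : (Real.pi : ℂ) ≠ 0 := by exact_mod_cast Real.pi_ne_zero
  rw [h2] at hp
  rw [eq_comm, ← mul_right_inj' (neg_ne_zero.2 hpi), ← hp]
  have := mul_inv_cancel₀ hpi
  generalize (∫ w, w⁻¹ * fderiv ℝ v (z - w) 1) = a
  generalize (∫ w, w⁻¹ * fderiv ℝ v (z - w) Complex.I) = b
  linear_combination ((a + Complex.I * b) / 2) * this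

/-- The Cauchy transform of a function carried by a compact set is holomorphic off that set. -/
theorem differentiableAt_integral_div {K : Set ℂ} (hK : IsCompact K) {v : ℂ → ℂ}
    (hv : ContinuousOn v K) {z : ℂ} (hz : z ∉ K) :
    DifferentiableAt ℂ (fun z => ∫ w in K, v w / (z - w)) z := by
  -- Points within r/2 of z stay at distance at least r/2 from K, which gives a dominating function
  -- for differentiation under the integral.
  obtain ⟨r, hr, hball⟩ := Metric.isOpen_iff.1 hK.isClosed.isOpen_compl z hz
  have hdist : ∀ x ∈ Metric.ball z (r / 2), ∀ w ∈ K, r / 2 ≤ ‖x - w‖ := by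
    intro x hx w hw
    by_contra h
    push Not at h
    have : w ∈ Metric.ball z r := by
      rw [Metric.mem_ball, dist_comm] at *
      have := dist_triangle z x w
      rw [dist_eq_norm x w] at this
      linarith
    exact hball this hw
  have hne : ∀ x ∈ Metric.ball z (r / 2), ∀ w ∈ K, x - w ≠ 0 := by
    intro x hx w hw h
    have := hdist x hx w hw
    rw [h, norm_zero] at this
    linarith
  have hmeas : ∀ x ∈ Metric.ball z (r / 2),
      ContinuousOn (fun w => v w / (x - w)) K := fun x hx =>
    hv.div (by fun_prop) (hne x hx)
  have hz2 : z ∈ Metric.ball z (r / 2) := Metric.mem_ball_self (by linarith)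
  have h := hasDerivAt_integral_of_dominated_loc_of_deriv_le (μ := volume.restrict K)
    (F := fun x w => v w / (x - w)) (F' := fun x w => -(v w) / (x - w) ^ 2) (x₀ := z)
    (bound := fun w => ‖v w‖ / (r / 2) ^ 2) (s := Metric.ball z (r / 2))
    (Metric.ball_mem_nhds _ (by linarith)) ?_ ?_ ?_ ?_ ?_ ?_
  · exact h.2.differentiableAt
  · filter_upwards [Metric.ball_mem_nhds z (by linarith : 0 < r / 2)] with x hx
    exact (hmeas x hx).aestronglyMeasurable hK.measurableSet
  · exact (hmeas z hz2).integrableOn_compact hK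
  · refine ContinuousOn.aestronglyMeasurable ?_ hK.measurableSet
    exact hv.neg.div (by fun_prop) fun w hw => pow_ne_zero 2 (hne z hz2 w hw)
  · filter_upwards [ae_restrict_mem hK.measurableSet] with w hw x hx
    rw [norm_div, norm_neg, norm_pow]
    gcongr
    exact hdist x hx w hw
  · exact (hv.norm.div_const _).integrableOn_compact hK
  · filter_upwards [ae_restrict_mem hK.measurableSet] with w hw x hx
    have h1 : HasDerivAt (fun x : ℂ => x - w) 1 x := (hasDerivAt_id x).sub_const w
    convert! (hasDerivAt_const x (v w)).div h1 (hne x hx w hw) using 1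
    simp

/-! ### Integral operators with continuous kernel -/

section Kernel

variable {X Y : Type*} [TopologicalSpace X] [CompactSpace X] [T2Space X]
  [TopologicalSpace Y] [CompactSpace Y] [T2Space Y]

/-- The products `a(x) b(y)` form a multiplicative monoid. -/
def productMonoid (X Y : Type*) [TopologicalSpace X] [TopologicalSpace Y] :
    Submonoid C(X × Y, ℂ) where
  carrier := {f | ∃ (a : C(X, ℂ)) (b : C(Y, ℂ)), ∀ p, f p = a p.1 * b p.2}
  one_mem' := ⟨1, 1, by simp⟩
  mul_mem' := by
    rintro f g ⟨a, b, h⟩ ⟨c, d, h'⟩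
    exact ⟨a * c, b * d, fun p => by simp [h, h']; ring⟩

/-- Stone–Weierstrass: products are closed under multiplication, so their span is already the
algebra they generate. It is closed under conjugation, and Urysohn functions of one of the two
coordinates separate points. -/
theorem productMonoid_dense :
    (Submodule.span ℂ (productMonoid X Y : Set C(X × Y, ℂ))).topologicalClosure = ⊤ := by
  let A : StarSubalgebra ℂ C(X × Y, ℂ) :=
    { Algebra.adjoin ℂ (productMonoid X Y : Set C(X × Y, ℂ)) with
      star_mem' := by
        intro f hf
        refine Algebra.adjoin_induction (hx := hf) (p := fun f _ =>
          star f ∈ Algebra.adjoin ℂ (productMonoid X Y : Set C(X × Y, ℂ))) ?_ ?_ ?_ ?_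
        · rintro f ⟨a, b, h⟩
          exact Algebra.subset_adjoin ⟨star a, star b, fun p => by simp [h]⟩
        · intro c
          exact Algebra.subset_adjoin ⟨algebraMap ℂ _ (star c), 1, fun p => by simp⟩
        · intro f g _ _ hf hg
          rw [star_add]
          exact add_mem hf hg
        · intro f g _ _ hf hg
          rw [star_mul]
          exact mul_mem hg hf }
  have hA : A.topologicalClosure = ⊤ := by
    apply ContinuousMap.starSubalgebra_topologicalClosure_eq_top_of_separatesPoints
    intro p q hpq
    by_cases h1 : p.1 = q.1
    · have h2 : p.2 ≠ q.2 := fun h => hpq (Prod.ext h1 h)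
      obtain ⟨g, hg0, hg1, -⟩ := exists_continuous_zero_one_of_isClosed
        (isClosed_singleton (x := p.2)) (isClosed_singleton (x := q.2)) (by simpa using h2)
      refine ⟨_, ⟨⟨fun r => (g r.2 : ℂ), by fun_prop⟩, Algebra.subset_adjoin
        ⟨1, ⟨fun y => (g y : ℂ), by fun_prop⟩, fun r => by simp⟩, rfl⟩, ?_⟩
      simp [hg0 (mem_singleton _), hg1 (mem_singleton _)]
    · obtain ⟨g, hg0, hg1, -⟩ := exists_continuous_zero_one_of_isClosed
        (isClosed_singleton (x := p.1)) (isClosed_singleton (x := q.1)) (by simpa using h1)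
      refine ⟨_, ⟨⟨fun r => (g r.1 : ℂ), by fun_prop⟩, Algebra.subset_adjoin
        ⟨⟨fun y => (g y : ℂ), by fun_prop⟩, 1, fun r => by simp⟩, rfl⟩, ?_⟩
      simp [hg0 (mem_singleton _), hg1 (mem_singleton _)]
  rw [eq_top_iff]
  intro f _
  have hf : f ∈ A.topologicalClosure := by rw [hA]; trivial
  rw [← SetLike.mem_coe, StarSubalgebra.topologicalClosure_coe] at hf
  rw [← SetLike.mem_coe, Submodule.topologicalClosure_coe]
  refine closure_mono ?_ hf
  intro g hg
  have hg' : g ∈ Algebra.adjoin ℂ (productMonoid X Y : Set C(X × Y, ℂ)) := hg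
  rw [← Subalgebra.mem_toSubmodule, Algebra.adjoin_eq_span, Submonoid.closure_eq] at hg'
  exact hg'

variable [FirstCountableTopology X] [SecondCountableTopology Y] [MeasurableSpace Y] [BorelSpace Y] (μ : Measure Y) [IsFiniteMeasure μ]

theorem integrable_of_continuous {f : Y → ℂ} (hf : Continuous f) : Integrable f μ :=
  hf.integrable_of_hasCompactSupport (HasCompactSupport.of_compactSpace f)

/-- The integral operator with kernel `k`. -/
def kernelOp (k : C(X × Y, ℂ)) : C(Y, ℂ) →L[ℂ] C(X, ℂ) :=
  LinearMap.mkContinuous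
    { toFun := fun v => ⟨fun x => ∫ y, k (x, y) * v y ∂μ, by
        have h := continuous_parametric_integral_of_continuous (μ := μ)
          (f := fun x y => k (x, y) * v y) (by fun_prop) (isCompact_univ (X := Y))
        simpa using! h⟩
      map_add' := by
        intro v w
        ext x
        simp only [ContinuousMap.coe_mk, ContinuousMap.add_apply, mul_add]
        exact integral_add (integrable_of_continuous μ (by fun_prop))
          (integrable_of_continuous μ (by fun_prop))
      map_smul' := by
        intro c v
        ext x
        simp only [ContinuousMap.coe_mk, ContinuousMap.smul_apply, smul_eq_mul, RingHom.id_apply,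
          mul_left_comm _ c]
        exact integral_const_mul _ _ }
    (‖k‖ * μ.real univ) (by
      intro v
      rw [ContinuousMap.norm_le _ (by positivity)]
      intro x
      refine (norm_integral_le_of_norm_le_const (C := ‖k‖ * ‖v‖) ?_).trans (le_of_eq (by ring))
      filter_upwards with y
      rw [norm_mul]
      exact mul_le_mul (k.norm_coe_le_norm _) (v.norm_coe_le_norm _) (norm_nonneg _)
        (norm_nonneg _))

theorem kernelOp_apply (k : C(X × Y, ℂ)) (v : C(Y, ℂ)) (x : X) :
    kernelOp μ k v x = ∫ y, k (x, y) * v y ∂μ := rfl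

theorem norm_kernelOp_le (k : C(X × Y, ℂ)) : ‖kernelOp (X := X) μ k‖ ≤ ‖k‖ * μ.real univ :=
  LinearMap.mkContinuous_norm_le _ (by positivity) _

/-- The operator `T` can be approximated by operators of finite rank: up to an operator of arbitrarily
small norm it vanishes on a subspace of finite codimension. -/
def FiniteRankApprox {E F : Type*} [NormedAddCommGroup E] [NormedSpace ℂ E]
    [NormedAddCommGroup F] [NormedSpace ℂ F] (T : E →L[ℂ] F) : Prop :=
  ∀ ε > 0, ∃ (N : Submodule ℂ E) (R : E →L[ℂ] F), Module.Finite ℂ (E ⧸ N) ∧ ‖R‖ ≤ ε ∧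
    ∀ v ∈ N, T v = R v

theorem finite_quotient_inf {E : Type*} [AddCommGroup E] [Module ℂ E] {N N' : Submodule ℂ E}
    (h : Module.Finite ℂ (E ⧸ N)) (h' : Module.Finite ℂ (E ⧸ N')) :
    Module.Finite ℂ (E ⧸ (N ⊓ N')) := by
  have : N ⊓ N' = LinearMap.ker (N.mkQ.prod N'.mkQ) := by
    rw [LinearMap.ker_prod, Submodule.ker_mkQ, Submodule.ker_mkQ]
  rw [this]
  exact Module.Finite.equiv (N.mkQ.prod N'.mkQ).quotKerEquivRange.symm

theorem finite_quotient_iInf {E ι : Type*} [AddCommGroup E] [Module ℂ E] [Finite ι]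
    {N : ι → Submodule ℂ E} (h : ∀ i, Module.Finite ℂ (E ⧸ N i)) :
    Module.Finite ℂ (E ⧸ ⨅ i, N i) := by
  cases nonempty_fintype ι
  have : ⨅ i, N i = LinearMap.ker (LinearMap.pi fun i => (N i).mkQ) := by
    rw [LinearMap.ker_pi]
    simp
  rw [this]
  exact Module.Finite.equiv (LinearMap.pi fun i => (N i).mkQ).quotKerEquivRange.symm

/-- For a kernel a(x)b(y) the operator factors through the single functional v ↦ ∫ bv. Linear
combinations of such kernels impose finitely many conditions. -/
theorem kernelOp_span {k : C(X × Y, ℂ)}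
    (hk : k ∈ Submodule.span ℂ (productMonoid X Y : Set C(X × Y, ℂ))) :
    ∃ N : Submodule ℂ C(Y, ℂ), Module.Finite ℂ (C(Y, ℂ) ⧸ N) ∧ ∀ v ∈ N, kernelOp μ k v = 0 := by
  induction hk using Submodule.span_induction with
  | mem f hf =>
    obtain ⟨a, b, hab⟩ := hf
    let l : C(Y, ℂ) →ₗ[ℂ] ℂ :=
      { toFun := fun v => ∫ y, b y * v y ∂μ
        map_add' := by
          intro v w
          simp only [ContinuousMap.add_apply, mul_add]
          exact integral_add (integrable_of_continuous μ (by fun_prop))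
            (integrable_of_continuous μ (by fun_prop))
        map_smul' := by
          intro c v
          simp only [ContinuousMap.smul_apply, smul_eq_mul, RingHom.id_apply, mul_left_comm _ c]
          exact integral_const_mul _ _ }
    refine ⟨LinearMap.ker l, Module.Finite.equiv l.quotKerEquivRange.symm, fun v hv => ?_⟩
    ext x
    have hv' : ∫ y, b y * v y ∂μ = 0 := hv
    simp [kernelOp_apply, hab, mul_assoc, integral_const_mul, hv']
  | zero => 
    refine ⟨⊤, inferInstance, fun v _ => ?_⟩
    ext x
    simp [kernelOp_apply]
  | add f g _ _ hf hg =>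
    obtain ⟨N, hN, h⟩ := hf
    obtain ⟨N', hN', h'⟩ := hg
    refine ⟨N ⊓ N', finite_quotient_inf hN hN', fun v hv => ?_⟩
    ext x
    have h1 := DFunLike.congr_fun (h v hv.1) x
    have h2 := DFunLike.congr_fun (h' v hv.2) x
    simp only [kernelOp_apply, ContinuousMap.add_apply, add_mul, ContinuousMap.zero_apply] at h1 h2 ⊢
    rw [integral_add (integrable_of_continuous μ (by fun_prop))
            (integrable_of_continuous μ (by fun_prop)), h1, h2, add_zero]
  | smul c f _ hf =>
    obtain ⟨N, hN, h⟩ := hf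
    refine ⟨N, hN, fun v hv => ?_⟩
    ext x
    have h1 := DFunLike.congr_fun (h v hv) x
    simp only [kernelOp_apply, ContinuousMap.smul_apply, smul_eq_mul, mul_assoc,
      ContinuousMap.zero_apply] at h1 ⊢
    rw [integral_const_mul, h1, mul_zero]

theorem finiteRankApprox_kernelOp (k : C(X × Y, ℂ)) : FiniteRankApprox (kernelOp μ k) := by
  intro ε hε
  have hk : k ∈ (Submodule.span ℂ (productMonoid X Y : Set C(X × Y, ℂ))).topologicalClosure := by
    rw [productMonoid_dense]; trivial
  rw [← SetLike.mem_coe, Submodule.topologicalClosure_coe, Metric.mem_closure_iff] at hk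
  -- The small operator is the one with kernel k - k'. The added 1 covers the case of total mass
  -- zero.
  obtain ⟨k', hk', hd⟩ := hk (ε / (μ.real univ + 1)) (by positivity)
  obtain ⟨N, hN, h⟩ := kernelOp_span μ hk'
  refine ⟨N, kernelOp μ (k - k'), hN, ?_, fun v hv => ?_⟩
  · refine (norm_kernelOp_le μ _).trans ?_
    rw [dist_eq_norm, lt_div_iff₀ (by positivity)] at hd
    nlinarith [norm_nonneg (k - k')]
  · ext x
    have h1 := DFunLike.congr_fun (h v hv) x
    simp only [kernelOp_apply, ContinuousMap.sub_apply, sub_mul, ContinuousMap.zero_apply] at h1 ⊢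
    rw [integral_sub (integrable_of_continuous μ (by fun_prop))
            (integrable_of_continuous μ (by fun_prop)), h1, sub_zero]

end Kernel

/-- In the sup norm a matrix of operators is bounded by its row sums, so errors ε/(|J| + 1) in the
entries suffice; the finitely many conditions on the entries are imposed simultaneously. -/
theorem FiniteRankApprox.pi_sum {J : Type*} [Fintype J] {E : J → Type*}
    [∀ j, NormedAddCommGroup (E j)] [∀ j, NormedSpace ℂ (E j)] {T : ∀ j i, E i →L[ℂ] E j}
    (hT : ∀ j i, FiniteRankApprox (T j i)) :
    FiniteRankApprox (ContinuousLinearMap.pi fun j =>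
      ∑ i, (T j i).comp (ContinuousLinearMap.proj (R := ℂ) (φ := E) i)) := by
  intro ε hε
  choose N R hN hR h using fun j i => hT j i (ε / (Fintype.card J + 1)) (by positivity)
  refine ⟨⨅ j, ⨅ i, (N j i).comap (LinearMap.proj i), ContinuousLinearMap.pi fun j =>
      ∑ i, (R j i).comp (ContinuousLinearMap.proj (R := ℂ) (φ := E) i), ?_, ?_, ?_⟩
  · refine finite_quotient_iInf fun j => finite_quotient_iInf fun i => ?_
    have : (N j i).comap (LinearMap.proj i) =
        LinearMap.ker ((N j i).mkQ ∘ₗ (LinearMap.proj (R := ℂ) (φ := E) i)) := by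
      rw [LinearMap.ker_comp, Submodule.ker_mkQ]
    rw [this]
    have := hN j i
    exact Module.Finite.equiv (LinearMap.quotKerEquivRange _).symm
  · refine ContinuousLinearMap.opNorm_le_bound _ hε.le fun v => ?_
    rw [pi_norm_le_iff_of_nonneg (by positivity)]
    intro j
    simp only [ContinuousLinearMap.coe_pi', sum_apply, ContinuousLinearMap.comp_apply,
      ContinuousLinearMap.proj_apply]
    have hb : ∀ i ∈ Finset.univ, ‖R j i (v i)‖ ≤ ε / (Fintype.card J + 1) * ‖v‖ := fun i _ =>
      ((R j i).le_opNorm _).trans (mul_le_mul (hR j i) (norm_le_pi_norm v i) (norm_nonneg _)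
        (by positivity))
    refine (norm_sum_le_of_le _ hb).trans ?_
    rw [Finset.sum_const, Finset.card_univ, nsmul_eq_mul, ← mul_assoc]
    gcongr
    rw [mul_div_assoc', div_le_iff₀ (by positivity)]
    nlinarith
  · intro v hv
    simp only [Submodule.mem_iInf, Submodule.mem_comap, LinearMap.proj_apply] at hv
    ext1 j
    simp only [ContinuousLinearMap.coe_pi', sum_apply, ContinuousLinearMap.comp_apply,
      ContinuousLinearMap.proj_apply]
    exact Finset.sum_congr rfl fun i _ => h j i _ (hv j i)

/-- If `T` is approximated by operators of finite rank, then `1 + T` has cofinite range, so it meets the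
image of every infinite-dimensional space. -/
theorem FiniteRankApprox.exists_add_eq {E V : Type*} [NormedAddCommGroup E] [NormedSpace ℂ E]
    [CompleteSpace E] [AddCommGroup V] [Module ℂ V] (hV : ¬ Module.Finite ℂ V) {T : E →L[ℂ] E}
    (hT : FiniteRankApprox T) (A : V →ₗ[ℂ] E) : ∃ x ≠ 0, ∃ v, v + T v = A x := by
  obtain ⟨N, R, hN, hR, h⟩ := hT (1 / 2) (by norm_num)
  -- Neumann series, as the norm of `R` is at most 1/2.
  have hu : IsUnit (1 + R) := by
    have := isUnit_one_sub_of_norm_lt_one (x := -R) (by rw [norm_neg]; linarith)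
    rwa [sub_neg_eq_add] at this
  obtain ⟨U, hU⟩ := hu
  -- The candidate solution is v = (1 + R)⁻¹(A x). It solves the equation for T as soon as v lies in
  -- `N`, where T and R agree. The map `B` is the obstruction; its target is finite-dimensional, so
  -- it kills some x ≠ 0.
  let B : V →ₗ[ℂ] E ⧸ N := N.mkQ ∘ₗ (↑(U⁻¹ : (E →L[ℂ] E)ˣ) : E →L[ℂ] E).toLinearMap ∘ₗ A
  have hB : ¬ Function.Injective B := fun hi => hV (Module.Finite.of_injective B hi)
  rw [← LinearMap.ker_eq_bot, Submodule.eq_bot_iff] at hB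
  push Not at hB
  obtain ⟨x, hx, hx0⟩ := hB
  refine ⟨x, hx0, (↑(U⁻¹ : (E →L[ℂ] E)ˣ) : E →L[ℂ] E) (A x), ?_⟩
  have hmem : (↑(U⁻¹ : (E →L[ℂ] E)ˣ) : E →L[ℂ] E) (A x) ∈ N := by
    rw [← Submodule.ker_mkQ N]
    exact hx
  rw [h _ hmem]
  have h1 : ((1 + R) * (↑(U⁻¹ : (E →L[ℂ] E)ˣ) : E →L[ℂ] E)) (A x) = A x := by
    rw [← hU, U.mul_inv]
    rfl
  exact h1

/-- Solvability, up to finitely many conditions, of a system of Fredholm integral equations with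
continuous kernels on compact subsets of the plane. -/
theorem exists_integral_equation {J V : Type*} [Fintype J] {K : J → Set ℂ}
    (hK : ∀ j, IsCompact (K j)) (k : ∀ j i, C(K j × K i, ℂ)) [AddCommGroup V] [Module ℂ V]
    (hV : ¬ Module.Finite ℂ V) (A : V →ₗ[ℂ] ∀ j, C(K j, ℂ)) :
    ∃ x ≠ 0, ∃ v : ∀ j, C(K j, ℂ), ∀ j z,
      v j z + ∑ i, ∫ w : K i, k j i (z, w) * v i w ∂(Measure.comap Subtype.val volume) = A x j z := by
  have : ∀ j, CompactSpace (K j) := fun j => isCompact_iff_compactSpace.1 (hK j)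
  have : ∀ j, IsFiniteMeasure (Measure.comap (Subtype.val : K j → ℂ) volume) := fun j => by
    constructor
    rw [Measure.comap_apply _ Subtype.val_injective
      (fun s hs => (hK j).measurableSet.subtype_image hs) _ MeasurableSet.univ]
    simpa using (hK j).measure_lt_top
  obtain ⟨x, hx, v, hv⟩ := (FiniteRankApprox.pi_sum fun j i => finiteRankApprox_kernelOp
    (Measure.comap (Subtype.val : K i → ℂ) volume) (k j i)).exists_add_eq hV A
  refine ⟨x, hx, v, fun j z => ?_⟩
  rw [← hv]
  simp [kernelOp_apply]

/-! ### Change of charts -/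

section Charts

variable {S : Type*} [TopologicalSpace S] [ChartedSpace ℂ S]

/-- The change of coordinates from the preferred chart at `d` to the preferred chart at `c`. -/
def tr (c d : S) : ℂ → ℂ := chartAt ℂ c ∘ (chartAt ℂ d).symm

theorem tendsto_symm {c x : S} (hx : x ∈ (chartAt ℂ c).source) :
    Tendsto (chartAt ℂ c).symm (𝓝 (chartAt ℂ c x)) (𝓝 x) := by
  have h := (chartAt ℂ c).continuousAt_symm ((chartAt ℂ c).map_source hx)
  rwa [ContinuousAt, (chartAt ℂ c).left_inv hx] at h

theorem eventually_source {c x : S} (hx : x ∈ (chartAt ℂ c).source) :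
    ∀ᶠ y in 𝓝 x, y ∈ (chartAt ℂ c).source :=
  (chartAt ℂ c).open_source.mem_nhds hx

theorem eventually_target {c x : S} (hx : x ∈ (chartAt ℂ c).source) :
    ∀ᶠ z in 𝓝 (chartAt ℂ c x), z ∈ (chartAt ℂ c).target :=
  (chartAt ℂ c).open_target.mem_nhds ((chartAt ℂ c).map_source hx)

theorem tendsto_chart {c x : S} (hx : x ∈ (chartAt ℂ c).source) :
    Tendsto (chartAt ℂ c) (𝓝 x) (𝓝 (chartAt ℂ c x)) :=
  (chartAt ℂ c).continuousAt hx

theorem tendsto_symm_ne {c x : S} (hx : x ∈ (chartAt ℂ c).source) :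
    Tendsto (chartAt ℂ c).symm (𝓝[≠] (chartAt ℂ c x)) (𝓝[≠] x) := by
  refine tendsto_nhdsWithin_iff.2 ⟨(tendsto_symm hx).mono_left nhdsWithin_le_nhds, ?_⟩
  filter_upwards [mem_nhdsWithin_of_mem_nhds (eventually_target hx), self_mem_nhdsWithin]
    with z hz hne h
  apply hne
  rw [mem_singleton_iff] at h ⊢
  rw [← h, (chartAt ℂ c).right_inv hz]

theorem tendsto_chart_ne {c x : S} (hx : x ∈ (chartAt ℂ c).source) :
    Tendsto (chartAt ℂ c) (𝓝[≠] x) (𝓝[≠] (chartAt ℂ c x)) := by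
  refine tendsto_nhdsWithin_iff.2 ⟨(tendsto_chart hx).mono_left nhdsWithin_le_nhds, ?_⟩
  filter_upwards [mem_nhdsWithin_of_mem_nhds (eventually_source hx), self_mem_nhdsWithin]
    with z hz hne h
  exact hne ((chartAt ℂ c).injOn hz hx h)

theorem comp_symm_eventuallyEq {E : Type*} (f : S → E) {c d x : S} (hd : x ∈ (chartAt ℂ d).source)
    (hc : x ∈ (chartAt ℂ c).source) :
    f ∘ (chartAt ℂ d).symm =ᶠ[𝓝 (chartAt ℂ d x)] (f ∘ (chartAt ℂ c).symm) ∘ tr c d := by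
  filter_upwards [(tendsto_symm hd).eventually (eventually_source hc)] with z hz
  simp only [Function.comp_apply, tr]
  rw [(chartAt ℂ c).left_inv hz]

theorem tr_apply {c d x : S} (hd : x ∈ (chartAt ℂ d).source) :
    tr c d (chartAt ℂ d x) = chartAt ℂ c x := by
  simp [tr, (chartAt ℂ d).left_inv hd]

variable [IsManifold 𝓘(ℂ) ω S]

theorem holAt_iff {f : S → ℂ} {c x : S} (hx : x ∈ (chartAt ℂ c).source) :
    HolAt f x ↔ AnalyticAt ℂ (f ∘ (chartAt ℂ c).symm) (chartAt ℂ c x) := by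
  rw [HolAt, contMDiffAt_iff_source_of_mem_source hx]
  simp only [mfld_simps, contMDiffWithinAt_iff_contDiffWithinAt,
    contDiffWithinAt_univ]
  exact ⟨ContDiffAt.analyticAt, fun h => h.contDiffAt⟩

theorem analyticAt_tr {c d x : S} (hd : x ∈ (chartAt ℂ d).source) (hc : x ∈ (chartAt ℂ c).source) :
    AnalyticAt ℂ (tr c d) (chartAt ℂ d x) :=
  (holAt_iff hd).1 (contMDiffAt_of_mem_maximalAtlas (IsManifold.chart_mem_maximalAtlas c) hc)

theorem deriv_tr_mul {c d x : S} (hd : x ∈ (chartAt ℂ d).source)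
    (hc : x ∈ (chartAt ℂ c).source) :
    deriv (tr d c) (chartAt ℂ c x) * deriv (tr c d) (chartAt ℂ d x) = 1 := by
  have h1 := (analyticAt_tr hd hc).differentiableAt.hasDerivAt
  have h2 : HasDerivAt (tr d c) (deriv (tr d c) (chartAt ℂ c x)) (tr c d (chartAt ℂ d x)) := by
    rw [tr_apply hd]
    exact (analyticAt_tr hc hd).differentiableAt.hasDerivAt
  have h3 := h2.comp _ h1
  have h4 : tr d c ∘ tr c d =ᶠ[𝓝 (chartAt ℂ d x)] id := by
    filter_upwards [(tendsto_symm hd).eventually (eventually_source hc), eventually_target hd]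
      with z hz hz'
    simp only [tr, Function.comp_apply, id]
    rw [(chartAt ℂ c).left_inv hz, (chartAt ℂ d).right_inv hz']
  exact (h3.congr_of_eventuallyEq h4.symm).unique (hasDerivAt_id _)

theorem deriv_tr_ne_zero {c d x : S} (hd : x ∈ (chartAt ℂ d).source)
    (hc : x ∈ (chartAt ℂ c).source) : deriv (tr c d) (chartAt ℂ d x) ≠ 0 :=
  right_ne_zero_of_mul_eq_one (deriv_tr_mul hd hc)

theorem meroAt_iff {f : S → ℂ} {c x : S} (hx : x ∈ (chartAt ℂ c).source) :
    MeroAt f x ↔ MeromorphicAt (f ∘ (chartAt ℂ c).symm) (chartAt ℂ c x) := by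
  have hxx := mem_chart_source ℂ x
  have h1 : MeromorphicAt (f ∘ (chartAt ℂ c).symm) (chartAt ℂ c x) ↔
      MeromorphicAt ((f ∘ (chartAt ℂ x).symm) ∘ tr x c) (chartAt ℂ c x) :=
    MeromorphicAt.meromorphicAt_congr
      ((comp_symm_eventuallyEq f hx hxx).filter_mono nhdsWithin_le_nhds)
  rw [h1, meromorphicAt_comp_iff_of_deriv_ne_zero (analyticAt_tr hx hxx) (deriv_tr_ne_zero hx hxx),
    tr_apply hx]
  rfl

end Charts

/-! ### Meromorphic germs -/

section Germs

variable {S : Type*} [TopologicalSpace S] [ChartedSpace ℂ S]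

theorem eventually_codiscrete_iff {P : S → Prop} :
    (∀ᶠ x in codiscrete S, P x) ↔ ∀ p, ∀ᶠ x in 𝓝[≠] p, P x := by
  rw [Filter.Eventually, mem_codiscrete]
  refine forall_congr' fun p => ?_
  rw [disjoint_principal_right, compl_compl]
  rfl

theorem ord_congr {f g : S → ℂ} {p : S} (h : ∀ᶠ x in 𝓝[≠] p, f x = g x) : ord f p = ord g p :=
  meromorphicOrderAt_congr ((tendsto_chart_symm_punctured p).eventually h)

theorem ord_eq_top_iff {f : S → ℂ} {p : S} : ord f p = ⊤ ↔ ∀ᶠ x in 𝓝[≠] p, f x = 0 := by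
  rw [ord, meromorphicOrderAt_eq_top_iff]
  constructor
  · intro h
    filter_upwards [(tendsto_chart_ne (mem_chart_source ℂ p)).eventually h,
      mem_nhdsWithin_of_mem_nhds (eventually_source (mem_chart_source ℂ p))] with x hx hx'
    rwa [Function.comp_apply, (chartAt ℂ p).left_inv hx'] at hx
  · exact fun h => (tendsto_chart_symm_punctured p).eventually h

theorem MeroAt.mul {f g : S → ℂ} {p : S} (hf : MeroAt f p) (hg : MeroAt g p) :
    MeroAt (fun x => f x * g x) p :=
  MeromorphicAt.mul hf hg

theorem MeroAt.congr_iff {f g : S → ℂ} {p : S} (h : ∀ᶠ x in 𝓝[≠] p, f x = g x) :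
    MeroAt f p ↔ MeroAt g p :=
  ⟨fun hf => hf.congr h, fun hg => hg.congr (h.mono fun _ hx => hx.symm)⟩

variable [IsManifold 𝓘(ℂ) ω S]

theorem HolAt.analyticAt {f : S → ℂ} {p : S} (h : HolAt f p) :
    AnalyticAt ℂ (f ∘ (chartAt ℂ p).symm) (chartAt ℂ p p) :=
  (holAt_iff (mem_chart_source ℂ p)).1 h

theorem HolAt.meroAt {f : S → ℂ} {p : S} (h : HolAt f p) : MeroAt f p :=
  h.analyticAt.meromorphicAt

theorem HolAt.eventually {f : S → ℂ} {p : S} (h : HolAt f p) : ∀ᶠ x in 𝓝 p, HolAt f x := by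
  have hp := mem_chart_source ℂ p
  filter_upwards [(tendsto_chart hp).eventually h.analyticAt.eventually_analyticAt,
    eventually_source hp] with x hx hx'
  exact (holAt_iff hx').2 hx

theorem HolAt.congr {f g : S → ℂ} {p : S} (hf : HolAt f p) (h : ∀ᶠ x in 𝓝 p, f x = g x) :
    HolAt g p :=
  ContMDiffAt.congr_of_eventuallyEq hf (h.mono fun _ hx => hx.symm)

theorem HolAt.cexp {f : S → ℂ} {p : S} (hf : HolAt f p) :
    HolAt (fun x => Complex.exp (f x)) p :=
  ContMDiffAt.comp p (Complex.contDiff_exp.contMDiff.contMDiffAt) hf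

theorem HolAt.mul {f g : S → ℂ} {p : S} (hf : HolAt f p) (hg : HolAt g p) :
    HolAt (fun x => f x * g x) p :=
  ContMDiffAt.mul hf hg

theorem HolAt.neg {f : S → ℂ} {p : S} (hf : HolAt f p) : HolAt (fun x => - f x) p :=
  ContMDiffAt.neg hf

theorem HolAt.ord_eq_zero {f : S → ℂ} {p : S} (hf : HolAt f p) (h0 : f p ≠ 0) : ord f p = 0 := by
  have h := hf.analyticAt
  rw [ord, h.meromorphicOrderAt_eq, h.analyticOrderAt_eq_zero.2]
  · rfl
  · rwa [Function.comp_apply, (chartAt ℂ p).left_inv (mem_chart_source ℂ p)]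

theorem ord_mul_of_holAt {f g : S → ℂ} {p : S} (hg : HolAt g p) (h0 : g p ≠ 0) :
    ord (fun x => f x * g x) p = ord f p := by
  have h : (fun x => f x * g x) = fun x => g x * f x := by
    ext x; ring
  rw [h]
  refine meromorphicOrderAt_mul_of_ne_zero hg.analyticAt ?_
  rwa [(chartAt ℂ p).left_inv (mem_chart_source ℂ p)]

theorem meroAt_mul_iff {f g : S → ℂ} {p : S} (hg : HolAt g p) (h0 : g p ≠ 0) :
    MeroAt (fun x => f x * g x) p ↔ MeroAt f p := by
  refine ⟨fun h => ?_, fun h => h.mul hg.meroAt⟩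
  have hi : MeroAt (fun x => (g x)⁻¹) p := MeromorphicAt.inv hg.meroAt
  refine (h.mul hi).congr (mem_nhdsWithin_of_mem_nhds ?_)
  filter_upwards [hg.continuousAt.eventually_ne h0] with x hx
  field_simp

theorem MeroAt.eventually_holAt {f : S → ℂ} {p : S} (hf : MeroAt f p) :
    ∀ᶠ x in 𝓝[≠] p, HolAt f x := by
  have hp := mem_chart_source ℂ p
  have h := MeromorphicAt.eventually_analyticAt hf
  filter_upwards [(tendsto_chart_ne hp).eventually h,
    mem_nhdsWithin_of_mem_nhds (eventually_source hp)] with x hx hx'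
  exact (holAt_iff hx').2 hx

theorem MeroAt.eventually_ne_zero {f : S → ℂ} {p : S} (hf : MeroAt f p) (h : ord f p ≠ ⊤) :
    ∀ᶠ x in 𝓝[≠] p, f x ≠ 0 := by
  have hp := mem_chart_source ℂ p
  filter_upwards [(tendsto_chart_ne hp).eventually
    ((meromorphicOrderAt_ne_top_iff_eventually_ne_zero hf).1 h),
    mem_nhdsWithin_of_mem_nhds (eventually_source hp)] with x hx hx'
  rwa [Function.comp_apply, (chartAt ℂ p).left_inv hx'] at hx

end Germs

/-! ### The underlying real surface -/

section Real

variable {S : Type*} [TopologicalSpace S] [ChartedSpace ℂ S] [IsManifold 𝓘(ℂ) ω S]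

/-- Holomorphic changes of charts are real smooth. This gives access to bump functions and
partitions of unity, which exist only over the reals. -/
instance isManifold_real : IsManifold 𝓘(ℝ, ℂ) ∞ S := by
  refine isManifold_of_contDiffOn _ _ _ fun e e' he he' => ?_
  have h : e.symm ≫ₕ e' ∈ contDiffGroupoid ω 𝓘(ℂ) :=
    HasGroupoid.compatible he he'
  have h1 := contMDiffOn_of_mem_contDiffGroupoid h
  rw [contMDiffOn_iff_contDiffOn] at h1
  have h2 : ContDiffOn ℝ ∞ (e.symm ≫ₕ e') (e.symm ≫ₕ e').source :=
    (h1.of_le (by simp)).restrict_scalars ℝ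
  simpa using! h2

theorem contDiffOn_comp_symm {f : S → ℂ} (hf : ContMDiff 𝓘(ℝ, ℂ) 𝓘(ℝ, ℂ) ∞ f) (c : S) :
    ContDiffOn ℝ ∞ (f ∘ (chartAt ℂ c).symm) (chartAt ℂ c).target := by
  rw [← contMDiffOn_iff_contDiffOn]
  exact hf.comp_contMDiffOn contMDiffOn_chart_symm

theorem contDiffAt_comp_symm {f : S → ℂ} (hf : ContMDiff 𝓘(ℝ, ℂ) 𝓘(ℝ, ℂ) ∞ f) {c x : S}
    (hx : x ∈ (chartAt ℂ c).source) :
    ContDiffAt ℝ ∞ (f ∘ (chartAt ℂ c).symm) (chartAt ℂ c x) :=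
  (contDiffOn_comp_symm hf c).contDiffAt (eventually_target hx)

theorem differentiableAt_comp_symm {f : S → ℂ} (hf : ContMDiff 𝓘(ℝ, ℂ) 𝓘(ℝ, ℂ) ∞ f) {c x : S}
    (hx : x ∈ (chartAt ℂ c).source) :
    DifferentiableAt ℝ (f ∘ (chartAt ℂ c).symm) (chartAt ℂ c x) :=
  (contDiffAt_comp_symm hf hx).differentiableAt (by simp)

/-- The coefficient of `∂̄f` in the preferred chart at `c`, as a function on the surface. -/
def dbarAt (c : S) (f : S → ℂ) (x : S) : ℂ := dbar (f ∘ (chartAt ℂ c).symm) (chartAt ℂ c x)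

/-- The conjugated derivative is the transition law of a (0,1)-form, so ∂̄f makes sense globally. -/
theorem dbarAt_eq {f : S → ℂ} {c d x : S} (hd : x ∈ (chartAt ℂ d).source)
    (hc : x ∈ (chartAt ℂ c).source)
    (hf : DifferentiableAt ℝ (f ∘ (chartAt ℂ c).symm) (chartAt ℂ c x)) :
    dbarAt d f x = conj (deriv (tr c d) (chartAt ℂ d x)) * dbarAt c f x := by
  rw [dbarAt, dbar_congr (comp_symm_eventuallyEq f hd hc), dbar_comp _
    (analyticAt_tr hd hc).differentiableAt, tr_apply hd]
  · rfl
  · rwa [tr_apply hd]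

theorem dbarAt_congr {f g : S → ℂ} {c x : S} (hx : x ∈ (chartAt ℂ c).source)
    (h : ∀ᶠ y in 𝓝 x, f y = g y) : dbarAt c f x = dbarAt c g x :=
  dbar_congr ((tendsto_symm hx).eventually h)

end Real

/-! ### Sections of a line bundle with a pole, by a parametrix for `∂̄` -/

/-- A finite atlas with cutoff functions `ψ j`, a partition of unity `ρ j` such that `ψ j = 1` near the
support of `ρ j`, and frames `e j` over `U j` of a line bundle on `S`. -/
structure FrameCover (S : Type*) [TopologicalSpace S] [ChartedSpace ℂ S] (J : Type*)
    [Fintype J] where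
  c : J → S
  U : J → Set S
  O : J → Set S
  isOpen_U : ∀ j, IsOpen (U j)
  isOpen_O : ∀ j, IsOpen (O j)
  U_subset : ∀ j, U j ⊆ (chartAt ℂ (c j)).source
  ψ : J → S → ℂ
  ρ : J → S → ℂ
  smooth_ψ : ∀ j, ContMDiff 𝓘(ℝ, ℂ) 𝓘(ℝ, ℂ) ∞ (ψ j)
  smooth_ρ : ∀ j, ContMDiff 𝓘(ℝ, ℂ) 𝓘(ℝ, ℂ) ∞ (ρ j)
  tsupport_ψ : ∀ j, tsupport (ψ j) ⊆ U j
  tsupport_ρ : ∀ j, tsupport (ρ j) ⊆ O j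
  ψ_eq_one : ∀ j, ∀ x ∈ O j, ψ j x = 1
  sum_ρ : ∀ x, ∑ j, ρ j x = 1
  -- No regularity is asked of a single `e j`, only of the quotients: at a puncture the frame will
  -- be exp h, which is not meromorphic there.
  e : J → S → ℂ
  e_ne_zero : ∀ j x, e j x ≠ 0
  hol_e : ∀ i j, ∀ x ∈ U i ∩ U j, HolAt (fun x => e i x / e j x) x

namespace FrameCover

variable {S : Type*} [TopologicalSpace S] [ChartedSpace ℂ S] {J : Type*} [Fintype J]
  (F : FrameCover S J)

theorem O_subset (j : J) : F.O j ⊆ F.U j := fun x hx =>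
  F.tsupport_ψ j (subset_tsupport _ (by rw [Function.mem_support, F.ψ_eq_one j x hx]; exact one_ne_zero))

theorem source {j : J} {x : S} (hx : x ∈ F.U j) : x ∈ (chartAt ℂ (F.c j)).source :=
  F.U_subset j hx

/-- The coordinate image of the support of `ρ j`. -/
def K (j : J) : Set ℂ := chartAt ℂ (F.c j) '' tsupport (F.ρ j)

theorem tsupport_ρ_subset (j : J) : tsupport (F.ρ j) ⊆ (chartAt ℂ (F.c j)).source :=
  (F.tsupport_ρ j).trans ((F.O_subset j).trans (F.U_subset j))

theorem isCompact_K [CompactSpace S] (j : J) : IsCompact (F.K j) :=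
  (isClosed_tsupport _).isCompact.image_of_continuousOn
    ((chartAt ℂ (F.c j)).continuousOn.mono (F.tsupport_ρ_subset j))

theorem notMem_K {j : J} {x : S} (hx : x ∈ F.U j) (hρ : x ∉ tsupport (F.ρ j)) :
    chartAt ℂ (F.c j) x ∉ F.K j := by
  rintro ⟨y, hy, hyx⟩
  rw [(chartAt ℂ (F.c j)).injOn (F.tsupport_ρ_subset j hy) (F.source hx) hyx] at hy
  exact hρ hy

variable [IsManifold 𝓘(ℂ) ω S]

open Classical in
/-- The coefficient of the error term of the parametrix. -/
def b (j i : J) (z : ℂ) : ℂ :=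
  if z ∈ (chartAt ℂ (F.c j)).target then
    F.ρ j ((chartAt ℂ (F.c j)).symm z) * dbarAt (F.c j) (F.ψ i) ((chartAt ℂ (F.c j)).symm z) *
      (F.e i ((chartAt ℂ (F.c j)).symm z) / F.e j ((chartAt ℂ (F.c j)).symm z))
  else 0

theorem b_apply {j : J} (i : J) {x : S} (hx : x ∈ F.U j) :
    F.b j i (chartAt ℂ (F.c j) x) =
      F.ρ j x * dbarAt (F.c j) (F.ψ i) x * (F.e i x / F.e j x) := by
  rw [b, if_pos ((chartAt ℂ (F.c j)).map_source (F.source hx)),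
    (chartAt ℂ (F.c j)).left_inv (F.source hx)]

theorem b_eq_zero {j : J} (i : J) {z : ℂ} (hz : z ∉ F.K j) : F.b j i z = 0 := by
  rw [b]
  split_ifs with h
  · have : (chartAt ℂ (F.c j)).symm z ∉ tsupport (F.ρ j) := fun h' =>
      hz ⟨_, h', (chartAt ℂ (F.c j)).right_inv h⟩
    rw [image_eq_zero_of_notMem_tsupport this]
    simp
  · rfl

theorem dbarAt_ψ_eq_zero {i : J} (c : S) {x : S} (hc : x ∈ (chartAt ℂ c).source)
    (hx : x ∉ tsupport (F.ψ i) ∨ x ∈ F.O i) : dbarAt c (F.ψ i) x = 0 := by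
  have h : ∀ a : ℂ, (∀ᶠ y in 𝓝 x, F.ψ i y = a) → dbarAt c (F.ψ i) x = 0 := by
    intro a h
    rw [dbarAt_congr hc h]
    exact dbar_of_differentiableAt (differentiableAt_const a)
  rcases hx with hx | hx
  · refine h 0 ?_
    exact notMem_tsupport_iff_eventuallyEq.1 hx
  · refine h 1 ?_
    filter_upwards [(F.isOpen_O i).mem_nhds hx] with y hy using F.ψ_eq_one i y hy

/-- This is what ψ i = 1 near supp ρ i is for. If a point of supp ρ j lies in supp ψ i but not in O
i, it is in U i and off supp ρ i, so its i-th coordinate avoids K i. At all other points the factor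
ρ j · ∂̄ψ i vanishes locally and hides the meaningless values of the chart change. -/
theorem b_dichotomy [CompactSpace S] (j i : J) (z : ℂ) : (∀ᶠ w in 𝓝 z, F.b j i w = 0) ∨
    (ContDiffAt ℝ 1 (F.b j i) z ∧ AnalyticAt ℂ (tr (F.c i) (F.c j)) z ∧
      tr (F.c i) (F.c j) z ∉ F.K i) := by
  by_cases hz : z ∈ F.K j
  swap
  · left
    filter_upwards [(F.isCompact_K j).isClosed.isOpen_compl.mem_nhds hz] with w hw
    exact F.b_eq_zero i hw
  obtain ⟨x, hx, rfl⟩ := hz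
  have hxU : x ∈ F.U j := F.O_subset j (F.tsupport_ρ j hx)
  have hxs := F.source hxU
  by_cases hψ : x ∉ tsupport (F.ψ i) ∨ x ∈ F.O i
  · left
    have h1 : ∀ᶠ y in 𝓝 x, y ∉ tsupport (F.ψ i) ∨ y ∈ F.O i := by
      rcases hψ with h | h
      · filter_upwards [(isClosed_tsupport _).isOpen_compl.mem_nhds h] with y hy using Or.inl hy
      · filter_upwards [(F.isOpen_O i).mem_nhds h] with y hy using Or.inr hy
    filter_upwards [(tendsto_symm hxs).eventually h1,
      (tendsto_symm hxs).eventually (eventually_source hxs)] with w hw hw'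
    rw [b, F.dbarAt_ψ_eq_zero _ hw' hw]
    simp
  · right
    push Not at hψ
    have hxi : x ∈ F.U i := F.tsupport_ψ i hψ.1
    refine ⟨?_, analyticAt_tr hxs (F.source hxi), ?_⟩
    · have h1 : ContDiffAt ℝ ∞ (F.ρ j ∘ (chartAt ℂ (F.c j)).symm) (chartAt ℂ (F.c j) x) :=
        contDiffAt_comp_symm (F.smooth_ρ j) hxs
      have h2 : ContDiffAt ℝ 1 (dbar (F.ψ i ∘ (chartAt ℂ (F.c j)).symm))
          (chartAt ℂ (F.c j) x) := by
        have h := (contDiffAt_comp_symm (F.smooth_ψ i) hxs).fderiv_right (m := 1)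
          (by norm_cast)
        unfold dbar
        exact ((h.clm_apply contDiffAt_const).add (contDiffAt_const.mul
          (h.clm_apply contDiffAt_const))).div_const 2
      have h3 : AnalyticAt ℂ ((fun x => F.e i x / F.e j x) ∘ (chartAt ℂ (F.c j)).symm)
          (chartAt ℂ (F.c j) x) := (holAt_iff hxs).1 (F.hol_e i j x ⟨hxi, hxU⟩)
      have h4 : ContDiffAt ℝ 1 ((fun x => F.e i x / F.e j x) ∘ (chartAt ℂ (F.c j)).symm)
          (chartAt ℂ (F.c j) x) := h3.contDiffAt.restrict_scalars ℝ
      refine (((h1.of_le (by exact_mod_cast le_top)).mul h2).mul h4).congr_of_eventuallyEq ?_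
      filter_upwards [eventually_target hxs] with w hw
      rw [b, if_pos hw]
      simp [dbarAt, (chartAt ℂ (F.c j)).right_inv hw]
    · rw [tr_apply hxs]
      exact F.notMem_K hxi fun h => hψ.2 (F.tsupport_ρ i h)

/-- By the dichotomy, G is only evaluated off K i wherever the coefficient is not locally zero. This
gives the regularity of the solution of the integral equation. -/
theorem contDiff_b_mul [CompactSpace S] (j i : J) {G : ℂ → ℂ}
    (hG : ∀ w ∉ F.K i, DifferentiableAt ℂ G w) :
    ContDiff ℝ 1 fun z => F.b j i z * G (tr (F.c i) (F.c j) z) := by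
  rw [contDiff_iff_contDiffAt]
  intro z
  rcases F.b_dichotomy j i z with h | ⟨h1, h2, h3⟩
  · refine (contDiffAt_const (c := (0 : ℂ))).congr_of_eventuallyEq ?_
    filter_upwards [h] with w hw
    rw [hw, zero_mul]
  · refine h1.mul ?_
    have hGa : AnalyticAt ℂ G (tr (F.c i) (F.c j) z) := by
      rw [Complex.analyticAt_iff_eventually_differentiableAt]
      filter_upwards [(F.isCompact_K i).isClosed.isOpen_compl.mem_nhds h3] with w hw
      exact hG w hw
    exact (hGa.comp h2).contDiffAt.restrict_scalars ℝ

/-- The kernel of the error term of the parametrix. -/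
def kernel [CompactSpace S] (j i : J) : C(F.K j × F.K i, ℂ) where
  toFun p := F.b j i p.1 * ((Real.pi : ℂ)⁻¹ / (tr (F.c i) (F.c j) p.1 - p.2))
  continuous_toFun := by
    rw [continuous_iff_continuousAt]
    rintro ⟨z, w⟩
    have hz : ContinuousAt (fun p : F.K j × F.K i => (p.1 : ℂ)) (z, w) := by fun_prop
    have hw : ContinuousAt (fun p : F.K j × F.K i => (p.2 : ℂ)) (z, w) := by fun_prop
    rcases F.b_dichotomy j i z with h | ⟨h1, h2, h3⟩
    · refine ContinuousAt.congr (continuousAt_const (y := (0 : ℂ))) ?_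
      filter_upwards [hz.eventually h] with p hp
      rw [hp, zero_mul]
    · refine ContinuousAt.mul ?_ (ContinuousAt.div continuousAt_const (ContinuousAt.sub ?_ hw) ?_)
      · exact ContinuousAt.comp (g := F.b j i) h1.continuousAt hz
      · exact ContinuousAt.comp (g := tr (F.c i) (F.c j)) h2.continuousAt hz
      · rw [sub_ne_zero]
        intro h
        exact h3 (h ▸ w.2)

/-- The polar part with coefficients given by a polynomial. -/
def polar (z₀ : ℂ) (p : Polynomial ℂ) (z : ℂ) : ℂ := (Polynomial.X * p).eval (z - z₀)⁻¹

theorem differentiableAt_polar {z₀ z : ℂ} (p : Polynomial ℂ) (hz : z ≠ z₀) :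
    DifferentiableAt ℂ (polar z₀ p) z := by
  unfold polar
  refine ((Polynomial.X * p).differentiable _).comp z ?_
  exact ((differentiableAt_id).sub_const z₀).inv (sub_ne_zero.2 hz)

/-- The factor X in `polar` makes the polynomial in 1/(z - z₀) non-constant even when p is constant.
-/
theorem tendsto_norm_polar {z₀ : ℂ} {p : Polynomial ℂ} (hp : p ≠ 0) :
    Tendsto (fun z => ‖polar z₀ p z‖) (𝓝[≠] z₀) atTop := by
  refine Polynomial.tendsto_norm_atTop _ ?_ ?_
  · rw [Polynomial.degree_mul, Polynomial.degree_X, Polynomial.degree_eq_natDegree hp]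
    norm_cast
    omega
  · have h : Tendsto (fun z : ℂ => z - z₀) (𝓝[≠] z₀) (𝓝[≠] 0) := by
      refine tendsto_nhdsWithin_iff.2 ⟨?_, ?_⟩
      · have : Tendsto (fun z : ℂ => z - z₀) (𝓝 z₀) (𝓝 (z₀ - z₀)) := by
          exact (continuous_id.sub continuous_const).tendsto z₀
        rw [sub_self] at this
        exact this.mono_left nhdsWithin_le_nhds
      · filter_upwards [self_mem_nhdsWithin] with z hz
        exact sub_ne_zero.2 hz
    exact tendsto_norm_inv_nhdsNE_zero_atTop.comp h

theorem meromorphicAt_polar (z₀ : ℂ) (p : Polynomial ℂ) : MeromorphicAt (polar z₀ p) z₀ := by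
  have h : MeromorphicAt (fun z : ℂ => (z - z₀)⁻¹) z₀ :=
    ((MeromorphicAt.id z₀).sub (MeromorphicAt.const z₀ z₀)).inv
  unfold polar
  generalize Polynomial.X * p = q
  induction q using Polynomial.induction_on' with
  | add f g hf hg =>
    simp only [Polynomial.eval_add]
    exact hf.add hg
  | monomial n a =>
    simp only [Polynomial.eval_monomial]
    exact (MeromorphicAt.const a z₀).mul (h.pow n)

end FrameCover

/-! ### Solving the integral equation and assembling the section -/

namespace FrameCover

variable {S : Type*} [TopologicalSpace S] [ChartedSpace ℂ S] {J : Type*} [Fintype J]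
  (F : FrameCover S J) [IsManifold 𝓘(ℂ) ω S]

theorem contDiff_potential [CompactSpace S] {o j : J} {G : ℂ → ℂ} {H : J → ℂ → ℂ}
    (hG : ∀ w ∉ F.K o, DifferentiableAt ℂ G w)
    (hH : ∀ i, ∀ w ∉ F.K i, DifferentiableAt ℂ (H i) w) :
    ContDiff ℝ 1 fun z => F.b j o z * G (tr (F.c o) (F.c j) z) -
      ∑ i, F.b j i z * H i (tr (F.c i) (F.c j) z) :=
  (F.contDiff_b_mul j o hG).sub (ContDiff.sum fun i _ => F.contDiff_b_mul j i (hH i))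

/-- The parametrix: for some nonzero polar part there are functions `H i` in the coordinate planes,
whose `∂̄` compensates for the effect of the cutoff functions. -/
theorem exists_potentials [CompactSpace S] {o : J} {z₀ : ℂ} (hz₀ : z₀ ∈ F.K o) :
    ∃ p : Polynomial ℂ, p ≠ 0 ∧ ∃ H : J → ℂ → ℂ, (∀ i, Differentiable ℝ (H i)) ∧
      ∀ i z, dbar (H i) z = F.b i o z * polar z₀ p (tr (F.c o) (F.c i) z) -
        ∑ k, F.b i k z * H k (tr (F.c k) (F.c i) z) := by
  have hpol : ∀ p, ∀ w ∉ F.K o, DifferentiableAt ℂ (polar z₀ p) w := fun p w hw =>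
    differentiableAt_polar p fun h => hw (h ▸ hz₀)
  -- The right-hand side of the system, linear in the polar part; the polynomials provide the
  -- infinite-dimensional source.
  let A : Polynomial ℂ →ₗ[ℂ] ∀ j, C(F.K j, ℂ) :=
    { toFun := fun p j => ⟨fun z => F.b j o z * polar z₀ p (tr (F.c o) (F.c j) z),
        (F.contDiff_b_mul j o (hpol p)).continuous.comp continuous_subtype_val⟩
      map_add' := by
        intro p q
        ext j z
        simp [polar, mul_add]
      map_smul' := by
        intro a p
        ext j z
        simp [polar]
        ring }
  obtain ⟨p, hp, v, hv⟩ := exists_integral_equation (fun j => F.isCompact_K j) F.kernel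
    Polynomial.not_finite A
  refine ⟨p, hp, ?_⟩
  classical
  let u : J → ℂ → ℂ := fun j w => if h : w ∈ F.K j then v j ⟨w, h⟩ else 0
  have hu : ∀ j, ContinuousOn (u j) (F.K j) := by
    intro j
    rw [continuousOn_iff_continuous_domRestrict]
    convert (v j).continuous using 1
    ext w
    simp [u]
  let H : J → ℂ → ℂ := fun j z => (Real.pi : ℂ)⁻¹ * ∫ w in F.K j, u j w / (z - w)
  have hH : ∀ i, ∀ w ∉ F.K i, DifferentiableAt ℂ (H i) w := fun i w hw =>
    (differentiableAt_integral_div (F.isCompact_K i) (hu i) hw).const_mul _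
  have hcd := fun j => F.contDiff_potential (o := o) (j := j) (hpol p) hH
  -- The equation bootstraps regularity. The solution is a priori only continuous on K j and
  -- extended by zero, but both sides vanish off K j, and the left side is C¹ because each `H i` is
  -- holomorphic off K i. Hence `u j` is C¹ on the whole plane and its Cauchy transform solves the
  -- ∂̄-equation.
  have hueq : ∀ j, (fun z => F.b j o z * polar z₀ p (tr (F.c o) (F.c j) z) -
      ∑ i, F.b j i z * H i (tr (F.c i) (F.c j) z)) = u j := by
    intro j
    ext z
    by_cases hz : z ∈ F.K j
    · have h := hv j ⟨z, hz⟩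
      have huz : u j z = v j ⟨z, hz⟩ := by simp [u, hz]
      rw [huz]
      have hA : A p j ⟨z, hz⟩ = F.b j o z * polar z₀ p (tr (F.c o) (F.c j) z) := rfl
      rw [hA] at h
      rw [sub_eq_iff_eq_add, ← h]
      congr 1
      refine Finset.sum_congr rfl fun i _ => ?_
      have hi : ∀ w : F.K i, F.kernel j i (⟨z, hz⟩, w) * v i w =
          F.b j i z * (Real.pi : ℂ)⁻¹ * (u i w / (tr (F.c i) (F.c j) z - w)) := by
        intro w
        have : u i w = v i w := by simp [u]
        rw [this]
        simp only [kernel, ContinuousMap.coe_mk]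
        ring
      simp_rw [hi]
      rw [integral_subtype_comap (F.isCompact_K i).measurableSet
        (fun w => F.b j i z * (Real.pi : ℂ)⁻¹ * (u i w / (tr (F.c i) (F.c j) z - w))),
        integral_const_mul, mul_assoc]
    · simp [F.b_eq_zero _ hz, u, hz]
  have hcs : ∀ j, HasCompactSupport (u j) := fun j =>
    HasCompactSupport.intro (F.isCompact_K j) fun w hw => by simp [u, hw]
  have hcd' : ∀ j, ContDiff ℝ 1 (u j) := fun j => hueq j ▸ hcd j
  have hHc : ∀ j, H j = cauchyT (u j) := by
    intro j
    ext z
    simp only [H, cauchyT]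
    congr 1
    refine setIntegral_eq_integral_of_forall_compl_eq_zero fun w hw => ?_
    simp [u, hw]
  refine ⟨H, fun i => hHc i ▸ differentiable_cauchyT (hcd' i) (hcs i), fun i z => ?_⟩
  have h1 := dbar_cauchyT (hcd' i) (hcs i) z
  rw [← hHc i, ← hueq i] at h1
  exact h1

/-- The local section `ψ i · G(z i) · e i`, read in the frame `e j`. -/
def piece (i j : J) (G : ℂ → ℂ) (x : S) : ℂ :=
  F.ψ i x * (F.e i x / F.e j x) * G (chartAt ℂ (F.c i) x)

theorem differentiableAt_piece {i j : J} {G : ℂ → ℂ} {x : S} (hx : x ∈ F.U j)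
    (hG : x ∈ F.U i → DifferentiableAt ℝ G (chartAt ℂ (F.c i) x)) :
    DifferentiableAt ℝ (F.piece i j G ∘ (chartAt ℂ (F.c j)).symm) (chartAt ℂ (F.c j) x) ∧
    dbarAt (F.c j) (F.piece i j G) x =
      dbarAt (F.c j) (F.ψ i) x * (F.e i x / F.e j x) * G (chartAt ℂ (F.c i) x) +
      F.ψ i x * (F.e i x / F.e j x) * (conj (deriv (tr (F.c i) (F.c j)) (chartAt ℂ (F.c j) x)) *
        dbar G (chartAt ℂ (F.c i) x)) := by
  have hxs := F.source hx
  by_cases hψ : x ∈ tsupport (F.ψ i)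
  · have hxi := F.tsupport_ψ i hψ
    have hxis := F.source hxi
    let ψ' : ℂ → ℂ := F.ψ i ∘ (chartAt ℂ (F.c j)).symm
    let r' : ℂ → ℂ := (fun x => F.e i x / F.e j x) ∘ (chartAt ℂ (F.c j)).symm
    have h1 : DifferentiableAt ℝ ψ' (chartAt ℂ (F.c j) x) :=
      differentiableAt_comp_symm (F.smooth_ψ i) hxs
    have h2 : DifferentiableAt ℂ r' (chartAt ℂ (F.c j) x) :=
      ((holAt_iff hxs).1 (F.hol_e i j x ⟨hxi, hx⟩)).differentiableAt
    have h3 : DifferentiableAt ℂ (tr (F.c i) (F.c j)) (chartAt ℂ (F.c j) x) :=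
      (analyticAt_tr hxs hxis).differentiableAt
    have hG' : DifferentiableAt ℝ G (tr (F.c i) (F.c j) (chartAt ℂ (F.c j) x)) := by
      rw [tr_apply hxs]
      exact hG hxi
    have h4 : DifferentiableAt ℝ (G ∘ tr (F.c i) (F.c j)) (chartAt ℂ (F.c j) x) :=
      hG'.comp _ (h3.restrictScalars ℝ)
    have h12 : DifferentiableAt ℝ (fun z => ψ' z * r' z) (chartAt ℂ (F.c j) x) :=
      h1.mul (h2.restrictScalars ℝ)
    have hdef : F.piece i j G ∘ (chartAt ℂ (F.c j)).symm =
        fun z => (ψ' z * r' z) * (G ∘ tr (F.c i) (F.c j)) z := rfl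
    refine ⟨by rw [hdef]; exact h12.mul h4, ?_⟩
    rw [dbarAt, hdef, dbar_mul h12 h4, dbar_mul_of_differentiableAt h1 h2, dbar_comp hG' h3]
    simp only [Function.comp_apply, tr_apply hxs, ψ', r', dbarAt,
      (chartAt ℂ (F.c j)).left_inv hxs]
  · have hev : ∀ᶠ y in 𝓝 x, F.piece i j G y = 0 := by
      filter_upwards [(isClosed_tsupport _).isOpen_compl.mem_nhds hψ] with y hy
      rw [piece, image_eq_zero_of_notMem_tsupport hy, zero_mul, zero_mul]
    have hev' : F.piece i j G ∘ (chartAt ℂ (F.c j)).symm =ᶠ[𝓝 (chartAt ℂ (F.c j) x)]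
        fun _ => 0 := (tendsto_symm hxs).eventually hev
    refine ⟨(differentiableAt_const (0 : ℂ)).congr_of_eventuallyEq hev', ?_⟩
    rw [F.dbarAt_ψ_eq_zero _ hxs (Or.inl hψ), image_eq_zero_of_notMem_tsupport hψ,
      dbarAt, dbar_congr hev', dbar_of_differentiableAt (differentiableAt_const _)]
    ring

theorem ψ_mul_ρ (i : J) (x : S) : F.ψ i x * F.ρ i x = F.ρ i x := by
  by_cases h : F.ρ i x = 0
  · simp [h]
  · rw [F.ψ_eq_one i x (F.tsupport_ρ i (subset_tsupport _ h)), one_mul]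

/-- Passing from chart and frame i to chart and frame j is absorbed by the conjugated derivative and
the quotient of frames, and ψ i by ψ i · ρ i = ρ i. So the corrections made in the various charts
are ρ i times one common (0,1)-form, and they add up to it. -/
theorem ψ_b (i j k : J) {x : S} (hx : x ∈ F.U j) :
    F.ψ i x * (F.e i x / F.e j x) * (conj (deriv (tr (F.c i) (F.c j)) (chartAt ℂ (F.c j) x)) *
      F.b i k (chartAt ℂ (F.c i) x)) =
    F.ρ i x * (dbarAt (F.c j) (F.ψ k) x * (F.e k x / F.e j x)) := by
  by_cases hψ : x ∈ tsupport (F.ψ i)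
  · have hxi := F.tsupport_ψ i hψ
    have h1 := dbarAt_eq (F.source hx) (F.source hxi)
      (differentiableAt_comp_symm (F.smooth_ψ k) (F.source hxi))
    rw [F.b_apply k hxi, h1]
    have hi := F.e_ne_zero i x
    have hj := F.e_ne_zero j x
    have h2 := F.ψ_mul_ρ i x
    field_simp
    linear_combination ((starRingEnd ℂ) (deriv (tr (F.c i) (F.c j)) (chartAt ℂ (F.c j) x)) *
      dbarAt (F.c i) (F.ψ k) x * F.e k x) * h2
  · have h0 := image_eq_zero_of_notMem_tsupport hψ
    rw [← F.ψ_mul_ρ i x, h0]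
    ring

theorem holAt_of_dbarAt {f : S → ℂ} {c x : S} (hx : x ∈ (chartAt ℂ c).source)
    (h : ∀ᶠ y in 𝓝 x, DifferentiableAt ℝ (f ∘ (chartAt ℂ c).symm) (chartAt ℂ c y) ∧
      dbarAt c f y = 0) : HolAt f x := by
  rw [holAt_iff hx, Complex.analyticAt_iff_eventually_differentiableAt]
  filter_upwards [(tendsto_symm hx).eventually h, eventually_target hx] with z hz hz'
  rw [dbarAt, (chartAt ℂ c).right_inv hz'] at hz
  exact (dbar_eq_zero_iff hz.1).1 hz.2

/-- The section is ψ_o e_o P - Σ ψ_i e_i H_i. As x₀ lies in one domain only, near x₀ all other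
cutoffs vanish and ψ_o = 1, so in the frame e_o it is simply P - H_o. -/
theorem exists_section [T2Space S] [CompactSpace S] (o : J) {x₀ : S} (hx₀ : x₀ ∈ F.U o)
    (hu : ∀ j, x₀ ∈ F.U j → j = o) :
    ∃ f : S → ℂ, (∀ j, ∀ x ∈ F.U j, x ≠ x₀ → HolAt (fun y => f y / F.e j y) x) ∧
      MeroAt (fun y => f y / F.e o y) x₀ ∧ ¬ ∀ᶠ x in 𝓝[≠] x₀, f x = 0 := by
  have hρ : ∀ j, j ≠ o → F.ρ j x₀ = 0 := fun j hj => by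
    by_contra h
    exact hj (hu j (F.O_subset j (F.tsupport_ρ j (subset_tsupport _ h))))
  have hρo : F.ρ o x₀ = 1 := by
    rw [← F.sum_ρ x₀, Finset.sum_eq_single o (fun j _ => hρ j) (by simp)]
  have hts : x₀ ∈ tsupport (F.ρ o) := subset_tsupport _ (by
    rw [Function.mem_support, hρo]; exact one_ne_zero)
  have hO : x₀ ∈ F.O o := F.tsupport_ρ o hts
  set z₀ := chartAt ℂ (F.c o) x₀ with hz₀
  obtain ⟨p, hp, H, hHd, hH⟩ := F.exists_potentials (o := o) (z₀ := z₀) ⟨x₀, hts, rfl⟩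
  let f : S → ℂ := fun x => F.ψ o x * F.e o x * polar z₀ p (chartAt ℂ (F.c o) x) -
    ∑ i, F.ψ i x * F.e i x * H i (chartAt ℂ (F.c i) x)
  have hf : ∀ j, (fun y => f y / F.e j y) =
      fun y => F.piece o j (polar z₀ p) y - ∑ i, F.piece i j (H i) y := by
    intro j
    ext y
    simp only [f, piece, sub_div, Finset.sum_div]
    congr 1
    · ring
    · exact Finset.sum_congr rfl fun i _ => by ring
  have hxs := F.source hx₀
  have hnear : ∀ᶠ x in 𝓝 x₀, x ∈ F.O o ∧ ∀ j, j ≠ o → x ∉ tsupport (F.ψ j) := by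
    have h1 : ∀ᶠ x in 𝓝 x₀, x ∈ F.O o := (F.isOpen_O o).mem_nhds hO
    refine h1.and (eventually_all.2 fun j => ?_)
    by_cases hj : j = o
    · simp [hj]
    · have : x₀ ∉ tsupport (F.ψ j) := fun h => hj (hu j (F.tsupport_ψ j h))
      filter_upwards [(isClosed_tsupport _).isOpen_compl.mem_nhds this] with x hx _ using hx
  have hfo : ∀ᶠ x in 𝓝 x₀, f x / F.e o x =
      polar z₀ p (chartAt ℂ (F.c o) x) - H o (chartAt ℂ (F.c o) x) := by
    filter_upwards [hnear] with x ⟨hx, hx'⟩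
    have h1 := congr_fun (hf o) x
    have h2 : ∀ G, F.piece o o G x = G (chartAt ℂ (F.c o) x) := fun G => by
      rw [piece, F.ψ_eq_one o x hx, div_self (F.e_ne_zero o x), one_mul, one_mul]
    rw [h1, Finset.sum_eq_single o, h2, h2]
    · intro i _ hi
      rw [piece, image_eq_zero_of_notMem_tsupport (hx' i hi), zero_mul, zero_mul]
    · simp
  refine ⟨f, fun j x hx hne => ?_, ?_, ?_⟩
  · have hxsj := F.source hx
    refine holAt_of_dbarAt hxsj ?_
    filter_upwards [(F.isOpen_U j).mem_nhds hx, isOpen_compl_singleton.mem_nhds hne] with y hy hyne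
    rw [hf j]
    have hP := F.differentiableAt_piece (i := o) (G := polar z₀ p) hy fun hyo =>
      (differentiableAt_polar p fun h => hyne
        ((chartAt ℂ (F.c o)).injOn (F.source hyo) hxs h)).restrictScalars ℝ
    have hQ := fun i => F.differentiableAt_piece (i := i) (G := H i) hy fun _ => hHd i _
    have hQs : DifferentiableAt ℝ (fun z => ∑ i, (F.piece i j (H i) ∘ (chartAt ℂ (F.c j)).symm) z)
        (chartAt ℂ (F.c j) y) := DifferentiableAt.fun_sum fun i _ => (hQ i).1
    have hdef : (fun y => F.piece o j (polar z₀ p) y - ∑ i, F.piece i j (H i) y) ∘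
        (chartAt ℂ (F.c j)).symm = fun z => (F.piece o j (polar z₀ p) ∘ (chartAt ℂ (F.c j)).symm) z -
          ∑ i, (F.piece i j (H i) ∘ (chartAt ℂ (F.c j)).symm) z := rfl
    rw [dbarAt, hdef]
    refine ⟨hP.1.sub hQs, ?_⟩
    rw [dbar_sub hP.1 hQs, dbar_sum _ fun i _ => (hQ i).1]
    change dbarAt (F.c j) (F.piece o j (polar z₀ p)) y -
      ∑ i, dbarAt (F.c j) (F.piece i j (H i)) y = 0
    rw [hP.2]
    have hPz : F.ψ o y * (F.e o y / F.e j y) *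
        (conj (deriv (tr (F.c o) (F.c j)) (chartAt ℂ (F.c j) y)) *
        dbar (polar z₀ p) (chartAt ℂ (F.c o) y)) = 0 := by
      by_cases hyo : y ∈ F.U o
      · rw [dbar_of_differentiableAt (differentiableAt_polar p fun h => hyne
          ((chartAt ℂ (F.c o)).injOn (F.source hyo) hxs h))]
        ring
      · rw [image_eq_zero_of_notMem_tsupport fun h => hyo (F.tsupport_ψ o h)]
        ring
    rw [hPz, add_zero]
    set D : ℂ := dbarAt (F.c j) (F.ψ o) y * (F.e o y / F.e j y) *
      polar z₀ p (chartAt ℂ (F.c o) y) with hD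
    set E : J → ℂ := fun i => dbarAt (F.c j) (F.ψ i) y * (F.e i y / F.e j y) *
      H i (chartAt ℂ (F.c i) y) with hE
    -- `D` and `E` come from ∂̄ falling on the cutoffs; the second summand comes from ∂̄(H i).
    -- Summed over i, with Σ ρ i = 1, the right side is D, which cancels the contribution of the
    -- polar part.
    have hterm : ∀ i, dbarAt (F.c j) (F.piece i j (H i)) y = E i + F.ρ i y * (D - ∑ k, E k) := by
      intro i
      rw [(hQ i).2, hH]
      congr 1
      by_cases hψ : y ∈ tsupport (F.ψ i)
      · have hyi := F.source (F.tsupport_ψ i hψ)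
        simp only [tr_apply hyi, hD, hE, mul_sub, Finset.mul_sum]
        congr 1
        · have := F.ψ_b i j o hy
          linear_combination polar z₀ p (chartAt ℂ (F.c o) y) * this
        · refine Finset.sum_congr rfl fun k _ => ?_
          have := F.ψ_b i j k hy
          linear_combination H k (chartAt ℂ (F.c k) y) * this
      · rw [← F.ψ_mul_ρ i y, image_eq_zero_of_notMem_tsupport hψ]
        ring
    rw [Finset.sum_congr rfl fun i _ => hterm i, Finset.sum_add_distrib, ← Finset.sum_mul, F.sum_ρ]
    ring
  -- Near x₀ every cutoff is locally constant, so all the error coefficients vanish there and ∂̄(H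
  -- o) = 0.
  · have hHhol : AnalyticAt ℂ (H o) z₀ := by
      rw [Complex.analyticAt_iff_eventually_differentiableAt]
      filter_upwards [(tendsto_symm hxs).eventually hnear, eventually_target hxs] with z hz hz'
      rw [← dbar_eq_zero_iff (hHd o z), hH]
      have hs := (chartAt ℂ (F.c o)).map_target hz'
      have hb : ∀ k, F.b o k z = 0 := by
        intro k
        rw [b, if_pos hz', F.dbarAt_ψ_eq_zero _ hs]
        · ring
        · by_cases hk : k = o
          · exact Or.inr (hk ▸ hz.1)
          · exact Or.inl (hz.2 k hk)
      simp [hb]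
    rw [meroAt_iff hxs]
    refine ((meromorphicAt_polar z₀ p).sub hHhol.meromorphicAt).congr ?_
    refine Eventually.filter_mono nhdsWithin_le_nhds ?_
    filter_upwards [(tendsto_symm hxs).eventually hfo, eventually_target hxs] with z hz hz'
    simp only [Function.comp_apply, Pi.sub_apply]
    rw [hz, (chartAt ℂ (F.c o)).right_inv hz']
  · intro h0
    have h1 : ∀ᶠ z in 𝓝[≠] z₀, polar z₀ p z = H o z := by
      filter_upwards [(tendsto_symm_ne hxs).eventually h0,
        mem_nhdsWithin_of_mem_nhds ((tendsto_symm hxs).eventually hfo),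
        mem_nhdsWithin_of_mem_nhds (eventually_target hxs)] with z hz hz1 hz2
      have hz1' : f ((chartAt ℂ (F.c o)).symm z) / F.e o ((chartAt ℂ (F.c o)).symm z) = _ := hz1
      rw [hz, zero_div, (chartAt ℂ (F.c o)).right_inv hz2, eq_comm, sub_eq_zero] at hz1'
      exact hz1'
    have h2 := tendsto_norm_polar (z₀ := z₀) hp
    have h3 : Tendsto (fun z => ‖H o z‖) (𝓝[≠] z₀) (𝓝 ‖H o z₀‖) :=
      ((hHd o).continuous.norm.tendsto z₀).mono_left nhdsWithin_le_nhds
    have h4 := h2.congr' (h1.mono fun z hz => by rw [hz])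
    exact not_tendsto_nhds_of_tendsto_atTop h4 _ h3

end FrameCover

/-! ### Sections of the line bundle and functions with exponential singularities -/

section Algebra

variable {S : Type*} [TopologicalSpace S]

/-- Mutually inverse, support-preserving linear maps induce isomorphisms of the spaces of classes. -/
theorem exists_classes_equiv {E E' : S → Type*} [∀ x, AddCommGroup (E x)] [∀ x, Module ℂ (E x)]
    [∀ x, AddCommGroup (E' x)] [∀ x, Module ℂ (E' x)] {A : Submodule ℂ (Π x, E x)}
    {A' : Submodule ℂ (Π x, E' x)} (T : (Π x, E x) ≃ₗ[ℂ] Π x, E' x)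
    (hT : ∀ f x, T f x = 0 ↔ f x = 0) (hA : ∀ f, T f ∈ A' ↔ f ∈ A) :
    ∃ Φ : Classes A ≃ₗ[ℂ] Classes A',
      (∀ f : A, ∃ h : T f.1 ∈ A', Φ (cls A f) = cls A' ⟨T f.1, h⟩) ∧
      ∀ g : A', ∃ h : T.symm g.1 ∈ A, Φ.symm (cls A' g) = cls A ⟨T.symm g.1, h⟩ := by
  have hA' : A.map (T : (Π x, E x) →ₗ[ℂ] Π x, E' x) = A' := by
    ext g
    rw [Submodule.mem_map]
    constructor
    · rintro ⟨f, hf, rfl⟩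
      exact (hA f).2 hf
    · intro hg
      refine ⟨T.symm g, (hA _).1 ?_, T.apply_symm_apply g⟩
      rwa [T.apply_symm_apply]
  let U : A ≃ₗ[ℂ] A' := (T.submoduleMap A).trans (LinearEquiv.ofEq _ _ hA')
  have hU : ∀ f : A, (U f : Π x, E' x) = T f := fun f => rfl
  have hq : ((nullOff E).submoduleOf A).map (U : A →ₗ[ℂ] A') = (nullOff E').submoduleOf A' := by
    ext g
    rw [Submodule.mem_map]
    have key : ∀ f : A, f ∈ (nullOff E).submoduleOf A ↔ U f ∈ (nullOff E').submoduleOf A' := by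
      intro f
      change (∀ᶠ x in codiscrete S, f.1 x = 0) ↔ ∀ᶠ x in codiscrete S, T f.1 x = 0
      simp only [hT]
    constructor
    · rintro ⟨f, hf, rfl⟩
      exact (key f).1 hf
    · intro hg
      refine ⟨U.symm g, (key _).2 ?_, U.apply_symm_apply g⟩
      rwa [U.apply_symm_apply]
  refine ⟨Submodule.Quotient.equiv _ _ U hq, fun f => ⟨(hA _).2 f.2, rfl⟩, fun g => ?_⟩
  have hg : T.symm g.1 ∈ A := by
    rw [← hA, T.apply_symm_apply]
    exact g.2
  refine ⟨hg, ?_⟩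
  rw [LinearEquiv.symm_apply_eq]
  change cls A' g = cls A' (U ⟨T.symm g.1, hg⟩)
  congr 1
  apply Subtype.ext
  rw [hU]
  exact (T.apply_symm_apply _).symm

theorem nontrivial_classes {E : S → Type*} [∀ x, AddCommGroup (E x)] [∀ x, Module ℂ (E x)]
    {A : Submodule ℂ (Π x, E x)} {f : Π x, E x} (hf : f ∈ A)
    (h : ¬ ∀ᶠ x in codiscrete S, f x = 0) : Nontrivial (Classes A) := by
  refine ⟨cls A ⟨f, hf⟩, 0, fun h0 => h ?_⟩
  exact (Submodule.Quotient.mk_eq_zero _).1 h0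

theorem cls_ne_zero_iff {E : S → Type*} [∀ x, AddCommGroup (E x)] [∀ x, Module ℂ (E x)]
    {A : Submodule ℂ (Π x, E x)} {f : A} :
    cls A f ≠ 0 ↔ ¬ ∀ᶠ x in codiscrete S, f.1 x = 0 :=
  not_congr (Submodule.Quotient.mk_eq_zero _)

end Algebra

namespace ExpCurve

variable {S : Type*} [TopologicalSpace S] [ChartedSpace ℂ S]

/-- As exp has no zeros, the factor g is forced to be f e^{-h} near p. This removes the existential
quantifier. -/
theorem hasExpType_iff {h f : S → ℂ} {p : S} :
    HasExpType h f p ↔ MeroAt (fun x => f x * Complex.exp (-h x)) p := by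
  constructor
  · rintro ⟨g, hg, hfg⟩
    refine hg.congr ?_
    filter_upwards [hfg] with x hx
    rw [hx, mul_assoc, ← Complex.exp_add]
    simp
  · intro hf
    refine ⟨_, hf, Eventually.of_forall fun x => ?_⟩
    rw [mul_assoc, ← Complex.exp_add]
    simp

theorem formHasExpType_iff [IsManifold 𝓘(ℂ) ω S] {h : S → ℂ} {w : SForm S} {p : S} :
    FormHasExpType h w p ↔ HasExpType h (coeff w p) p := by
  constructor
  · rintro ⟨b, hb, hwb⟩
    refine ⟨coeff b p, hb, ?_⟩
    filter_upwards [hwb] with x hx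
    simp [coeff, hx, mul_comm]
  · intro hf
    rw [hasExpType_iff] at hf
    refine ⟨fun x => Complex.exp (-h x) • w x, ?_, Eventually.of_forall fun x => ?_⟩
    · refine hf.congr (Eventually.of_forall fun x => ?_)
      simp [coeff, mul_comm]
    · rw [smul_smul, ← Complex.exp_add]
      simp

end ExpCurve

/-! ### The local dictionary between sections and functions -/

namespace Cover

variable {S : Type*} [TopologicalSpace S] [ChartedSpace ℂ S] {X : ExpCurve S} (C : Cover X)

theorem sHdual_smul_sH (x : S) (v : C.L x) : C.sHdual x v • C.sH x = v := by
  -- The fibre over x is a copy of ℂ, on which the trivialization of index `C.index x` acts as the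
  -- identity.
  have hself : ∀ v : C.L x, ((C.core.localTriv (C.index x) ⟨x, v⟩).2 : ℂ) = v := fun v =>
    C.core.coordChange_self (C.index x) x (C.mem_base_index x) v
  have h2 : (C.sH x : ℂ) ≠ 0 := fun h => by
    have h1 := C.sHdual_sH x
    rw [show C.sH x = 0 from h, map_zero] at h1
    exact zero_ne_one h1
  refine (congrArg (· • C.sH x) (congrArg₂ (fun a b : ℂ => a / b) (hself v)
    (hself (C.sH x)))).trans ?_
  exact div_mul_cancel₀ (G₀ := ℂ) v h2

theorem tensorDual_mulSection (f : S → ℂ) : C.tensorDual (C.mulSection f) = f := by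
  ext x
  simp [tensorDual, mulSection, C.sHdual_sH]

theorem mulSection_tensorDual (s : Π x, C.L x) : C.mulSection (C.tensorDual s) = s := by
  ext x
  exact C.sHdual_smul_sH x (s x)

/-- Multiplication by `sHdual`, as a linear isomorphism. -/
def tensorDualEquiv : (Π x, C.L x) ≃ₗ[ℂ] S → ℂ where
  toFun := C.tensorDual
  invFun := C.mulSection
  left_inv := C.mulSection_tensorDual
  right_inv := C.tensorDual_mulSection
  map_add' s t := by
    ext x
    simp [tensorDual]
  map_smul' c s := by
    ext x
    simp [tensorDual]

theorem index_eq_some {p : X.P} : C.index p = some p := by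
  rcases h : C.index p with _ | q
  · have := C.mem_base_index p
    rw [h] at this
    exact absurd this (C.notMem_V p)
  · have := C.mem_base_index p
    rw [h] at this
    rw [C.eq_of_mem this (C.mem_B p)]

theorem localRep_mulSection (f : S → ℂ) (p : S) :
    ∀ᶠ x in 𝓝 p, localRep (C.mulSection f) p x =
      f x * (C.core.localTriv (C.index p) ⟨x, C.sH x⟩).2 := by
  have hb : C.base (C.index p) ∈ 𝓝 p :=
    (C.core.isOpen_baseSet (C.index p)).mem_nhds (C.mem_base_index p)
  filter_upwards [hb] with x hx
  exact ((C.core.localTriv (C.index p)).linear ℂ hx).map_smul (f x) (C.sH x)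

variable [IsManifold 𝓘(ℂ) ω S]

/-- A puncture lies in no other member of the cover than its own B p, so the trivialization there is
the one in which `sH` is exp(-h). At other points `sH` reads 1 or exp(-h q) with h q holomorphic,
hence a unit that affects neither meromorphy nor order. -/
theorem localRep_mulSection_cases (f : S → ℂ) (p : S) :
    (∃ hp : p ∈ X.P, ∀ᶠ x in 𝓝 p,
      localRep (C.mulSection f) p x = f x * Complex.exp (-X.h ⟨p, hp⟩ x)) ∨
    (p ∉ X.P ∧ ∃ u : S → ℂ, HolAt u p ∧ u p ≠ 0 ∧ ∀ᶠ x in 𝓝 p,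
      localRep (C.mulSection f) p x = f x * u x) := by
  have hl := C.localRep_mulSection f p
  have hb : C.base (C.index p) ∈ 𝓝 p :=
    (C.core.isOpen_baseSet (C.index p)).mem_nhds (C.mem_base_index p)
  by_cases hp : p ∈ X.P
  · left
    refine ⟨hp, ?_⟩
    rw [C.index_eq_some (p := ⟨p, hp⟩)] at hl hb
    filter_upwards [hl, hb] with x hx hxb
    rw [hx, C.localTriv_sH_B hxb]
  · right
    refine ⟨hp, ?_⟩
    have hm := C.mem_base_index p
    rcases h : C.index p with _ | q
    · rw [h] at hl hb
      refine ⟨fun _ => 1, contMDiffAt_const, one_ne_zero, ?_⟩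
      filter_upwards [hl, hb] with x hx hxb
      rw [hx, C.localTriv_sH_V hxb]
    · rw [h] at hl hb hm
      refine ⟨fun x => Complex.exp (-X.h q x), (C.hol q p hm ?_).neg.cexp,
        Complex.exp_ne_zero _, ?_⟩
      · rintro rfl
        exact hp q.2
      · filter_upwards [hl, hb] with x hx hxb
        rw [hx, C.localTriv_sH_B hxb]

/-- The behaviour at `p` that membership in `M` prescribes. -/
def MemAt (X : ExpCurve S) (f : S → ℂ) (p : S) : Prop :=
  (p ∉ X.P → MeroAt f p) ∧ ∀ hp : p ∈ X.P, ExpCurve.HasExpType (X.h ⟨p, hp⟩) f p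

theorem meroAt_localRep_mulSection (f : S → ℂ) (p : S) :
    MeroAt (localRep (C.mulSection f) p) p ↔ MemAt X f p := by
  rcases C.localRep_mulSection_cases f p with ⟨hp, h⟩ | ⟨hp, u, hu, hu0, h⟩
  · rw [MeroAt.congr_iff (h.filter_mono nhdsWithin_le_nhds), ← ExpCurve.hasExpType_iff]
    simp [MemAt, hp]
  · rw [MeroAt.congr_iff (h.filter_mono nhdsWithin_le_nhds), meroAt_mul_iff hu hu0]
    simp [MemAt, hp]

theorem secOrd_mulSection (f : S → ℂ) (p : S) : secOrd (C.mulSection f) p = X.div f p := by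
  rw [secOrd, ExpCurve.div]
  rcases C.localRep_mulSection_cases f p with ⟨hp, h⟩ | ⟨hp, u, hu, hu0, h⟩
  · rw [ord_congr (h.filter_mono nhdsWithin_le_nhds), dif_pos hp]
  · rw [ord_congr (h.filter_mono nhdsWithin_le_nhds), ord_mul_of_holAt hu hu0, dif_neg hp]

theorem mem_M_iff {f : S → ℂ} : f ∈ X.M ↔ ∀ p, MemAt X f p :=
  ⟨fun h p => ⟨h.1 p, fun hp => h.2 ⟨p, hp⟩⟩, fun h => ⟨fun p => (h p).1, fun p => (h p).2 p.2⟩⟩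

theorem mulSection_mem_iff {f : S → ℂ} : C.mulSection f ∈ meroSections C.L ↔ f ∈ X.M := by
  rw [mem_M_iff]
  exact forall_congr' fun p => C.meroAt_localRep_mulSection f p

theorem tensorDual_mem_iff {s : Π x, C.L x} : C.tensorDual s ∈ X.M ↔ s ∈ meroSections C.L := by
  rw [← mulSection_mem_iff, C.mulSection_tensorDual]

theorem mem_Om_iff {w : SForm S} : w ∈ X.Om ↔ ∀ p, MemAt X (coeff w p) p := by
  constructor
  · exact fun h p => ⟨h.1 p, fun hp => ExpCurve.formHasExpType_iff.1 (h.2 ⟨p, hp⟩)⟩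
  · exact fun h => ⟨fun p => (h p).1, fun p => ExpCurve.formHasExpType_iff.2 ((h p).2 p.2)⟩

/-- Evaluating w · `sH` on ∂/∂z gives, by definition, the section (coefficient of w) · `sH`, so the
case of functions applies with f depending on p. -/
theorem formMulSection_mem_iff {w : SForm S} :
    C.formMulSection w ∈ meroForms C.L ↔ w ∈ X.Om := by
  rw [mem_Om_iff]
  exact forall_congr' fun p => C.meroAt_localRep_mulSection (coeff w p) p

theorem formSecOrd_formMulSection (w : SForm S) (p : S) :
    formSecOrd (C.formMulSection w) p = X.formDiv w p :=
  C.secOrd_mulSection (coeff w p) p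

theorem formTensorDual_formMulSection (w : SForm S) :
    C.formTensorDual (C.formMulSection w) = w := by
  refine funext fun x => LinearMap.ext fun v => ?_
  change C.sHdual x (w x v • C.sH x) = w x v
  rw [map_smul, C.sHdual_sH, smul_eq_mul, mul_one]

theorem formMulSection_formTensorDual (a : Form C.L) :
    C.formMulSection (C.formTensorDual a) = a := by
  refine funext fun x => LinearMap.ext fun v => ?_
  exact C.sHdual_smul_sH x (a x v)

theorem formTensorDual_mem_iff {a : Form C.L} :
    C.formTensorDual a ∈ X.Om ↔ a ∈ meroForms C.L := by
  rw [← formMulSection_mem_iff, C.formMulSection_formTensorDual]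

/-- Multiplication of forms by `sHdual`, as a linear isomorphism. -/
def formTensorDualEquiv : Form C.L ≃ₗ[ℂ] SForm S where
  toFun := C.formTensorDual
  invFun := C.formMulSection
  left_inv := C.formMulSection_formTensorDual
  right_inv := C.formTensorDual_formMulSection
  map_add' a b := by
    refine funext fun x => LinearMap.ext fun v => ?_
    exact map_add (C.sHdual x) (a x v) (b x v)
  map_smul' c a := by
    refine funext fun x => LinearMap.ext fun v => ?_
    exact map_smul (C.sHdual x) c (a x v)

theorem tensorDual_eq_zero_iff (s : Π x, C.L x) (x : S) : C.tensorDual s x = 0 ↔ s x = 0 := by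
  constructor
  · intro h
    rw [← C.mulSection_tensorDual s, mulSection, h, zero_smul]
  · intro h
    simp [tensorDual, h]

theorem formTensorDual_eq_zero_iff (a : Form C.L) (x : S) :
    C.formTensorDual a x = 0 ↔ a x = 0 := by
  constructor
  · intro h
    rw [← C.formMulSection_formTensorDual a, formMulSection, h]
    refine LinearMap.ext fun v => ?_
    exact zero_smul ℂ _
  · intro h
    refine LinearMap.ext fun v => ?_
    change C.sHdual x (a x v) = 0
    rw [h, LinearMap.zero_apply, map_zero]

theorem exists_section_equiv :
    ∃ Φ : Classes (meroSections C.L) ≃ₗ[ℂ] Classes X.M,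
        (∀ s : meroSections C.L, ∃ hs : C.tensorDual s.1 ∈ X.M,
          Φ (cls _ s) = cls _ ⟨C.tensorDual s.1, hs⟩) ∧
        (∀ f : X.M, ∃ hf : C.mulSection f.1 ∈ meroSections C.L,
          Φ.symm (cls _ f) = cls _ ⟨C.mulSection f.1, hf⟩) ∧
        (∀ s : meroSections C.L, ∀ p, X.div (C.tensorDual s.1) p = secOrd s.1 p) ∧
        (∀ f : X.M, ∀ p, secOrd (C.mulSection f.1) p = X.div f.1 p) := by
  obtain ⟨Φ, h1, h2⟩ := exists_classes_equiv (A := meroSections C.L) (A' := X.M)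
    C.tensorDualEquiv C.tensorDual_eq_zero_iff fun s => C.tensorDual_mem_iff
  refine ⟨Φ, h1, h2, fun s p => ?_, fun f p => C.secOrd_mulSection f.1 p⟩
  rw [← secOrd_mulSection, C.mulSection_tensorDual]

theorem exists_form_equiv :
    ∃ Ψ : Classes (meroForms C.L) ≃ₗ[ℂ] Classes X.Om,
        (∀ a : meroForms C.L, ∃ ha : C.formTensorDual a.1 ∈ X.Om,
          Ψ (cls _ a) = cls _ ⟨C.formTensorDual a.1, ha⟩) ∧
        (∀ w : X.Om, ∃ hw : C.formMulSection w.1 ∈ meroForms C.L,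
          Ψ.symm (cls _ w) = cls _ ⟨C.formMulSection w.1, hw⟩) ∧
        (∀ a : meroForms C.L, ∀ p,
          X.formDiv (C.formTensorDual a.1) p = formSecOrd a.1 p) ∧
        (∀ w : X.Om, ∀ p, formSecOrd (C.formMulSection w.1) p = X.formDiv w.1 p) := by
  obtain ⟨Ψ, h1, h2⟩ := exists_classes_equiv (A := meroForms C.L) (A' := X.Om)
    C.formTensorDualEquiv C.formTensorDual_eq_zero_iff fun s => C.formTensorDual_mem_iff
  refine ⟨Ψ, h1, h2, fun a p => ?_, fun w p => C.formSecOrd_formMulSection w.1 p⟩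
  rw [← formSecOrd_formMulSection, C.formMulSection_formTensorDual]

end Cover

/-! ### Existence -/

theorem HolAt.inv {S : Type*} [TopologicalSpace S] [ChartedSpace ℂ S] [IsManifold 𝓘(ℂ) ω S]
    {f : S → ℂ} {p : S} (hf : HolAt f p) (h0 : f p ≠ 0) :
    HolAt (fun x => (f x)⁻¹) p := by
  have h1 : AnalyticAt ℂ (fun z => (f ∘ (chartAt ℂ p).symm) z) (chartAt ℂ p p) := hf.analyticAt
  refine (holAt_iff (mem_chart_source ℂ p)).2 (h1.inv ?_)
  rwa [Function.comp_apply, (chartAt ℂ p).left_inv (mem_chart_source ℂ p)]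

namespace ExpCurve

variable {S : Type*} [TopologicalSpace S] [ChartedSpace ℂ S] [IsManifold 𝓘(ℂ) ω S] (X : ExpCurve S)

/-- V can be all of S'; the B p are separated neighbourhoods, shrunk to where h p is holomorphic off
p. -/
theorem nonempty_cover [T2Space S] : Nonempty (Cover X) := by
  obtain ⟨W, hW, hd⟩ := X.P.finite_toSet.t2_separation
  have h : ∀ p : X.P, ∃ N : Set S, IsOpen N ∧ (p : S) ∈ N ∧ ∀ x ∈ N, x ≠ p → HolAt (X.h p) x := by
    intro p
    have := (X.mero p).eventually_holAt
    rw [eventually_nhdsWithin_iff] at this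
    obtain ⟨N, hN, hNo, hpN⟩ := eventually_nhds_iff.1 this
    exact ⟨N, hNo, hpN, hN⟩
  choose N hNo hpN hN using h
  refine ⟨{
    B := fun p => W p ∩ N p
    V := (X.P : Set S)ᶜ
    isOpen_B := fun p => (hW p).2.inter (hNo p)
    isOpen_V := X.P.finite_toSet.isClosed.isOpen_compl
    mem_B := fun p => ⟨(hW p).1, hpN p⟩
    disj := fun p q hpq => (hd p.2 q.2 fun h => hpq (Subtype.ext h)).mono inter_subset_left
      inter_subset_left
    notMem_V := fun p h => h p.2
    cover := fun x => ?_
    hol := fun p x hx hne => hN p x hx.2 hne }⟩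
  by_cases hx : x ∈ X.P
  · exact Or.inr ⟨⟨x, hx⟩, (hW x).1, hpN ⟨x, hx⟩⟩
  · exact Or.inl hx

/-- A frame near `x` of the line bundle attached to `X`. -/
def frame (x : S) : S → ℂ :=
  open Classical in
  if hx : x ∈ X.P then fun y => Complex.exp (X.h ⟨x, hx⟩ y) else fun _ => 1

theorem frame_ne_zero (x y : S) : X.frame x y ≠ 0 := by
  unfold frame
  split_ifs
  · exact Complex.exp_ne_zero _
  · exact one_ne_zero

theorem frame_of_mem (p : X.P) : X.frame p = fun y => Complex.exp (X.h p y) := by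
  rw [frame, dif_pos p.2]

theorem frame_of_notMem {x : S} (hx : x ∉ X.P) : X.frame x = fun _ => 1 := by
  rw [frame, dif_neg hx]

open Classical in
/-- A neighbourhood of `x` on which the frame at `x` can be used. -/
def frameDomain {X : ExpCurve S} (C : Cover X) (x : S) : Set S :=
  (chartAt ℂ x).source ∩ if hx : x ∈ X.P then C.B ⟨x, hx⟩ else (X.P : Set S)ᶜ

section

variable {X} (C : Cover X)

theorem isOpen_frameDomain [T1Space S] (x : S) : IsOpen (frameDomain C x) := by
  refine (chartAt ℂ x).open_source.inter ?_
  split_ifs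
  · exact C.isOpen_B _
  · exact X.P.finite_toSet.isClosed.isOpen_compl

theorem mem_frameDomain (x : S) : x ∈ frameDomain C x := by
  refine ⟨mem_chart_source ℂ x, ?_⟩
  split_ifs with h
  · exact C.mem_B ⟨x, h⟩
  · exact h

theorem frameDomain_of_mem {p : X.P} {y : S} (hy : y ∈ frameDomain C p) : y ∈ C.B p := by
  have := hy.2
  rwa [dif_pos p.2] at this

theorem frameDomain_of_notMem {x y : S} (hx : x ∉ X.P) (hy : y ∈ frameDomain C x) : y ∉ X.P := by
  have := hy.2
  rwa [dif_neg hx] at this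

/-- Each puncture lies in one frame domain only. Hence quotients of frames are trivial at punctures,
and the uniqueness hypothesis of `exists_section` holds. -/
theorem eq_of_mem_frameDomain {x : S} {p : X.P} (hp : (p : S) ∈ frameDomain C x) : x = p := by
  by_cases hx : x ∈ X.P
  · have h1 : (p : S) ∈ C.B ⟨x, hx⟩ := frameDomain_of_mem C (p := ⟨x, hx⟩) hp
    exact congrArg Subtype.val (C.eq_of_mem h1 (C.mem_B p))
  · exact absurd p.2 (frameDomain_of_notMem C hx hp)

theorem holAt_frame {x y : S} (hy : y ∈ frameDomain C x) (hyP : y ∉ X.P) :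
    HolAt (X.frame x) y := by
  by_cases hx : x ∈ X.P
  · rw [X.frame_of_mem ⟨x, hx⟩]
    refine (C.hol ⟨x, hx⟩ y (frameDomain_of_mem C (p := ⟨x, hx⟩) hy) ?_).cexp
    rintro rfl
    exact hyP hx
  · rw [X.frame_of_notMem hx]
    exact contMDiffAt_const

theorem holAt_frame_div {x x' y : S} (hy : y ∈ frameDomain C x) (hy' : y ∈ frameDomain C x') :
    HolAt (fun z => X.frame x z / X.frame x' z) y := by
  by_cases hyP : y ∈ X.P
  · have h1 : x = y := eq_of_mem_frameDomain C (p := ⟨y, hyP⟩) hy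
    have h2 : x' = y := eq_of_mem_frameDomain C (p := ⟨y, hyP⟩) hy'
    rw [h1, h2]
    simp only [div_self (X.frame_ne_zero _ _)]
    exact contMDiffAt_const
  · simp only [div_eq_mul_inv]
    exact (holAt_frame C hy hyP).mul ((holAt_frame C hy' hyP).inv (X.frame_ne_zero _ _))

end

theorem exists_bump [T2Space S] {x : S} {N : Set S} (hN : N ∈ 𝓝 x) :
    ∃ ψ : S → ℂ, ContMDiff 𝓘(ℝ, ℂ) 𝓘(ℝ, ℂ) ∞ ψ ∧ tsupport ψ ⊆ N ∧ ∀ᶠ y in 𝓝 x, ψ y = 1 := by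
  obtain ⟨f, hf⟩ : ∃ f : SmoothBumpFunction 𝓘(ℝ, ℂ) x, tsupport f ⊆ N := by
    obtain ⟨f, -, h⟩ := (SmoothBumpFunction.nhds_basis_tsupport (I := 𝓘(ℝ, ℂ)) x).mem_iff.1 hN
    exact ⟨f, h⟩
  refine ⟨fun y => (f y : ℂ), ?_, ?_, ?_⟩
  · exact Complex.ofRealCLM.contDiff.contMDiff.comp f.contMDiff
  · refine (closure_mono ?_).trans hf
    intro y hy
    simpa using hy
  · filter_upwards [f.eventuallyEq_one] with y hy
    simp [hy]

theorem exists_smooth_partition [T2Space S] [CompactSpace S] {J : Type*} [Fintype J] {O : J → Set S}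
    (hO : ∀ j, IsOpen (O j)) (hc : ∀ x, ∃ j, x ∈ O j) :
    ∃ ρ : J → S → ℂ, (∀ j, ContMDiff 𝓘(ℝ, ℂ) 𝓘(ℝ, ℂ) ∞ (ρ j)) ∧ (∀ j, tsupport (ρ j) ⊆ O j) ∧
      ∀ x, ∑ j, ρ j x = 1 := by
  obtain ⟨f, hf⟩ := SmoothPartitionOfUnity.exists_isSubordinate 𝓘(ℝ, ℂ) (isClosed_univ (X := S))
    O hO (fun x _ => mem_iUnion.2 (hc x))
  refine ⟨fun j y => (f j y : ℂ), fun j => ?_, fun j => ?_, fun x => ?_⟩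
  · exact Complex.ofRealCLM.contDiff.contMDiff.comp (f j).contMDiff
  · refine (closure_mono ?_).trans (hf j)
    intro y hy
    simpa using hy
  · have := f.sum_eq_one (mem_univ x)
    rw [finsum_eq_sum_of_fintype] at this
    change ∑ j, ((f j x : ℝ) : ℂ) = 1
    exact_mod_cast this

/-- There is a function in `O(S*)` that does not vanish near some puncture. -/
theorem exists_mem_O [T2Space S] [CompactSpace S] :
    ∃ f ∈ X.O, ∃ p : X.P, ¬ ∀ᶠ x in 𝓝[≠] (p : S), f x = 0 := by
  obtain ⟨C⟩ := X.nonempty_cover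
  have hb := fun x => exists_bump (x := x) ((isOpen_frameDomain C x).mem_nhds (mem_frameDomain C x))
  choose ψ hψs hψt hψ1 using hb
  let O : S → Set S := fun x => interior {y | ψ x y = 1}
  have hxO : ∀ x, x ∈ O x := fun x => mem_interior_iff_mem_nhds.2 (hψ1 x)
  obtain ⟨t, ht⟩ := isCompact_univ.elim_finite_subcover O (fun x => isOpen_interior)
    fun x _ => mem_iUnion.2 ⟨x, hxO x⟩
  have hc : ∀ x, ∃ j : t, x ∈ O j := fun x => by
    obtain ⟨j, hj, hx⟩ := mem_iUnion₂.1 (ht (mem_univ x))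
    exact ⟨⟨j, hj⟩, hx⟩
  obtain ⟨ρ, hρs, hρt, hρ⟩ := exists_smooth_partition (O := fun j : t => O j)
    (fun j => isOpen_interior) hc
  let F : FrameCover S t :=
    { c := fun j => j
      U := fun j => frameDomain C j
      O := fun j => O j
      isOpen_U := fun j => isOpen_frameDomain C j
      isOpen_O := fun j => isOpen_interior
      U_subset := fun j => inter_subset_left
      ψ := fun j => ψ j
      ρ := ρ
      smooth_ψ := fun j => hψs j
      smooth_ρ := hρs
      tsupport_ψ := fun j => hψt j
      tsupport_ρ := hρt
      ψ_eq_one := fun j x hx => interior_subset (s := {y | ψ j y = 1}) hx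
      sum_ρ := hρ
      e := fun j => X.frame j
      e_ne_zero := fun j x => X.frame_ne_zero j x
      hol_e := fun i j x hx => holAt_frame_div C hx.1 hx.2 }
  -- The finite subcover must retain every puncture, since no other domain contains it.
  have hmem : ∀ p : X.P, (p : S) ∈ t := fun p => by
    obtain ⟨j, hj⟩ := hc p
    rw [← eq_of_mem_frameDomain C (F.O_subset j hj)]
    exact j.2
  obtain ⟨p₀, hp₀⟩ := X.nonempty
  obtain ⟨f, hf, hf0, hfn⟩ := F.exists_section ⟨p₀, hmem ⟨p₀, hp₀⟩⟩ (x₀ := p₀)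
    (mem_frameDomain C p₀) fun j hj => Subtype.ext (eq_of_mem_frameDomain C (p := ⟨p₀, hp₀⟩) hj)
  have hhol : ∀ x ∉ X.P, HolAt f x := by
    intro x hx
    obtain ⟨j, hj⟩ := hc x
    have hU := F.O_subset j hj
    have h1 := (hf j x hU fun h => hx (h ▸ hp₀)).mul (holAt_frame C hU hx)
    refine h1.congr (Eventually.of_forall fun y => ?_)
    exact div_mul_cancel₀ _ (X.frame_ne_zero _ _)
  refine ⟨f, ⟨⟨fun p hp => (hhol p hp).meroAt, fun p => ?_⟩, hhol⟩, ⟨p₀, hp₀⟩, hfn⟩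
  refine ⟨fun y => f y / X.frame p y, ?_, Eventually.of_forall fun y => ?_⟩
  · by_cases hp : (p : S) = p₀
    · rw [hp]
      exact hf0
    · exact (hf ⟨p, hmem p⟩ p (mem_frameDomain C p) hp).meroAt
  · rw [X.frame_of_mem p, div_mul_cancel₀ _ (Complex.exp_ne_zero _)]

end ExpCurve

/-! ### Exact forms -/

/-- `g' + g h'` does not vanish identically if `h` has a pole and `g ≠ 0`. -/
theorem not_eventually_deriv_add_mul_deriv_eq_zero {g h : ℂ → ℂ} {z : ℂ} (hg : MeromorphicAt g z)
    (hpole : meromorphicOrderAt h z < 0)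
    (hg0 : meromorphicOrderAt g z ≠ ⊤) :
    ¬ ∀ᶠ w in 𝓝[≠] z, deriv g w + g w * deriv h w = 0 := by
  intro h0
  obtain ⟨n, hn⟩ := WithTop.ne_top_iff_exists.1 hg0
  obtain ⟨m, hm⟩ := WithTop.ne_top_iff_exists.1 (ne_top_of_lt hpole)
  rw [← hm] at hpole
  have hm0 : m < 0 := by exact_mod_cast hpole
  have h1 : meromorphicOrderAt (deriv h) z = ((m - 1 : ℤ) : WithTop ℤ) :=
    meromorphicOrderAt_deriv_eq_sub_one (by exact_mod_cast hm0.ne) hm.symm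
  -- The equation says g'/g = -h', of order m - 1 ≤ -2. But g'/g has order -1 if g has a zero or
  -- pole, and order at least 0 otherwise.
  have h2 : meromorphicOrderAt (logDeriv g) z = ((m - 1 : ℤ) : WithTop ℤ) := by
    rw [← h1, meromorphicOrderAt_neg (f := deriv h)]
    refine meromorphicOrderAt_congr ?_
    filter_upwards [h0, (meromorphicOrderAt_ne_top_iff_eventually_ne_zero hg).1 hg0] with w hw hw'
    rw [Pi.neg_apply, logDeriv_apply]
    field_simp
    linear_combination hw
  rcases eq_or_ne n 0 with rfl | hn0
  · have h3 := meromorphicOrderAt_logDeriv_nonneg hg hn.symm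
    rw [h2] at h3
    have : (0 : ℤ) ≤ m - 1 := by exact_mod_cast h3
    omega
  · have h3 := meromorphicOrderAt_logDeriv_eq_neg_one hg (by
      rw [← hn]; exact_mod_cast hn0) (by rw [← hn]; exact WithTop.coe_ne_top)
    rw [h2] at h3
    have : m - 1 = -1 := WithTop.coe_injective h3
    omega

variable {S : Type*} [TopologicalSpace S] [ChartedSpace ℂ S] [IsManifold 𝓘(ℂ) ω S]

/-- The coordinate vector field, read in the preferred chart at the point. -/
def coordVal (p x : S) : ℂ := coordVec p x

/-- The tangent space at x is identified with ℂ by the preferred chart at x, not by the one at p, so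
the field ∂/∂z of the latter becomes the derivative of a chart change. -/
theorem coordVal_eq {p x : S} (hx : x ∈ (chartAt ℂ p).source) :
    coordVal p x = deriv (tr x p) (chartAt ℂ p x) := by
  have h1 : coordVal p x = (tangentBundleCore 𝓘(ℂ) S).coordChange (achart ℂ p) (achart ℂ x) x
      (1 : ℂ) :=
    (tangentBundleCore 𝓘(ℂ) S).localTriv_symm_apply _ hx _
  rw [h1, tangentBundleCore_coordChange]
  simp only [mfld_simps]
  rw [fderivWithin_univ]
  exact fderiv_apply_one_eq_deriv

/-- The differential of a function. -/
def differential (f : S → ℂ) : SForm S := fun x =>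
  (deriv (f ∘ (chartAt ℂ x).symm) (chartAt ℂ x x) • (LinearMap.id : ℂ →ₗ[ℂ] ℂ) : ℂ →ₗ[ℂ] ℂ)

theorem coeff_differential {f : S → ℂ} {p x : S} (hx : x ∈ (chartAt ℂ p).source)
    (hf : HolAt f x) :
    coeff (differential f) p x = deriv (f ∘ (chartAt ℂ p).symm) (chartAt ℂ p x) := by
  have hxx := mem_chart_source ℂ x
  have h1 : coeff (differential f) p x =
      deriv (f ∘ (chartAt ℂ x).symm) (chartAt ℂ x x) * coordVal p x := rfl
  have h2 : HasDerivAt (f ∘ (chartAt ℂ x).symm) (deriv (f ∘ (chartAt ℂ x).symm) (chartAt ℂ x x))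
      (tr x p (chartAt ℂ p x)) := by
    rw [tr_apply hx]
    exact hf.analyticAt.differentiableAt.hasDerivAt
  have h3 := h2.comp _ (analyticAt_tr hx hxx).differentiableAt.hasDerivAt
  rw [h1, coordVal_eq hx]
  exact ((h3.congr_of_eventuallyEq (comp_symm_eventuallyEq f hx hxx)).deriv).symm

theorem coeff_differential_comp_symm {f : S → ℂ} {p : S} (hf : HolAt f p) :
    ∀ᶠ z in 𝓝 (chartAt ℂ p p), (coeff (differential f) p ∘ (chartAt ℂ p).symm) z =
      deriv (f ∘ (chartAt ℂ p).symm) z := by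
  have hp := mem_chart_source ℂ p
  filter_upwards [(tendsto_symm hp).eventually hf.eventually, eventually_target hp] with z hz hz'
  rw [Function.comp_apply, coeff_differential ((chartAt ℂ p).map_target hz') hz,
    (chartAt ℂ p).right_inv hz']

theorem formHolAt_differential {f : S → ℂ} {p : S} (hf : HolAt f p) :
    FormHolAt (differential f) p := by
  rw [FormHolAt, holAt_iff (mem_chart_source ℂ p)]
  exact hf.analyticAt.deriv.congr ((coeff_differential_comp_symm hf).mono fun z hz => hz.symm)

theorem residueZeroAt_of_formHolAt {w : SForm S} {p : S} (hw : FormHolAt w p) :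
    ResidueZeroAt w p := by
  have h := (HolAt.analyticAt hw).eventually_analyticAt
  obtain ⟨ε, hε, h⟩ := Metric.eventually_nhds_iff.1 h
  filter_upwards [Ioo_mem_nhdsGT hε] with r hr
  refine Complex.circleIntegral_eq_zero_of_differentiable_on_off_countable hr.1.le
    countable_empty ?_ ?_
  · intro z hz
    exact (h (lt_of_le_of_lt hz hr.2)).continuousAt.continuousWithinAt
  · intro z hz
    exact (h (lt_trans hz.1 hr.2)).differentiableAt

/-! ### Differentials of functions with exponential singularities -/

namespace ExpCurve

variable (X : ExpCurve S)

theorem eventually_notMem_P [T1Space S] (p : S) : ∀ᶠ x in 𝓝[≠] p, x ∉ X.P := by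
  have h1 : ((X.P : Set S) \ {p})ᶜ ∈ 𝓝 p :=
    (X.P.finite_toSet.subset sdiff_subset).isClosed.isOpen_compl.mem_nhds fun h => h.2 rfl
  filter_upwards [mem_nhdsWithin_of_mem_nhds h1, self_mem_nhdsWithin] with x hx hne hxP
  exact hx ⟨hxP, hne⟩

/-- The product rule for g e^h. It exhibits the meromorphic factor g' + g h', so that df has the
same exponential type as f. -/
theorem coeff_differential_puncture [T1Space S] {f : S → ℂ} (hf : f ∈ X.O) (p : X.P) {g : S → ℂ}
    (hfg : ∀ᶠ x in 𝓝[≠] (p : S), f x = g x * Complex.exp (X.h p x)) (hg : MeroAt g p) :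
    ∀ᶠ z in 𝓝[≠] (chartAt ℂ (p : S) p), (coeff (differential f) p ∘ (chartAt ℂ (p : S)).symm) z =
      (deriv (g ∘ (chartAt ℂ (p : S)).symm) z + (g ∘ (chartAt ℂ (p : S)).symm) z *
        deriv (X.h p ∘ (chartAt ℂ (p : S)).symm) z) *
          Complex.exp ((X.h p ∘ (chartAt ℂ (p : S)).symm) z) := by
  have hp := mem_chart_source ℂ (p : S)
  have h1 := (tendsto_symm_ne hp).eventually hfg
  filter_upwards [eventually_eventually_nhdsWithin.2 h1, self_mem_nhdsWithin,
    (tendsto_symm_ne hp).eventually (X.eventually_notMem_P p),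
    mem_nhdsWithin_of_mem_nhds (eventually_target hp),
    MeromorphicAt.eventually_analyticAt hg, MeromorphicAt.eventually_analyticAt (X.mero p)]
    with z hz hne hzP hzt hgz hhz
  rw [nhdsWithin_eq_nhds.2 (isOpen_compl_singleton.mem_nhds hne)] at hz
  rw [Function.comp_apply, coeff_differential ((chartAt ℂ (p : S)).map_target hzt) (hf.2 _ hzP),
    (chartAt ℂ (p : S)).right_inv hzt]
  have h2 := (hgz.differentiableAt.hasDerivAt).mul hhz.differentiableAt.hasDerivAt.cexp
  have h3 := (h2.congr_of_eventuallyEq (f₁ := f ∘ (chartAt ℂ (p : S)).symm) hz).deriv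
  rw [h3]
  ring

theorem differential_mem_Om0 [T1Space S] {f : S → ℂ} (hf : f ∈ X.O) :
    differential f ∈ X.Om0 := by
  have hhol : ∀ p ∉ X.P, FormHolAt (differential f) p := fun p hp =>
    formHolAt_differential (hf.2 p hp)
  refine ⟨⟨fun p hp => (hhol p hp).meroAt, fun p => ?_⟩, hhol⟩
  obtain ⟨g, hg, hfg⟩ := hf.1.2 p
  have hp := mem_chart_source ℂ (p : S)
  have h := X.coeff_differential_puncture hf p hfg hg
  rw [formHasExpType_iff]
  have hg' : MeromorphicAt (g ∘ (chartAt ℂ (p : S)).symm) (chartAt ℂ (p : S) p) := hg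
  have hh' : MeromorphicAt (X.h p ∘ (chartAt ℂ (p : S)).symm) (chartAt ℂ (p : S) p) := X.mero p
  refine ⟨(fun z => deriv (g ∘ (chartAt ℂ (p : S)).symm) z + (g ∘ (chartAt ℂ (p : S)).symm) z *
        deriv (X.h p ∘ (chartAt ℂ (p : S)).symm) z) ∘ chartAt ℂ (p : S), ?_, ?_⟩
  · refine MeromorphicAt.congr (hg'.deriv.add (hg'.mul hh'.deriv)) ?_
    filter_upwards [mem_nhdsWithin_of_mem_nhds (eventually_target hp)] with z hz
    simp [(chartAt ℂ (p : S)).right_inv hz]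
  · filter_upwards [(tendsto_chart_ne hp).eventually h,
      mem_nhdsWithin_of_mem_nhds (eventually_source hp)] with x hx hxs
    simpa [(chartAt ℂ (p : S)).left_inv hxs] using hx

/-- The poles of the types enter here: without a pole of h, f could be constant. -/
theorem differential_ne_zero [T1Space S] {f : S → ℂ} (hf : f ∈ X.O) {p : X.P}
    (hfp : ¬ ∀ᶠ x in 𝓝[≠] (p : S), f x = 0) :
    ¬ ∀ᶠ x in codiscrete S, differential f x = 0 := by
  intro h0
  rw [eventually_codiscrete_iff] at h0
  obtain ⟨g, hg, hfg⟩ := hf.1.2 p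
  have hp := mem_chart_source ℂ (p : S)
  have h := X.coeff_differential_puncture hf p hfg hg
  refine not_eventually_deriv_add_mul_deriv_eq_zero hg (X.pole p) ?_ ?_
  · intro hgt
    refine hfp ?_
    filter_upwards [ord_eq_top_iff.1 hgt, hfg] with x hx hx'
    rw [hx', hx, zero_mul]
  · filter_upwards [h, (tendsto_symm_ne hp).eventually (h0 p)] with z hz hz'
    have h1 : (coeff (differential f) p ∘ (chartAt ℂ (p : S)).symm) z = 0 := by
      rw [Function.comp_apply, coeff, hz', LinearMap.zero_apply]
    rw [h1] at hz
    exact (mul_eq_zero.1 hz.symm).resolve_right (Complex.exp_ne_zero _)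

theorem nontrivial_spaces [T2Space S] [CompactSpace S] :
    Nontrivial (Classes X.M) ∧ Nontrivial (Classes X.O) ∧ Nontrivial (Classes X.Om) ∧
      Nontrivial (Classes X.OmII) ∧ Nontrivial (Classes X.Om0) := by
  obtain ⟨f, hf, p, hfp⟩ := X.exists_mem_O
  have h1 : ¬ ∀ᶠ x in codiscrete S, f x = 0 := fun h =>
    hfp (eventually_codiscrete_iff.1 h p)
  have h2 := X.differential_ne_zero hf hfp
  have h3 := X.differential_mem_Om0 hf
  exact ⟨nontrivial_classes hf.1 h1, nontrivial_classes hf h1, nontrivial_classes h3.1 h2,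
    nontrivial_classes (A := X.OmII)
      ⟨h3.1, fun q hq => residueZeroAt_of_formHolAt (h3.2 q hq)⟩ h2, nontrivial_classes h3 h2⟩

end ExpCurve

/-! ### Local residues of logarithmic differentials -/

theorem contDiff_mul_of_analyticAt {g A : ℂ → ℂ} (hg : ContDiff ℝ 1 g)
    (h : ∀ z, g =ᶠ[𝓝 z] 0 ∨ AnalyticAt ℂ A z) : ContDiff ℝ 1 fun z => g z * A z := by
  rw [contDiff_iff_contDiffAt]
  intro z
  rcases h z with h | h
  · refine (contDiffAt_const (c := (0 : ℂ))).congr_of_eventuallyEq ?_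
    filter_upwards [h] with w hw
    rw [hw, Pi.zero_apply, zero_mul]
  · exact hg.contDiffAt.mul (h.contDiffAt.restrict_scalars ℝ)

theorem continuous_mul_of_analyticAt {g A : ℂ → ℂ} (hg : Continuous g)
    (h : ∀ z, g =ᶠ[𝓝 z] 0 ∨ AnalyticAt ℂ A z) : Continuous fun z => g z * A z := by
  rw [continuous_iff_continuousAt]
  intro z
  rcases h z with h | h
  · refine (continuousAt_const (y := (0 : ℂ))).congr ?_
    filter_upwards [h] with w hw
    rw [hw, Pi.zero_apply, zero_mul]
  · exact hg.continuousAt.mul h.continuousAt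

theorem dbar_eventuallyEq_zero {g : ℂ → ℂ} {z a : ℂ} (h : ∀ᶠ w in 𝓝 z, g w = a) :
    dbar g =ᶠ[𝓝 z] 0 := by
  filter_upwards [h.eventually_nhds] with w hw
  rw [dbar_congr (g := fun _ => a) hw, dbar_of_differentiableAt (differentiableAt_const a),
    Pi.zero_apply]

/-- Where A is analytic, ∂̄g · A = ∂̄(gA), and gA is C¹ with compact support. -/
theorem integral_dbar_mul_eq_zero {g A : ℂ → ℂ} (hg : ContDiff ℝ 1 g) (hc : HasCompactSupport g)
    (h : ∀ z, g =ᶠ[𝓝 z] 0 ∨ AnalyticAt ℂ A z) : ∫ z, dbar g z * A z = 0 := by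
  rw [← integral_dbar_eq_zero (contDiff_mul_of_analyticAt hg h) hc.mul_right]
  refine integral_congr_ae (Eventually.of_forall fun z => ?_)
  simp only
  rcases h z with h | h
  · have h2 : (fun w => g w * A w) =ᶠ[𝓝 z] fun _ => 0 := by
      filter_upwards [h] with w hw
      rw [hw, Pi.zero_apply, zero_mul]
    rw [dbar_congr h2, dbar_congr h, dbar_of_differentiableAt (differentiableAt_const _)]
    have h3 : dbar (0 : ℂ → ℂ) z = 0 := dbar_of_differentiableAt (differentiableAt_const _)
    rw [h3, zero_mul]
  · rw [dbar_mul_of_differentiableAt (hg.differentiable one_ne_zero z) h.differentiableAt]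

/-- Derivatives of functions with an isolated singularity have no residue. -/
theorem integral_dbar_mul_deriv_eq_zero {g H : ℂ → ℂ} {z₀ : ℂ} (hg : ContDiff ℝ ∞ g)
    (hc : HasCompactSupport g) (h1 : ∀ᶠ z in 𝓝 z₀, g z = 1)
    (h : ∀ z, z ≠ z₀ → g =ᶠ[𝓝 z] 0 ∨ AnalyticAt ℂ H z) : ∫ z, dbar g z * deriv H z = 0 := by
  have hgv : ∀ v, ContDiff ℝ 1 fun z => fderiv ℝ g z v := fun v =>
    (hg.fderiv_right (m := 1) (by norm_cast)).clm_apply contDiff_const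
  have hz : ∀ v z a, (∀ᶠ w in 𝓝 z, g w = a) → (fun z => fderiv ℝ g z v) =ᶠ[𝓝 z] 0 := by
    intro v z a h
    filter_upwards [h.eventually_nhds] with w hw
    rw [Filter.EventuallyEq.fderiv_eq (f := fun _ => a) hw]
    simp
  have hH : ∀ v z, (fun z => fderiv ℝ g z v) =ᶠ[𝓝 z] 0 ∨ AnalyticAt ℂ H z := by
    intro v z
    by_cases hzz : z = z₀
    · exact Or.inl (hz v z 1 (hzz ▸ h1))
    · exact (h z hzz).imp (hz v z 0) id
  have hcd := fun v => contDiff_mul_of_analyticAt (hgv v) (hH v)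
  have hcs : ∀ v, HasCompactSupport fun z => fderiv ℝ g z v * H z := fun v =>
    (hc.fderiv_apply ℝ v).mul_right
  have hint : ∀ v u, Integrable fun z => fderiv ℝ (fun z => fderiv ℝ g z v * H z) z u :=
    fun v u => (((hcd v).continuous_fderiv one_ne_zero).clm_apply
      continuous_const).integrable_of_hasCompactSupport ((hcs v).fderiv_apply ℝ u)
  -- The integrand is a curl: ∂_y(g_x H) - ∂_x(g_y H) = 2i ∂̄g · H', because the mixed second
  -- derivatives of g cancel and H_y = iH_x. The singularity of H is harmless, as dg vanishes near
  -- it.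
  have key : ∫ z, (fderiv ℝ (fun z => fderiv ℝ g z 1 * H z) z Complex.I -
      fderiv ℝ (fun z => fderiv ℝ g z Complex.I * H z) z 1) = 0 := by
    rw [integral_sub (hint _ _) (hint _ _), integral_fderiv_eq_zero (hcd _) (hcs _),
      integral_fderiv_eq_zero (hcd _) (hcs _), sub_zero]
  have hpt : ∀ z, fderiv ℝ (fun z => fderiv ℝ g z 1 * H z) z Complex.I -
      fderiv ℝ (fun z => fderiv ℝ g z Complex.I * H z) z 1 =
      2 * Complex.I * (dbar g z * deriv H z) := by
    intro z
    have hcase : (∃ a, ∀ᶠ w in 𝓝 z, g w = a) ∨ AnalyticAt ℂ H z := by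
      by_cases hzz : z = z₀
      · exact Or.inl ⟨1, hzz ▸ h1⟩
      · exact (h z hzz).imp (fun h => ⟨0, h⟩) id
    rcases hcase with ⟨a, ha⟩ | ha
    · have h2 : ∀ v, (fun z => fderiv ℝ g z v * H z) =ᶠ[𝓝 z] fun _ => 0 := by
        intro v
        filter_upwards [hz v z a ha] with w hw
        have hw' : fderiv ℝ g w v = 0 := hw
        rw [hw', zero_mul]
      rw [(h2 1).fderiv_eq, (h2 Complex.I).fderiv_eq, (dbar_eventuallyEq_zero ha).eq_of_nhds]
      simp
    · have hd : ∀ v, DifferentiableAt ℝ (fun z => fderiv ℝ g z v) z := fun v =>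
        (hgv v).differentiable one_ne_zero z
      have hHd := ha.differentiableAt
      have hHf : ∀ u, fderiv ℝ H z u = u * deriv H z := by
        intro u
        rw [hHd.fderiv_restrictScalars ℝ, ContinuousLinearMap.coe_restrictScalars',
          ← fderiv_apply_one_eq_deriv, ← smul_eq_mul, ← map_smul, smul_eq_mul, mul_one]
      have hsymm : fderiv ℝ (fun z => fderiv ℝ g z 1) z Complex.I =
          fderiv ℝ (fun z => fderiv ℝ g z Complex.I) z 1 := by
        have hs := (hg.contDiffAt (x := z)).isSymmSndFDerivAt (by simp; norm_cast)
        have hdd : DifferentiableAt ℝ (fderiv ℝ g) z :=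
          (hg.fderiv_right (m := 1) (by norm_cast)).differentiable one_ne_zero z
        have h3 : ∀ v u, fderiv ℝ (fun z => fderiv ℝ g z v) z u =
            fderiv ℝ (fderiv ℝ g) z u v := by
          intro v u
          rw [fderiv_clm_apply hdd (differentiableAt_const v)]
          simp
        rw [h3, h3]
        exact hs _ _
      rw [fderiv_fun_mul (hd _) (hHd.restrictScalars ℝ),
        fderiv_fun_mul (hd _) (hHd.restrictScalars ℝ)]
      simp only [add_apply, smul_apply, smul_eq_mul, hHf, hsymm, dbar]
      linear_combination (-fderiv ℝ g z Complex.I * deriv H z) * Complex.I_mul_I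
  simp_rw [hpt] at key
  rw [integral_const_mul] at key
  exact (mul_eq_zero.1 key).resolve_left (by simp)

/-- Of the three terms of A only n/(z - z₀) contributes, by Cauchy–Pompeiu and g(z₀) = 1. -/
theorem integral_dbar_mul_log {g A b H : ℂ → ℂ} {z₀ n : ℂ} {U : Set ℂ}
    (hg : ContDiff ℝ ∞ g)
    (hc : HasCompactSupport g) (hgU : tsupport g ⊆ U) (h1 : ∀ᶠ z in 𝓝 z₀, g z = 1)
    (hb : ∀ z ∈ U, AnalyticAt ℂ b z) (hH : ∀ z ∈ U, z ≠ z₀ → AnalyticAt ℂ H z)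
    (hA : ∀ z ∈ U, z ≠ z₀ → A z = n / (z - z₀) + b z + deriv H z) :
    ∫ z, dbar g z * A z = - Real.pi * n := by
  have hg1 : ContDiff ℝ 1 g := hg.of_le (by norm_cast)
  have hout : ∀ z ∉ U, g =ᶠ[𝓝 z] 0 := fun z hz =>
    notMem_tsupport_iff_eventuallyEq.1 fun h => hz (hgU h)
  have hd : ∀ z, (z ∉ U ∨ z = z₀) → dbar g =ᶠ[𝓝 z] 0 := by
    rintro z (hz | rfl)
    · exact dbar_eventuallyEq_zero (hout z hz)
    · exact dbar_eventuallyEq_zero h1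
  have hcase : ∀ z, (dbar g =ᶠ[𝓝 z] 0) ∨ (z ∈ U ∧ z ≠ z₀) := by
    intro z
    by_cases hz : z ∉ U ∨ z = z₀
    · exact Or.inl (hd z hz)
    · push Not at hz
      exact Or.inr hz
  have hint : ∀ B : ℂ → ℂ, (∀ z ∈ U, z ≠ z₀ → AnalyticAt ℂ B z) →
      Integrable fun z => dbar g z * B z := fun B hB =>
    (continuous_mul_of_analyticAt (continuous_dbar hg1)
      fun z => (hcase z).imp id fun h => hB z h.1 h.2).integrable_of_hasCompactSupport
      (HasCompactSupport.dbar hc).mul_right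
  have hi1 := hint (fun z => n / (z - z₀)) fun z _ hne =>
    analyticAt_const.div (analyticAt_id.sub analyticAt_const) (sub_ne_zero.2 hne)
  have hi2 := hint b fun z hz _ => hb z hz
  have hi3 := hint (deriv H) fun z hz hne => (hH z hz hne).deriv
  have heq : ∀ z, dbar g z * A z = (dbar g z * (n / (z - z₀)) + dbar g z * b z) +
      dbar g z * deriv H z := by
    intro z
    rcases hcase z with h | h
    · rw [h.eq_of_nhds]
      simp
    · rw [hA z h.1 h.2]
      ring
  have hi12 : Integrable fun z => dbar g z * (n / (z - z₀)) + dbar g z * b z := hi1.add hi2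
  simp_rw [heq]
  rw [integral_add hi12 hi3, integral_add hi1 hi2,
    integral_dbar_mul_eq_zero hg1 hc fun z => (em (z ∈ U)).symm.imp (hout z) (hb z),
    integral_dbar_mul_deriv_eq_zero hg hc h1 fun z hne =>
      (em (z ∈ U)).symm.imp (hout z) fun hz => hH z hz hne]
  have h2 := integral_dbar_div hg1 hc z₀
  have h3 : ∀ z, dbar g z * (n / (z - z₀)) = n * (dbar g z / (z - z₀)) := fun z => by ring
  simp_rw [h3]
  rw [integral_const_mul, h2, h1.self_of_nhds]
  ring

/-- The logarithmic derivative of `G e^H` near a point, where `G` and `H` are meromorphic. -/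
theorem logDeriv_local_form {F G H : ℂ → ℂ} {z₀ : ℂ} {n : ℤ} (hG : MeromorphicAt G z₀)
    (hH : MeromorphicAt H z₀) (hn : meromorphicOrderAt G z₀ = n)
    (hF : ∀ᶠ z in 𝓝[≠] z₀, F z = G z * Complex.exp (H z)) :
    ∃ b : ℂ → ℂ, ∀ᶠ z in 𝓝 z₀, AnalyticAt ℂ b z ∧ (z ≠ z₀ → AnalyticAt ℂ H z ∧
      logDeriv F z = n / (z - z₀) + b z + deriv H z) := by
  obtain ⟨g, hga, hg0, hg⟩ := (meromorphicOrderAt_eq_int_iff hG).1 hn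
  -- Here g is the non-vanishing analytic factor of G = (z - z₀)^n g.
  refine ⟨logDeriv g, ?_⟩
  have h1 : ∀ᶠ z in 𝓝[≠] z₀, F z = (z - z₀) ^ n * g z * Complex.exp (H z) := by
    filter_upwards [hF, hg] with z hz hz'
    rw [hz, hz', smul_eq_mul]
  have h2 := eventually_nhdsWithin_iff.1 (eventually_eventually_nhdsWithin.2 h1)
  have h3 := eventually_nhdsWithin_iff.1 hH.eventually_analyticAt
  filter_upwards [h2, h3, hga.eventually_analyticAt, hga.continuousAt.eventually_ne hg0]
    with z hz hHz hgz hgz0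
  refine ⟨hgz.deriv.div hgz hgz0, fun hne => ⟨hHz hne, ?_⟩⟩
  have h4 := hz hne
  rw [nhdsWithin_eq_nhds.2 (isOpen_compl_singleton.mem_nhds hne)] at h4
  have hsub : z - z₀ ≠ 0 := sub_ne_zero.2 hne
  have hd1 : DifferentiableAt ℂ (fun w => w - z₀) z := by fun_prop
  have hdz : DifferentiableAt ℂ (fun w => (w - z₀) ^ n) z :=
    hd1.zpow (Or.inl hsub)
  have h5 : logDeriv F z = logDeriv (fun z => (z - z₀) ^ n * g z * Complex.exp (H z)) z := by
    rw [logDeriv_apply, logDeriv_apply, Filter.EventuallyEq.deriv_eq h4, h4.self_of_nhds]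
  rw [h5, logDeriv_mul (f := fun z => (z - z₀) ^ n * g z) (g := fun z => Complex.exp (H z)) z
    (mul_ne_zero (zpow_ne_zero _ hsub) hgz0) (Complex.exp_ne_zero _)
    (hdz.mul hgz.differentiableAt) (hHz hne).differentiableAt.cexp,
    logDeriv_mul (f := fun z => (z - z₀) ^ n) (g := g) z (zpow_ne_zero _ hsub) hgz0 hdz hgz.differentiableAt, logDeriv_fun_zpow hd1]
  congr 1
  · congr 1
    rw [logDeriv_apply]
    simp [div_eq_mul_inv]
  · rw [logDeriv_apply, (hHz hne).differentiableAt.hasDerivAt.cexp.deriv,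
      mul_div_cancel_left₀ _ (Complex.exp_ne_zero _)]

/-! ### Integration of area forms -/

section Area

variable {S : Type*} [TopologicalSpace S] [ChartedSpace ℂ S]

/-- The integral, over the domain of the preferred chart at `c`, of the area form with coefficient `q`
in that chart. -/
def areaIntegral (c : S) (q : S → ℂ) : ℂ :=
  ∫ z in (chartAt ℂ c).target, q ((chartAt ℂ c).symm z)

theorem integrableOn_chart [CompactSpace S] {c : S} {q : S → ℂ} {K : Set S} (hK : IsClosed K)
    (hKc : K ⊆ (chartAt ℂ c).source) (h0 : ∀ x ∉ K, q x = 0)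
    (hq : ∀ x ∈ (chartAt ℂ c).source, ContinuousAt (q ∘ (chartAt ℂ c).symm) (chartAt ℂ c x)) :
    IntegrableOn (fun z => q ((chartAt ℂ c).symm z)) (chartAt ℂ c).target := by
  have hcK : IsCompact (chartAt ℂ c '' K) :=
    hK.isCompact.image_of_continuousOn ((chartAt ℂ c).continuousOn.mono hKc)
  have h1 : IntegrableOn (fun z => q ((chartAt ℂ c).symm z)) (chartAt ℂ c '' K) := by
    refine ContinuousOn.integrableOn_compact hcK ?_
    rintro _ ⟨x, hx, rfl⟩
    exact (hq x (hKc hx)).continuousWithinAt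
  refine h1.of_forall_sdiff_eq_zero (chartAt ℂ c).open_target.measurableSet fun z hz => h0 _ ?_
  exact fun h => hz.2 ⟨_, h, (chartAt ℂ c).right_inv hz.1⟩

theorem abs_det_fderiv_of_hasDerivAt (a : ℂ) :
    |((ContinuousLinearMap.toSpanSingleton ℂ a).restrictScalars ℝ : ℂ →L[ℝ] ℂ).det| = ‖a‖ ^ 2 := by
  have h : ((ContinuousLinearMap.toSpanSingleton ℂ a).restrictScalars ℝ : ℂ →L[ℝ] ℂ).toLinearMap =
      LinearMap.mul ℝ ℂ a := by
    ext
    simp [mul_comm]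
  rw [ContinuousLinearMap.det, h]
  have h2 := Algebra.norm_complex_apply a
  rw [Algebra.norm_apply] at h2
  rw [show (LinearMap.mul ℝ ℂ) a = Algebra.lmul ℝ ℂ a from rfl, h2, Complex.normSq_eq_norm_sq,
    abs_of_nonneg (by positivity)]

variable [IsManifold 𝓘(ℂ) ω S]

/-- The transition factor is |tr'|², the real Jacobian of the chart change; the vanishing hypotheses
restrict both integrals to the overlap. -/
theorem areaIntegral_eq {c d : S} {q r : S → ℂ}
    (hqr : ∀ x ∈ (chartAt ℂ d).source, x ∈ (chartAt ℂ c).source →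
      r x = conj (deriv (tr c d) (chartAt ℂ d x)) * deriv (tr c d) (chartAt ℂ d x) * q x)
    (hq : ∀ x ∈ (chartAt ℂ c).source, x ∉ (chartAt ℂ d).source → q x = 0)
    (hr : ∀ x ∈ (chartAt ℂ d).source, x ∉ (chartAt ℂ c).source → r x = 0) :
    areaIntegral c q = areaIntegral d r := by
  have hset : ∀ (a b : S) (p : S → ℂ), (∀ x ∈ (chartAt ℂ a).source, x ∉ (chartAt ℂ b).source →
      p x = 0) → areaIntegral a p = ∫ z in (chartAt ℂ a).target ∩ (chartAt ℂ a).symm ⁻¹'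
        (chartAt ℂ b).source, p ((chartAt ℂ a).symm z) := by
    intro a b p hp
    refine setIntegral_eq_of_subset_of_forall_sdiff_eq_zero (chartAt ℂ a).open_target.measurableSet
      inter_subset_left fun z hz => ?_
    exact hp _ ((chartAt ℂ a).map_target hz.1) fun h => hz.2 ⟨hz.1, h⟩
  rw [hset c d q hq, hset d c r hr]
  set s := (chartAt ℂ d).target ∩ (chartAt ℂ d).symm ⁻¹' (chartAt ℂ c).source with hs
  have hsm : MeasurableSet s :=
    ((chartAt ℂ d).isOpen_inter_preimage_symm (chartAt ℂ c).open_source).measurableSet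
  have himage : tr c d '' s =
      (chartAt ℂ c).target ∩ (chartAt ℂ c).symm ⁻¹' (chartAt ℂ d).source := by
    ext w
    constructor
    · rintro ⟨z, hz, rfl⟩
      refine ⟨(chartAt ℂ c).map_source hz.2, ?_⟩
      simp only [tr, Function.comp_apply, mem_preimage]
      rw [(chartAt ℂ c).left_inv hz.2]
      exact (chartAt ℂ d).map_target hz.1
    · intro hw
      refine ⟨chartAt ℂ d ((chartAt ℂ c).symm w), ⟨(chartAt ℂ d).map_source hw.2, ?_⟩, ?_⟩
      · rw [mem_preimage, (chartAt ℂ d).left_inv hw.2]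
        exact (chartAt ℂ c).map_target hw.1
      · rw [tr_apply hw.2, (chartAt ℂ c).right_inv hw.1]
  have hinj : InjOn (tr c d) s := by
    intro z hz w hw h
    have h1 := (chartAt ℂ c).injOn hz.2 hw.2 h
    rw [← (chartAt ℂ d).right_inv hz.1, ← (chartAt ℂ d).right_inv hw.1, h1]
  have hder : ∀ z ∈ s, HasFDerivWithinAt (tr c d) ((ContinuousLinearMap.toSpanSingleton ℂ
      (deriv (tr c d) z)).restrictScalars ℝ : ℂ →L[ℝ] ℂ) s z := by
    intro z hz
    have h1 := analyticAt_tr ((chartAt ℂ d).map_target hz.1) hz.2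
    rw [(chartAt ℂ d).right_inv hz.1] at h1
    exact (h1.differentiableAt.hasDerivAt.hasFDerivAt.restrictScalars ℝ).hasFDerivWithinAt
  rw [← himage, integral_image_eq_integral_abs_det_fderiv_smul volume hsm hder hinj]
  refine setIntegral_congr_fun hsm fun z hz => ?_
  rw [abs_det_fderiv_of_hasDerivAt, hqr _ ((chartAt ℂ d).map_target hz.1) hz.2,
    (chartAt ℂ d).right_inv hz.1, ← Complex.normSq_eq_conj_mul_self, Complex.normSq_eq_norm_sq,
    Complex.real_smul]
  simp only [tr, Function.comp_apply]
  rw [(chartAt ℂ c).left_inv hz.2]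

/-- The function `β c` is, for each `c`, the coefficient of one and the same continuous area form in
the preferred chart at `c`. -/
structure IsAreaForm (β : S → S → ℂ) : Prop where
  continuousAt : ∀ c, ∀ x ∈ (chartAt ℂ c).source,
    ContinuousAt (β c ∘ (chartAt ℂ c).symm) (chartAt ℂ c x)
  eq : ∀ c d, ∀ x ∈ (chartAt ℂ d).source, x ∈ (chartAt ℂ c).source →
    β d x = conj (deriv (tr c d) (chartAt ℂ d x)) * deriv (tr c d) (chartAt ℂ d x) * β c x

variable {J : Type*} [Fintype J]

/-- The integral of an area form, computed with a partition of unity. -/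
def integralArea (c : J → S) (ρ : J → S → ℂ) (β : S → S → ℂ) : ℂ :=
  ∑ j, areaIntegral (c j) fun x => ρ j x * β (c j) x

theorem continuousAt_mul_chart {ρ q : S → ℂ} {c x : S} (hρ : Continuous ρ)
    (hx : x ∈ (chartAt ℂ c).source) (hq : ContinuousAt (q ∘ (chartAt ℂ c).symm) (chartAt ℂ c x)) :
    ContinuousAt ((fun x => ρ x * q x) ∘ (chartAt ℂ c).symm) (chartAt ℂ c x) := by
  have h : ContinuousAt (ρ ∘ (chartAt ℂ c).symm) (chartAt ℂ c x) :=
    hρ.continuousAt.comp ((chartAt ℂ c).continuousAt_symm ((chartAt ℂ c).map_source hx))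
  exact h.mul hq

theorem integralArea_sum [CompactSpace S] {c : J → S} {ρ : J → S → ℂ} (hρ : ∀ j, Continuous (ρ j))
    (hρc : ∀ j, tsupport (ρ j) ⊆ (chartAt ℂ (c j)).source) {ι : Type*} [Fintype ι]
    {β : ι → S → S → ℂ} (hβ : ∀ i, IsAreaForm (β i)) :
    integralArea c ρ (fun c x => ∑ i, β i c x) = ∑ i, integralArea c ρ (β i) := by
  simp only [integralArea]
  rw [Finset.sum_comm]
  refine Finset.sum_congr rfl fun j _ => ?_
  have hint : ∀ i, IntegrableOn (fun z =>
      ρ j ((chartAt ℂ (c j)).symm z) * β i (c j) ((chartAt ℂ (c j)).symm z))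
      (chartAt ℂ (c j)).target := fun i =>
    integrableOn_chart (q := fun x => ρ j x * β i (c j) x) (isClosed_tsupport _) (hρc j)
      (fun x hx => by simp [image_eq_zero_of_notMem_tsupport hx])
      fun x hx => continuousAt_mul_chart (hρ j) hx ((hβ i).continuousAt _ x hx)
  simp only [areaIntegral, Finset.mul_sum]
  exact integral_finsetSum _ fun i _ => hint i

/-- Split the form with ρ and move each piece ρ j · β from the chart at d to the chart at c j. -/
theorem integralArea_eq [CompactSpace S] {c : J → S} {ρ : J → S → ℂ} (hρ : ∀ j, Continuous (ρ j))
    (hρc : ∀ j, tsupport (ρ j) ⊆ (chartAt ℂ (c j)).source) (hρ1 : ∀ x, ∑ j, ρ j x = 1)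
    {β : S → S → ℂ} (hβ : IsAreaForm β) {K : Set S} (hK : IsClosed K) {d : S}
    (hKd : K ⊆ (chartAt ℂ d).source)
    (h0 : ∀ c, ∀ x ∈ (chartAt ℂ c).source, x ∉ K → β c x = 0) :
    integralArea c ρ β = areaIntegral d (β d) := by
  have h1 : areaIntegral d (β d) = ∑ j, areaIntegral d fun x => ρ j x * β d x := by
    have hint : ∀ j, IntegrableOn (fun z => ρ j ((chartAt ℂ d).symm z) *
        β d ((chartAt ℂ d).symm z)) (chartAt ℂ d).target := by
      intro j
      -- `h0` says nothing outside the domain of the chart, where β d has arbitrary values; the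
      -- indicator removes them.
      have h := integrableOn_chart (q := K.indicator fun x => ρ j x * β d x) hK hKd
        (fun x hx => indicator_of_notMem hx _) fun x hx => by
          refine (continuousAt_mul_chart (hρ j) hx (hβ.continuousAt _ x hx)).congr ?_
          filter_upwards [(tendsto_symm hx).eventually (eventually_source hx)] with z hz
          by_cases hzK : (chartAt ℂ d).symm z ∈ K
          · simp [indicator_of_mem hzK]
          · simp [indicator_of_notMem hzK, h0 d _ hz hzK]
      refine h.congr_fun (fun z hz => ?_) (chartAt ℂ d).open_target.measurableSet
      by_cases hzK : (chartAt ℂ d).symm z ∈ K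
      · simp [indicator_of_mem hzK]
      · simp [indicator_of_notMem hzK, h0 d _ ((chartAt ℂ d).map_target hz) hzK]
    simp only [areaIntegral]
    rw [← integral_finsetSum _ fun j _ => hint j]
    refine integral_congr_ae (Eventually.of_forall fun z => ?_)
    simp only
    rw [← Finset.sum_mul, hρ1, one_mul]
  rw [h1]
  refine Finset.sum_congr rfl fun j _ => areaIntegral_eq (fun x hd hc => ?_) (fun x hc hd => ?_)
    fun x hd hc => ?_
  · rw [hβ.eq (c j) d x hd hc]
    ring
  · rw [h0 (c j) x hc fun h => hd (hKd h), mul_zero]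
  · rw [image_eq_zero_of_notMem_tsupport fun h => hc (hρc j h), zero_mul]

/-- The function `φ` read in the preferred chart at `c`, extended by zero. -/
def ext (c : S) (φ : S → ℂ) : ℂ → ℂ := (chartAt ℂ c).target.indicator (φ ∘ (chartAt ℂ c).symm)

theorem ext_eventuallyEq (c : S) (φ : S → ℂ) {z : ℂ} (hz : z ∈ (chartAt ℂ c).target) :
    ext c φ =ᶠ[𝓝 z] φ ∘ (chartAt ℂ c).symm := by
  filter_upwards [(chartAt ℂ c).open_target.mem_nhds hz] with w hw
  exact indicator_of_mem hw _

theorem isCompact_image_tsupport [CompactSpace S] {c : S} {φ : S → ℂ}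
    (hφ : tsupport φ ⊆ (chartAt ℂ c).source) : IsCompact (chartAt ℂ c '' tsupport φ) :=
  (isClosed_tsupport φ).isCompact.image_of_continuousOn ((chartAt ℂ c).continuousOn.mono hφ)

theorem ext_eq_zero {c : S} {φ : S → ℂ} {z : ℂ} (hz : z ∉ chartAt ℂ c '' tsupport φ) :
    ext c φ z = 0 := by
  rw [ext, indicator_apply_eq_zero]
  intro h
  by_contra h2
  exact hz ⟨_, subset_tsupport _ h2, (chartAt ℂ c).right_inv h⟩

theorem tsupport_ext_subset [CompactSpace S] {c : S} {φ : S → ℂ}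
    (hφ : tsupport φ ⊆ (chartAt ℂ c).source) : tsupport (ext c φ) ⊆ chartAt ℂ c '' tsupport φ :=
  closure_minimal (fun _ hz => by_contra fun h => hz (ext_eq_zero h))
    (isCompact_image_tsupport hφ).isClosed

theorem hasCompactSupport_ext [CompactSpace S] {c : S} {φ : S → ℂ}
    (hφ : tsupport φ ⊆ (chartAt ℂ c).source) : HasCompactSupport (ext c φ) :=
  (isCompact_image_tsupport hφ).of_isClosed_subset (isClosed_tsupport _) (tsupport_ext_subset hφ)

theorem ext_eventuallyEq_zero [CompactSpace S] {c : S} {φ : S → ℂ}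
    (hφ : tsupport φ ⊆ (chartAt ℂ c).source) {z : ℂ} (hz : z ∉ (chartAt ℂ c).target) :
    ext c φ =ᶠ[𝓝 z] 0 := by
  refine notMem_tsupport_iff_eventuallyEq.1 fun h => hz ?_
  obtain ⟨x, hx, rfl⟩ := tsupport_ext_subset hφ h
  exact (chartAt ℂ c).map_source (hφ hx)

theorem contDiff_ext [CompactSpace S] {c : S} {φ : S → ℂ}
    (hφs : ContMDiff 𝓘(ℝ, ℂ) 𝓘(ℝ, ℂ) ∞ φ) (hφ : tsupport φ ⊆ (chartAt ℂ c).source) :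
    ContDiff ℝ ∞ (ext c φ) := by
  rw [contDiff_iff_contDiffAt]
  intro z
  by_cases hz : z ∈ (chartAt ℂ c).target
  · refine ContDiffAt.congr_of_eventuallyEq ?_ (ext_eventuallyEq c φ hz)
    exact (contDiffOn_comp_symm hφs c).contDiffAt ((chartAt ℂ c).open_target.mem_nhds hz)
  · exact (contDiffAt_const (c := (0 : ℂ))).congr_of_eventuallyEq (ext_eventuallyEq_zero hφ hz)

theorem areaIntegral_dbarAt [CompactSpace S] {c : S} {φ : S → ℂ}
    (hφ : tsupport φ ⊆ (chartAt ℂ c).source) (A : ℂ → ℂ) :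
    areaIntegral c (fun x => dbarAt c φ x * A (chartAt ℂ c x)) = ∫ z, dbar (ext c φ) z * A z := by
  rw [areaIntegral, ← integral_indicator (chartAt ℂ c).open_target.measurableSet]
  refine integral_congr_ae (Eventually.of_forall fun z => ?_)
  by_cases hz : z ∈ (chartAt ℂ c).target
  · simp only [indicator_of_mem hz, dbarAt, (chartAt ℂ c).right_inv hz]
    rw [dbar_congr (ext_eventuallyEq c φ hz)]
  · simp only [indicator_of_notMem hz]
    rw [(dbar_eventuallyEq_zero (ext_eventuallyEq_zero hφ hz)).eq_of_nhds, Pi.zero_apply, zero_mul]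

end Area

/-! ### The degree of a divisor -/

section Log

variable {S : Type*} [TopologicalSpace S] [ChartedSpace ℂ S]

/-- The area form `∂̄σ ∧ df / f`, up to a constant factor. -/
def logForm (f σ : S → ℂ) (c x : S) : ℂ :=
  dbarAt c σ x * logDeriv (f ∘ (chartAt ℂ c).symm) (chartAt ℂ c x)

theorem dbarAt_eventually_eq_zero {σ : S → ℂ} {x : S} {a : ℂ} (h : ∀ᶠ y in 𝓝 x, σ y = a) (c : S)
    (hx : x ∈ (chartAt ℂ c).source) : ∀ᶠ y in 𝓝 x, dbarAt c σ y = 0 :=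
  (tendsto_chart hx).eventually (dbar_eventuallyEq_zero ((tendsto_symm hx).eventually h))

variable [IsManifold 𝓘(ℂ) ω S]

theorem analyticAt_logDeriv {f : S → ℂ} {c x : S} (hf : HolAt f x) (h0 : f x ≠ 0)
    (hx : x ∈ (chartAt ℂ c).source) :
    AnalyticAt ℂ (logDeriv (f ∘ (chartAt ℂ c).symm)) (chartAt ℂ c x) := by
  have h := (holAt_iff hx).1 hf
  refine h.deriv.div h ?_
  rwa [Function.comp_apply, (chartAt ℂ c).left_inv hx]

/-- In a change of charts ∂̄σ contributes the conjugate of tr' and df/f contributes tr'. The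
singularities of df/f are hidden where σ is locally constant. -/
theorem isAreaForm_logForm {f σ : S → ℂ} (hσ : ContMDiff 𝓘(ℝ, ℂ) 𝓘(ℝ, ℂ) ∞ σ)
    (h : ∀ x, (∃ a, ∀ᶠ y in 𝓝 x, σ y = a) ∨ (HolAt f x ∧ f x ≠ 0)) : IsAreaForm (logForm f σ) := by
  refine ⟨fun c x hx => ?_, fun c d x hd hc => ?_⟩
  · rcases h x with ⟨a, ha⟩ | ⟨hf, h0⟩
    · refine (continuousAt_const (y := (0 : ℂ))).congr ?_
      filter_upwards [(tendsto_symm hx).eventually (dbarAt_eventually_eq_zero ha c hx)] with z hz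
      simp [logForm, hz]
    · have h1 : ContinuousAt (dbar (σ ∘ (chartAt ℂ c).symm)) (chartAt ℂ c x) := by
        have h2 := ((contDiffAt_comp_symm hσ hx).fderiv_right (m := 0) (by simp)).continuousAt
        exact ((h2.clm_apply continuousAt_const).add
          (continuousAt_const.mul (h2.clm_apply continuousAt_const))).div_const 2
      refine (h1.mul (analyticAt_logDeriv hf h0 hx).continuousAt).congr ?_
      filter_upwards [eventually_target hx] with z hz
      simp only [Pi.mul_apply, Function.comp_apply, logForm, dbarAt, (chartAt ℂ c).right_inv hz]
  · rcases h x with ⟨a, ha⟩ | ⟨hf, h0⟩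
    · simp [logForm, (dbarAt_eventually_eq_zero ha _ hd).self_of_nhds,
        (dbarAt_eventually_eq_zero ha _ hc).self_of_nhds]
    · have h1 : logDeriv (f ∘ (chartAt ℂ d).symm) (chartAt ℂ d x) =
          logDeriv (f ∘ (chartAt ℂ c).symm) (chartAt ℂ c x) * deriv (tr c d) (chartAt ℂ d x) := by
        have h2 := comp_symm_eventuallyEq f hd hc
        rw [logDeriv_apply, h2.deriv_eq, h2.eq_of_nhds, ← logDeriv_apply, logDeriv_comp,
          tr_apply hd]
        · rw [tr_apply hd]
          exact ((holAt_iff hc).1 hf).differentiableAt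
        · exact (analyticAt_tr hd hc).differentiableAt
      rw [logForm, logForm, h1, dbarAt_eq hd hc (differentiableAt_comp_symm hσ hc)]
      ring

theorem areaIntegral_logForm_eq_zero [CompactSpace S] {f σ : S → ℂ} {c : S}
    (hσ : ContMDiff 𝓘(ℝ, ℂ) 𝓘(ℝ, ℂ) ∞ σ) (hc : tsupport σ ⊆ (chartAt ℂ c).source)
    (h : ∀ x, (∀ᶠ y in 𝓝 x, σ y = 0) ∨ (HolAt f x ∧ f x ≠ 0)) :
    areaIntegral c (logForm f σ c) = 0 := by
  refine (areaIntegral_dbarAt hc (logDeriv (f ∘ (chartAt ℂ c).symm))).trans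
    (integral_dbar_mul_eq_zero ((contDiff_ext hσ hc).of_le (by norm_cast))
      (hasCompactSupport_ext hc) fun z => ?_)
  by_cases hz : z ∈ (chartAt ℂ c).target
  · have hx := (chartAt ℂ c).map_target hz
    rcases h ((chartAt ℂ c).symm z) with h1 | h1
    · left
      have h2 := (tendsto_symm hx).eventually h1
      rw [(chartAt ℂ c).right_inv hz] at h2
      exact (ext_eventuallyEq c σ hz).trans h2
    · right
      have h2 := analyticAt_logDeriv h1.1 h1.2 hx
      rwa [(chartAt ℂ c).right_inv hz] at h2
  · exact Or.inl (ext_eventuallyEq_zero hc hz)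

/-- Σ ∂̄σ i = ∂̄1 = 0. To add the forms they must be integrated in common charts, and σ itself
serves as the partition of unity. -/
theorem sum_areaIntegral_logForm [CompactSpace S] {ι : Type*} [Fintype ι] {f : S → ℂ}
    {σ : ι → S → ℂ} {c : ι → S} (hσ : ∀ i, ContMDiff 𝓘(ℝ, ℂ) 𝓘(ℝ, ℂ) ∞ (σ i))
    (hc : ∀ i, tsupport (σ i) ⊆ (chartAt ℂ (c i)).source) (h1 : ∀ x, ∑ i, σ i x = 1)
    (h : ∀ i x, (∃ a, ∀ᶠ y in 𝓝 x, σ i y = a) ∨ (HolAt f x ∧ f x ≠ 0)) :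
    ∑ i, areaIntegral (c i) (logForm f (σ i) (c i)) = 0 := by
  have hβ := fun i => isAreaForm_logForm (hσ i) (h i)
  have hcont := fun i => (hσ i).continuous
  have heq : ∀ i, areaIntegral (c i) (logForm f (σ i) (c i)) =
      integralArea c σ (logForm f (σ i)) := by
    intro i
    refine (integralArea_eq hcont hc h1 (hβ i) (isClosed_tsupport (σ i)) (hc i)
      fun d x hx hxK => ?_).symm
    have h2 := dbarAt_eventually_eq_zero (notMem_tsupport_iff_eventuallyEq.1 hxK) d hx
    rw [logForm, h2.self_of_nhds, zero_mul]
  rw [Finset.sum_congr rfl fun i _ => heq i, ← integralArea_sum hcont hc hβ, integralArea]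
  refine Finset.sum_eq_zero fun j _ => ?_
  rw [areaIntegral, setIntegral_congr_fun (g := fun _ => (0 : ℂ))
    (chartAt ℂ (c j)).open_target.measurableSet, integral_zero]
  intro z hz
  have hx := (chartAt ℂ (c j)).map_target hz
  have h2 : ∑ i, dbarAt (c j) (σ i) ((chartAt ℂ (c j)).symm z) = 0 := by
    simp only [dbarAt]
    rw [← dbar_sum _ fun i _ => differentiableAt_comp_symm (hσ i) hx]
    simp only [Function.comp_apply, h1]
    exact dbar_of_differentiableAt (differentiableAt_const _)
  simp only [logForm, ← Finset.sum_mul, h2, zero_mul, mul_zero]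

/-- The contribution of one point to the degree of `f = g e^h`. -/
theorem exists_nhds_residue [CompactSpace S] {f g h : S → ℂ} {d : S} {n : ℤ} (hg : MeroAt g d)
    (hh : MeroAt h d) (hn : ord g d = n) (hf : ∀ x, f x = g x * Complex.exp (h x)) :
    ∃ N ∈ 𝓝 d, N ⊆ (chartAt ℂ d).source ∧ ∀ χ : S → ℂ, ContMDiff 𝓘(ℝ, ℂ) 𝓘(ℝ, ℂ) ∞ χ →
      tsupport χ ⊆ N → (∀ᶠ y in 𝓝 d, χ y = 1) →
        areaIntegral d (logForm f χ d) = - Real.pi * n := by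
  have hd := mem_chart_source ℂ d
  obtain ⟨b, hb⟩ := logDeriv_local_form (F := f ∘ (chartAt ℂ d).symm) hg hh hn
    (Eventually.of_forall fun z => hf _)
  refine ⟨_, inter_mem (eventually_source hd) ((tendsto_chart hd).eventually hb),
    inter_subset_left, fun χ hχ hχN hχ1 => ?_⟩
  have hχd := hχN.trans inter_subset_left
  refine (areaIntegral_dbarAt hχd (logDeriv (f ∘ (chartAt ℂ d).symm))).trans
    (integral_dbar_mul_log (contDiff_ext hχ hχd) (hasCompactSupport_ext hχd) subset_rfl ?_
    (b := b) (H := h ∘ (chartAt ℂ d).symm) (z₀ := chartAt ℂ d d) ?_ ?_ ?_)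
  · filter_upwards [ext_eventuallyEq d χ (mem_chart_target ℂ d), (tendsto_symm hd).eventually hχ1]
      with z hz hz'
    rw [hz, Function.comp_apply, hz']
  · intro z hz
    obtain ⟨x, hx, rfl⟩ := tsupport_ext_subset hχd hz
    exact (hχN hx).2.1
  · intro z hz hne
    obtain ⟨x, hx, rfl⟩ := tsupport_ext_subset hχd hz
    exact ((hχN hx).2.2 hne).1
  · intro z hz hne
    obtain ⟨x, hx, rfl⟩ := tsupport_ext_subset hχd hz
    exact ((hχN hx).2.2 hne).2

/-- If `f` has the form `g e^h` near each point `d` of a finite set `T`, with `g` and `h` meromorphic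
and `g` of order `n d`, and is holomorphic without zeros off `T`, then these orders add up to zero. -/
theorem sum_order_eq_zero [T2Space S] [CompactSpace S] {f : S → ℂ} {T : Finset S} {n : S → ℤ}
    (hT : ∀ d ∈ T, ∃ g h : S → ℂ, MeroAt g d ∧ MeroAt h d ∧ ord g d = n d ∧
      ∀ x, f x = g x * Complex.exp (h x))
    (hfT : ∀ x ∉ T, HolAt f x ∧ f x ≠ 0) : ∑ d ∈ T, n d = 0 := by
  have hN : ∀ d : T, ∃ χ : S → ℂ, ContMDiff 𝓘(ℝ, ℂ) 𝓘(ℝ, ℂ) ∞ χ ∧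
      tsupport χ ⊆ (chartAt ℂ (d : S)).source ∧ (∀ᶠ y in 𝓝 (d : S), χ y = 1) ∧
      (∀ e ∈ T, e ≠ d → ∀ᶠ y in 𝓝 e, χ y = 0) ∧
      areaIntegral (d : S) (logForm f χ d) = - Real.pi * n d := by
    intro d
    obtain ⟨g, h, hg, hh, hn, hf⟩ := hT d d.2
    obtain ⟨N, hN, hNd, hres⟩ := exists_nhds_residue hg hh hn hf
    -- Keeping the support away from the rest of T makes χ locally constant at every singular point.
    have h1 : ((T : Set S) \ {(d : S)})ᶜ ∈ 𝓝 (d : S) :=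
      (T.finite_toSet.subset sdiff_subset).isClosed.isOpen_compl.mem_nhds fun h => h.2 rfl
    obtain ⟨χ, hχ, hχN, hχ1⟩ := ExpCurve.exists_bump (inter_mem hN h1)
    have hχN' := hχN.trans inter_subset_left
    refine ⟨χ, hχ, hχN'.trans hNd, hχ1, fun e he hne => ?_, hres χ hχ hχN' hχ1⟩
    exact notMem_tsupport_iff_eventuallyEq.1 fun h => (hχN h).2 ⟨he, hne⟩
  choose χ hχ hχd hχ1 hχ0 hχres using hN
  obtain ⟨t, ht⟩ := isCompact_univ.elim_finite_subcover (fun x : S => (chartAt ℂ x).source)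
    (fun x => (chartAt ℂ x).open_source) fun x _ => mem_iUnion.2 ⟨x, mem_chart_source ℂ x⟩
  obtain ⟨ρ, hρ, hρt, hρ1⟩ := ExpCurve.exists_smooth_partition
    (O := fun j : t => (chartAt ℂ (j : S)).source) (fun j => (chartAt ℂ (j : S)).open_source)
    fun x => by
      obtain ⟨j, hj, hx⟩ := mem_iUnion₂.1 (ht (mem_univ x))
      exact ⟨⟨j, hj⟩, hx⟩
  -- The remainder vanishes near T; cut into charts by ρ, it completes the χ d to a partition of
  -- unity and contributes nothing to the sum.
  have hu : ContMDiff 𝓘(ℝ, ℂ) 𝓘(ℝ, ℂ) ∞ fun x => 1 - ∑ d, χ d x :=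
    contMDiff_const.sub (ContMDiff.sum fun d _ => hχ d)
  have hu0 : ∀ e ∈ T, ∀ᶠ y in 𝓝 e, 1 - ∑ d, χ d y = 0 := by
    intro e he
    have h1 : ∀ d : T, d ≠ ⟨e, he⟩ → ∀ᶠ y in 𝓝 e, χ d y = 0 := fun d hd =>
      hχ0 d e he fun h => hd (Subtype.ext h.symm)
    filter_upwards [eventually_all.2 fun d => eventually_imp_distrib_left.2 (h1 d),
      hχ1 ⟨e, he⟩] with y hy hy1
    rw [Finset.sum_eq_single_of_mem ⟨e, he⟩ (Finset.mem_univ _) fun d _ hd => hy d hd, hy1,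
      sub_self]
  have hρu : ∀ j, ContMDiff 𝓘(ℝ, ℂ) 𝓘(ℝ, ℂ) ∞ fun x => ρ j x * (1 - ∑ d, χ d x) := fun j =>
    (contDiff_fst.mul contDiff_snd : ContDiff ℝ ∞ fun z : ℂ × ℂ => z.1 * z.2).comp_contMDiff
      ((hρ j).prodMk_space hu)
  have hρut : ∀ j : t, tsupport (fun x => ρ j x * (1 - ∑ d, χ d x)) ⊆ (chartAt ℂ (j : S)).source :=
    fun j => (tsupport_mul_subset_left).trans (hρt j)
  have hρu0 : ∀ j x, (∀ᶠ y in 𝓝 x, ρ j y * (1 - ∑ d, χ d y) = 0) ∨ (HolAt f x ∧ f x ≠ 0) := by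
    intro j x
    by_cases hx : x ∈ T
    · left
      filter_upwards [hu0 x hx] with y hy
      rw [hy, mul_zero]
    · exact Or.inr (hfT x hx)
  have hsum := sum_areaIntegral_logForm (f := f)
    (σ := Sum.elim (fun (j : t) x => ρ j x * (1 - ∑ d, χ d x)) χ)
    (c := Sum.elim (fun j : t => (j : S)) fun d : T => (d : S))
    (by
      rintro (j | d)
      exacts [hρu j, hχ d])
    (by
      rintro (j | d)
      exacts [hρut j, hχd d])
    (fun x => by
      simp only [Fintype.sum_sum_type, Sum.elim_inl, Sum.elim_inr]
      rw [← Finset.sum_mul, hρ1]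
      ring)
    (by
      rintro (j | d) x
      · exact (hρu0 j x).imp_left fun h => ⟨0, h⟩
      · by_cases hx : x ∈ T
        · left
          by_cases hxd : x = d
          · exact ⟨1, hxd ▸ hχ1 d⟩
          · exact ⟨0, hχ0 d x hx hxd⟩
        · exact Or.inr (hfT x hx))
  have hsum0 := fun j => areaIntegral_logForm_eq_zero (hρu j) (hρut j) (hρu0 j)
  simp only [Fintype.sum_sum_type, Sum.elim_inl, Sum.elim_inr, hχres, hsum0,
    Finset.sum_const_zero, zero_add] at hsum
  rw [← Finset.mul_sum] at hsum
  have h2 := (mul_eq_zero.1 hsum).resolve_left (by simp [Real.pi_ne_zero])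
  rw [Finset.sum_coe_sort T fun d => (n d : ℂ)] at h2
  exact_mod_cast h2

end Log

/-! ### Finiteness and degree of the divisor -/

namespace ExpCurve

variable {S : Type*} [TopologicalSpace S] [ChartedSpace ℂ S] [IsManifold 𝓘(ℂ) ω S]
variable (X : ExpCurve S)

/-- Treats punctures and ordinary points alike, with h = 0 at the latter. -/
theorem exists_eq_mul_exp {f : S → ℂ} (hf : f ∈ X.M) (p : S) :
    ∃ g h : S → ℂ, MeroAt g p ∧ MeroAt h p ∧ ord g p = X.div f p ∧
      ∀ x, f x = g x * Complex.exp (h x) := by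
  by_cases hp : p ∈ X.P
  · refine ⟨fun x => f x * Complex.exp (-X.h ⟨p, hp⟩ x), X.h ⟨p, hp⟩,
      hasExpType_iff.1 (hf.2 ⟨p, hp⟩), X.mero ⟨p, hp⟩, by rw [div, dif_pos hp], fun x => ?_⟩
    rw [mul_assoc, ← Complex.exp_add]
    simp
  · exact ⟨f, fun _ => 0, hf.1 p hp, MeroAt.zero p, by rw [div, dif_neg hp], by simp⟩

theorem eventually_holAt_ne_zero [T1Space S] {f : S → ℂ} (hf : f ∈ X.M) {p : S}
    (h : X.div f p ≠ ⊤) : ∀ᶠ x in 𝓝[≠] p, x ∉ X.P ∧ HolAt f x ∧ f x ≠ 0 := by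
  obtain ⟨g, h, hg, hh, hgp, hfg⟩ := X.exists_eq_mul_exp hf p
  obtain rfl := funext hfg
  rw [← hgp] at h
  filter_upwards [X.eventually_notMem_P p, hg.eventually_holAt, hh.eventually_holAt,
    hg.eventually_ne_zero h] with x hx hgx hhx hgx0
  exact ⟨hx, hgx.mul hhx.cexp, mul_ne_zero hgx0 (Complex.exp_ne_zero _)⟩

theorem eventually_eq_zero {f : S → ℂ} (hf : f ∈ X.M) {p : S} (h : X.div f p = ⊤) :
    ∀ᶠ x in 𝓝[≠] p, f x = 0 := by
  obtain ⟨g, h', hg, hh, hgp, hfg⟩ := X.exists_eq_mul_exp hf p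
  filter_upwards [ord_eq_top_iff.1 (hgp.trans h)] with x hx
  rw [hfg, hx, zero_mul]

theorem div_of_holAt {f : S → ℂ} {p : S} (h : p ∉ X.P ∧ HolAt f p ∧ f p ≠ 0) : X.div f p = 0 := by
  rw [div, dif_neg h.1, h.2.1.ord_eq_zero h.2.2]

/-- Identity theorem: a germ that vanishes does so at all nearby points, and one that does not is
holomorphic and nonzero at all nearby points, so the set of points of infinite order is clopen. -/
theorem div_ne_top [T1Space S] [PreconnectedSpace S] {f : S → ℂ} (hf : f ∈ X.M)
    (h0 : ¬ ∀ᶠ x in codiscrete S, f x = 0) (p : S) : X.div f p ≠ ⊤ := by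
  have hclopen : IsClopen {x | X.div f x = ⊤} := by
    constructor
    · rw [← isOpen_compl_iff, isOpen_iff_eventually]
      intro x hx
      have h := X.eventually_holAt_ne_zero hf hx
      rw [eventually_nhdsWithin_iff] at h
      filter_upwards [h] with y hy
      by_cases hyx : y = x
      · rwa [hyx]
      · change X.div f y ≠ ⊤
        rw [X.div_of_holAt (hy hyx)]
        exact WithTop.zero_ne_top
    · rw [isOpen_iff_eventually]
      intro x hx
      have h := eventually_nhdsWithin_iff.1 ((eventually_eventually_nhdsWithin.2
        (X.eventually_eq_zero hf hx)).and (X.eventually_notMem_P x))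
      filter_upwards [h] with y hy
      by_cases hyx : y = x
      · rwa [hyx]
      · rw [div, dif_neg (hy hyx).2, ord_eq_top_iff]
        refine Eventually.filter_mono nhdsWithin_le_nhds ?_
        have h2 := (hy hyx).1
        rwa [nhdsWithin_eq_nhds.2 (isOpen_compl_singleton.mem_nhds hyx)] at h2
  rcases isClopen_iff.1 hclopen with h | h
  · exact fun hp => (h ▸ (show p ∈ {x | X.div f x = ⊤} from hp) : p ∈ (∅ : Set S))
  · refine absurd (eventually_codiscrete_iff.2 fun q => X.eventually_eq_zero hf ?_) h0
    exact (h ▸ mem_univ q : q ∈ {x | X.div f x = ⊤})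

/-- The divisor of a nonzero element of `M` is finite, of degree zero. -/
theorem exists_div_eq [T2Space S] [CompactSpace S] [PreconnectedSpace S] {f : S → ℂ} (hf : f ∈ X.M)
    (h0 : ¬ ∀ᶠ x in codiscrete S, f x = 0) :
    ∃ D : S →₀ ℤ, (∀ p, X.div f p = (D p : WithTop ℤ)) ∧ (D.sum fun _ m => m) = 0 := by
  choose n hn using fun p => WithTop.ne_top_iff_exists.1 (X.div_ne_top hf h0 p)
  -- On a compact space the complement of a codiscrete set is finite.
  have hfin : {x | ¬ (x ∉ X.P ∧ HolAt f x ∧ f x ≠ 0)}.Finite := by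
    have h1 : ∀ᶠ x in codiscrete S, x ∉ X.P ∧ HolAt f x ∧ f x ≠ 0 :=
      eventually_codiscrete_iff.2 fun p => X.eventually_holAt_ne_zero hf (X.div_ne_top hf h0 p)
    refine (isCompact_univ.finite_sdiff_of_mem_codiscreteWithin h1).subset fun x hx => ⟨mem_univ x, hx⟩
  have hT : ∀ x ∉ hfin.toFinset, x ∉ X.P ∧ HolAt f x ∧ f x ≠ 0 := fun x hx =>
    not_not.1 fun h => hx (hfin.mem_toFinset.2 h)
  refine ⟨Finsupp.onFinset hfin.toFinset n fun p hp => ?_, fun p => (hn p).symm, ?_⟩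
  · by_contra h
    have h2 := hn p
    rw [X.div_of_holAt (hT p h)] at h2
    exact hp (WithTop.coe_eq_zero.1 h2)
  · rw [Finsupp.onFinset_sum _ fun _ => rfl]
    refine sum_order_eq_zero (f := f) (fun d _ => ?_) fun x hx => (hT x hx).2
    rw [hn]
    exact X.exists_eq_mul_exp hf d

end ExpCurve

namespace Cover

variable {S : Type*} [TopologicalSpace S] [ChartedSpace ℂ S] [IsManifold 𝓘(ℂ) ω S]
variable {X : ExpCurve S} (C : Cover X)

theorem hasDegree_zero [T2Space S] [CompactSpace S] [ConnectedSpace S] : HasDegree C.L 0 := by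
  refine ⟨?_, fun s hs => ?_⟩
  · obtain ⟨Φ, -⟩ := C.exists_section_equiv
    have := X.nontrivial_spaces.1
    exact Φ.toEquiv.nontrivial
  · have h0 : ¬ ∀ᶠ x in codiscrete S, C.tensorDual s.1 x = 0 := by
      simp only [C.tensorDual_eq_zero_iff]
      exact cls_ne_zero_iff.1 hs
    obtain ⟨D, hD, hD0⟩ := X.exists_div_eq (C.tensorDual_mem_iff.2 s.2) h0
    refine ⟨D, fun p => ?_, hD0⟩
    rw [← hD, ← C.secOrd_mulSection, C.mulSection_tensorDual]

end Cover

end ExpAlg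

end

theorem theorem3p1 {S : Type*} [TopologicalSpace S] [T2Space S] [CompactSpace S]
    [ConnectedSpace S] [ChartedSpace ℂ S] [IsManifold 𝓘(ℂ) ω S] (X : ExpAlg.ExpCurve S) :
    Nonempty (ExpAlg.Cover X) ∧
    (∀ C : ExpAlg.Cover X,
      ExpAlg.HasDegree C.L 0 ∧
      (∃ Φ : ExpAlg.Classes (ExpAlg.meroSections C.L) ≃ₗ[ℂ] ExpAlg.Classes X.M,
        (∀ s : ExpAlg.meroSections C.L, ∃ hs : C.tensorDual s.1 ∈ X.M,
          Φ (ExpAlg.cls _ s) = ExpAlg.cls _ ⟨C.tensorDual s.1, hs⟩) ∧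
        (∀ f : X.M, ∃ hf : C.mulSection f.1 ∈ ExpAlg.meroSections C.L,
          Φ.symm (ExpAlg.cls _ f) = ExpAlg.cls _ ⟨C.mulSection f.1, hf⟩) ∧
        (∀ s : ExpAlg.meroSections C.L, ∀ p, X.div (C.tensorDual s.1) p = ExpAlg.secOrd s.1 p) ∧
        (∀ f : X.M, ∀ p, ExpAlg.secOrd (C.mulSection f.1) p = X.div f.1 p)) ∧
      (∃ Ψ : ExpAlg.Classes (ExpAlg.meroForms C.L) ≃ₗ[ℂ] ExpAlg.Classes X.Om,
        (∀ a : ExpAlg.meroForms C.L, ∃ ha : C.formTensorDual a.1 ∈ X.Om,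
          Ψ (ExpAlg.cls _ a) = ExpAlg.cls _ ⟨C.formTensorDual a.1, ha⟩) ∧
        (∀ w : X.Om, ∃ hw : C.formMulSection w.1 ∈ ExpAlg.meroForms C.L,
          Ψ.symm (ExpAlg.cls _ w) = ExpAlg.cls _ ⟨C.formMulSection w.1, hw⟩) ∧
        (∀ a : ExpAlg.meroForms C.L, ∀ p,
          X.formDiv (C.formTensorDual a.1) p = ExpAlg.formSecOrd a.1 p) ∧
        (∀ w : X.Om, ∀ p, ExpAlg.formSecOrd (C.formMulSection w.1) p = X.formDiv w.1 p))) ∧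
    Nontrivial (ExpAlg.Classes X.M) ∧ Nontrivial (ExpAlg.Classes X.O) ∧
    Nontrivial (ExpAlg.Classes X.Om) ∧ Nontrivial (ExpAlg.Classes X.OmII) ∧
    Nontrivial (ExpAlg.Classes X.Om0) :=
  ⟨X.nonempty_cover, fun C => ⟨C.hasDegree_zero, C.exists_section_equiv, C.exists_form_equiv⟩,
    X.nontrivial_spaces⟩
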